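/- A stabilizer zx-diagram with \(n\) inputs and \(m\) outputs is an open multigraph built from green and red nodes (any number of legs, phase in \(\{0,\pi/2,\pi,-\pi/2\}\)), two-legged Hadamard nodes and bare wires. It represents the matrix \([\![D]\!]\) obtained by contracting, along the wires, the matrices \(|0\rangle^{\otimes m}\langle 0|^{\otimes n}+e^{i\alpha}|1\rangle^{\otimes m}\langle 1|^{\otimes n}\) (green), \(|+\rangle^{\otimes m}\langle +|^{\otimes n}+e^{i\alpha}|-\rangle^{\otimes m}\langle -|^{\otimes n}\) (red) and \(|+\rangle\langle 0|+|-\rangle\langle 1|\) (Hadamard). Diagrams are rewritten with the standard rules of the stabilizer zx-calculus (only the topology matters; spider, loop, cup, bialgebra, copy, colour change, \(\pi\)-copy, \(\pi\)-commutation and Euler decomposition of the Hadamard node, each also with the colours exchanged and upside down), used in their unscaled form, so that a step preserves the matrix up to a non-zero factor; scalar subdiagrams are never discarded. A diagram is in normal form with decomposed scalars if it consists of (i) a GS-LC diagram on all inputs and outputs (the inputs bent up to become outputs), i.e. one phaseless green node per input or output, a Hadamard node on each edge of a simple graph on these nodes, and a chain of phase shifts and Hadamard nodes (a single-qubit Clifford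 operator) between each green node and its input or output; and (ii) any number of disconnected scalar segments, each of which is either a single green or red node without legs, or a green and a red node joined by exactly one wire. Then every stabilizer diagram \(D\) can be rewritten into a diagram in normal form with decomposed scalars. For every diagram \(D'\) of this form into which \(D\) can be rewritten, \(D\) is a zero diagram (\([\![D]\!]=0\)) if and only if \(D'\) contains at least one of the following four scalars: the green node with phase \(\pi\) and no legs; the red node with phase \(\pi\) and no legs; a green node with phase \(\pi/2\) and a red node with phase \(-\pi/2\) joined by one wire; a green node with phase \(-\pi/2\) and a red node with phase \(\pi/2\) joined by one wire. In particular, whether a stabilizer diagram is a zero diagram is decidable: there is an algorithm (a computable function) which, given a finite description of a diagram \(D\), decides whether \([\![D]\!]=0\). -/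

import Mathlib

namespace ZX

/-- The wires (edges) of a diagram with `n` inputs and `m` outputs: each input and each output
is a wire with one free end; the inner wires are named by natural numbers. -/
inductive Wire (n m : ℕ) : Type
  | input (i : Fin n)
  | output (j : Fin m)
  | inner (k : ℕ)
  deriving DecidableEq

/-- The two colours of phased nodes. -/
inductive Colour : Type
  | green
  | red
  deriving DecidableEq

/-- The other colour. -/
def Colour.swap : Colour → Colour
  | green => red
  | red => green

/-- The constituents of a stabilizer diagram, with the wires they are attached to.
The phase `a : ZMod 4` stands for the angle `a * π / 2`, so `0, 1, 2, 3` are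
`0, π/2, π, -π/2`. A `cord a b` is a piece of bare wire (identity, cup or cap) with ends `a`, `b`;
it is not a node. -/
inductive Piece (n m : ℕ) : Type
  | node (c : Colour) (α : ZMod 4) (legs : Multiset (Wire n m))
  | had (a b : Wire n m)
  | cord (a b : Wire n m)

section Basic

variable {n m : ℕ}

/-- The wire ends at a piece. -/
def Piece.legs : Piece n m → Multiset (Wire n m)
  | .node _ _ l => l
  | .had a b => {a, b}
  | .cord a b => {a, b}

/-- Re-attach a piece along a map of wires. -/
def Piece.map (f : Wire n m → Wire n m) : Piece n m → Piece n m
  | .node c α l => .node c α (l.map f)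
  | .had a b => .had (f a) (f b)
  | .cord a b => .cord (f a) (f b)

/-- Renaming of the inner wires. -/
def Wire.rename (σ : Equiv.Perm ℕ) : Wire n m → Wire n m
  | .input i => .input i
  | .output j => .output j
  | .inner k => .inner (σ k)

/-- The name of a wire, if it is an inner one. -/
def Wire.innerName : Wire n m → Option ℕ
  | .inner k => some k
  | _ => none

end Basic

/-- A stabilizer diagram with `n` inputs and `m` outputs, as an open multigraph: every input and
every output is attached exactly once, and every inner wire in use has exactly two ends. -/
structure Diagram (n m : ℕ) : Type where
  pieces : Multiset (Piece n m)
  input_once : ∀ i, (pieces.bind Piece.legs).count (Wire.input i) = 1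
  output_once : ∀ j, (pieces.bind Piece.legs).count (Wire.output j) = 1
  inner_twice : ∀ k, (pieces.bind Piece.legs).count (Wire.inner k) = 0 ∨
    (pieces.bind Piece.legs).count (Wire.inner k) = 2

noncomputable section Semantics

variable {n m : ℕ}

/-- The complex number `exp (i α)` for the angle `α = a * π / 2`. -/
def phase (a : ZMod 4) : ℂ := Complex.exp (((a.val : ℝ) * (Real.pi / 2) : ℝ) * Complex.I)

/-- Coordinates of `|0⟩`. -/
def ket0 (b : Fin 2) : ℂ := if b = 0 then 1 else 0

/-- Coordinates of `|1⟩`. -/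
def ket1 (b : Fin 2) : ℂ := if b = 1 then 1 else 0

/-- Coordinates of `|+⟩`. -/
def ketPlus (b : Fin 2) : ℂ := (1 / (Real.sqrt 2 : ℂ)) * (ket0 b + ket1 b)

/-- Coordinates of `|-⟩`. -/
def ketMinus (b : Fin 2) : ℂ := (1 / (Real.sqrt 2 : ℂ)) * (ket0 b - ket1 b)

/-- The matrix entry of a piece when its wires carry the basis labels `v`. The vectors
`|0⟩, |1⟩, |+⟩, |-⟩`  real coordinates, so an input leg and an output leg of a node contribute
the same factor. -/
def Piece.entry (v : Wire n m → Fin 2) : Piece n m → ℂ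
  | .node .green α l =>
      (l.map fun w => ket0 (v w)).prod + phase α * (l.map fun w => ket1 (v w)).prod
  | .node .red α l =>
      (l.map fun w => ketPlus (v w)).prod + phase α * (l.map fun w => ketMinus (v w)).prod
  | .had a b => ketPlus (v b) * ket0 (v a) + ketMinus (v b) * ket1 (v a)
  | .cord a b => if v a = v b then 1 else 0

/-- The labelling of the wires given by basis labels `x` of the inputs, `y` of the outputs and the
set `s` of inner wires that carry the label `1`. -/
def labelling (x : Fin n → Fin 2) (y : Fin m → Fin 2) (s : Finset ℕ) : Wire n m → Fin 2
  | .input i => x i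
  | .output j => y j
  | .inner k => if k ∈ s then 1 else 0

/-- The inner wires of a diagram. -/
def Diagram.innerWires (D : Diagram n m) : Finset ℕ :=
  ((D.pieces.bind Piece.legs).filterMap Wire.innerName).toFinset

/-- The matrix represented by a diagram: tensor product of the matrices of the pieces, contracted
along all inner wires. -/
def Diagram.interp (D : Diagram n m) : Matrix (Fin m → Fin 2) (Fin n → Fin 2) ℂ :=
  Matrix.of fun y x => ∑ s ∈ D.innerWires.powerset,
    (D.pieces.map fun e => e.entry (labelling x y s)).prod

end Semantics

section Rewriting

variable {n m : ℕ}

open Wire Piece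

/-- The rewrite rules, as pairs of diagram fragments with the same free wire ends. The first three
belong to the rule that only the topology matters. Each rule is stated for either colour. -/
inductive Rule : Multiset (Piece n m) → Multiset (Piece n m) → Prop
  /-- A bare wire can be turned around. -/
  | cord_symm (a b : Wire n m) : Rule {cord a b} {cord b a}
  /-- A Hadamard node can be turned around. -/
  | had_symm (a b : Wire n m) : Rule {had a b} {had b a}
  /-- A bare wire can be absorbed into the wire that it prolongs. -/
  | cord_join (a : Wire n m) (k : ℕ) (e : Piece n m) (h : e.legs.count (inner k) = 1) :
      Rule {cord a (inner k), e} {e.map fun w => if w = inner k then a else w}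
  /-- Two nodes of the same colour that are joined by a wire merge and their phases add. -/
  | spider (c : Colour) (α β : ZMod 4) (k : ℕ) (A B : Multiset (Wire n m)) :
      Rule {node c α (inner k ::ₘ A), node c β (inner k ::ₘ B)} {node c (α + β) (A + B)}
  /-- Self-loops can be removed. -/
  | loop (c : Colour) (α : ZMod 4) (k : ℕ) (A : Multiset (Wire n m)) :
      Rule {node c α (inner k ::ₘ inner k ::ₘ A)} {node c α A}
  /-- A phaseless node with two legs is a bare wire. -/
  | cup (c : Colour) (a b : Wire n m) : Rule {node c 0 {a, b}} {cord a b}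
  /-- Bialgebra rule. -/
  | bialgebra (c : Colour) (a₁ a₂ b₁ b₂ : Wire n m) (k₁₁ k₁₂ k₂₁ k₂₂ k : ℕ) :
      Rule
        {node c 0 {a₁, inner k₁₁, inner k₁₂}, node c 0 {a₂, inner k₂₁, inner k₂₂},
          node c.swap 0 {inner k₁₁, inner k₂₁, b₁}, node c.swap 0 {inner k₁₂, inner k₂₂, b₂}}
        {node c.swap 0 {a₁, a₂, inner k}, node c 0 {inner k, b₁, b₂}}
  /-- Copy rule. -/
  | copy (c : Colour) (k : ℕ) (a b : Wire n m) :
      Rule {node c.swap 0 {inner k}, node c 0 {inner k, a, b}}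
        {node c.swap 0 {a}, node c.swap 0 {b}}
  /-- Colour change rule: Hadamard nodes on all legs. A pair `p` in `P` is a leg of the node, with
  the wire `p.1` between the node and the Hadamard node and the wire `p.2` beyond it. -/
  | colour (c : Colour) (α : ZMod 4) (P : Multiset (ℕ × Wire n m)) :
      Rule (node c α (P.map fun p => inner p.1) ::ₘ P.map fun p => had (inner p.1) p.2)
        {node c.swap α (P.map fun p => p.2)}
  /-- `π`-copy rule, with the copies of the `π` phase shift on the legs listed in `P`. -/
  | pi_copy (c : Colour) (a : Wire n m) (k : ℕ) (P : Multiset (ℕ × Wire n m)) :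
      Rule {node c.swap 2 {a, inner k}, node c 0 (inner k ::ₘ P.map fun p => p.2)}
        (node c 0 (a ::ₘ P.map fun p => inner p.1) ::ₘ
          P.map fun p : ℕ × Wire n m => node c.swap 2 {inner p.1, p.2})
  /-- `π`-commutation rule. -/
  | pi_comm (c : Colour) (α : ZMod 4) (a b : Wire n m) (k k' : ℕ) :
      Rule {node c.swap 2 {a, inner k}, node c α {inner k, b}}
        {node c (-α) {a, inner k'}, node c.swap 2 {inner k', b}}
  /-- Euler decomposition of the Hadamard node. -/
  | euler (c : Colour) (a b : Wire n m) (k k' : ℕ) :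
      Rule {had a b}
        {node c 1 {a, inner k}, node c.swap 1 {inner k, inner k'}, node c 1 {inner k', b}}

/-- Graphical derivability: the equivalence relation generated by the rewrite rules, applied
anywhere inside a diagram, and by renaming the inner wires. Since both `D` and `D'` are diagrams,
the wires that are inner to either side of a rule do not occur in the surroundings `C`. -/
inductive Diagram.Rewrites : Diagram n m → Diagram n m → Prop
  | rule (D D' : Diagram n m) (L R C : Multiset (Piece n m)) (h : Rule L R)
      (hD : D.pieces = L + C) (hD' : D'.pieces = R + C) : Rewrites D D'
  | rename (D D' : Diagram n m) (σ : Equiv.Perm ℕ)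
      (h : D'.pieces = D.pieces.map (Piece.map (Wire.rename σ))) : Rewrites D D'
  | refl (D : Diagram n m) : Rewrites D D
  | symm (D D' : Diagram n m) (h : Rewrites D D') : Rewrites D' D
  | trans (D D' D'' : Diagram n m) (h : Rewrites D D') (h' : Rewrites D' D'') : Rewrites D D''

end Rewriting

section NormalForm

variable {n m : ℕ}

open Wire Piece

/-- `LocalClifford a b E`: `E` is a chain of phase shifts and Hadamard nodes leading from the
wire `a` to the wire `b`, i.e. a single-qubit Clifford operator. -/
inductive LocalClifford : Wire n m → Wire n m → Multiset (Piece n m) → Prop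
  | nil (a : Wire n m) : LocalClifford a a 0
  | shift (c : Colour) (α : ZMod 4) (a b : Wire n m) (k : ℕ) (E : Multiset (Piece n m))
      (h : LocalClifford a (inner k) E) : LocalClifford a b (node c α {inner k, b} ::ₘ E)
  | had (a b : Wire n m) (k : ℕ) (E : Multiset (Piece n m))
      (h : LocalClifford a (inner k) E) : LocalClifford a b (had (inner k) b ::ₘ E)

/-- The wire of an input or output. All of them count as outputs of a state, by bending the
inputs up. -/
def boundary : Fin n ⊕ Fin m → Wire n m
  | .inl i => input i
  | .inr j => output j

/-- `GraphState edges out l r`: the graph state whose vertices are the inputs and outputs, with one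
Hadamard node for each edge in `edges`. The output of the vertex `v` is the wire `out v`. The
Hadamard node of the edge `e` is attached to the vertex `e.1` by the inner wire `l e` and to the
vertex `e.2` by the inner wire `r e`. -/
def GraphState (edges : Finset ((Fin n ⊕ Fin m) × (Fin n ⊕ Fin m)))
    (out : Fin n ⊕ Fin m → Wire n m) (l r : (Fin n ⊕ Fin m) × (Fin n ⊕ Fin m) → ℕ) :
    Multiset (Piece n m) :=
  (Finset.univ.val.map fun v => node Colour.green 0
    (out v ::ₘ ((edges.filter fun e => e.1 = v).val.map fun e => inner (l e)) +
      (edges.filter fun e => e.2 = v).val.map fun e => inner (r e))) +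
  edges.val.map fun e => had (inner (l e)) (inner (r e))

/-- GS-LC form: a graph state with a single-qubit Clifford operator on each output. The underlying
graph is simple; `edges` holds each of its edges once, in one of the two orientations. -/
def IsGSLC (E : Multiset (Piece n m)) : Prop :=
  ∃ (edges : Finset ((Fin n ⊕ Fin m) × (Fin n ⊕ Fin m)))
    (out : Fin n ⊕ Fin m → Wire n m) (l r : (Fin n ⊕ Fin m) × (Fin n ⊕ Fin m) → ℕ)
    (clifford : Fin n ⊕ Fin m → Multiset (Piece n m)),
    (∀ e ∈ edges, e.1 ≠ e.2 ∧ e.swap ∉ edges) ∧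
    (∀ v, LocalClifford (out v) (boundary v) (clifford v)) ∧
    E = GraphState edges out l r + ∑ v, clifford v

/-- The segments into which scalar diagrams are decomposed: a single green or red node, or a green
and a red node joined by one wire. -/
inductive ScalarSegment : Multiset (Piece n m) → Prop
  | single (c : Colour) (α : ZMod 4) : ScalarSegment {node c α 0}
  | pair (α β : ZMod 4) (k : ℕ) :
      ScalarSegment {node Colour.green α {inner k}, node Colour.red β {inner k}}

/-- The four zero scalars. -/
inductive ZeroSegment : Multiset (Piece n m) → Prop
  | green_pi : ZeroSegment {node Colour.green 2 0}
  | red_pi : ZeroSegment {node Colour.red 2 0}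
  | pos_neg (k : ℕ) :
      ZeroSegment {node Colour.green 1 {inner k}, node Colour.red (-1) {inner k}}
  | neg_pos (k : ℕ) :
      ZeroSegment {node Colour.green (-1) {inner k}, node Colour.red 1 {inner k}}

/-- A diagram in normal form with decomposed scalars: scalar segments next to a GS-LC diagram. -/
def Diagram.IsNormalForm (D : Diagram n m) : Prop :=
  ∃ (S : Multiset (Multiset (Piece n m))) (E : Multiset (Piece n m)),
    (∀ s ∈ S, ScalarSegment s) ∧ IsGSLC E ∧ D.pieces = S.sum + E

/-- The diagram explicitly contains one of the four zero scalars. -/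
def Diagram.ContainsZero (D : Diagram n m) : Prop :=
  ∃ s ≤ D.pieces, ZeroSegment s

end NormalForm

section Coding

variable {n m : ℕ}

/-- Numbering of the wires. -/
def Wire.code : Wire n m → ℕ
  | .input i => 3 * i
  | .output j => 3 * j + 1
  | .inner k => 3 * k + 2

/-- Descriptions of a piece by its type, its phase and a list of its legs. -/
inductive Piece.IsCode : ℕ × ℕ × List ℕ → Piece n m → Prop
  | green (α : ZMod 4) (l : List (Wire n m)) :
      IsCode (0, α.val, l.map Wire.code) (.node .green α l)
  | red (α : ZMod 4) (l : List (Wire n m)) :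
      IsCode (1, α.val, l.map Wire.code) (.node .red α l)
  | had (a b : Wire n m) : IsCode (2, 0, [a.code, b.code]) (.had a b)
  | cord (a b : Wire n m) : IsCode (3, 0, [a.code, b.code]) (.cord a b)

/-- Descriptions of a diagram by a list of its pieces. -/
def Diagram.IsCode (t : List (ℕ × ℕ × List ℕ)) (D : Diagram n m) : Prop :=
  ∃ es : List (Piece n m), D.pieces = es ∧ List.Forall₂ Piece.IsCode t es

end Coding

end ZX

namespace ZX

open Wire Piece

/-! ### Rewriting as a relation between multisets of pieces -/

section Relation

variable {n m : ℕ}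

/-! Existence of the normal form is a reduction of graphs. Colour changes make every red node green,
and inserted phaseless green nodes and pairs of Hadamard nodes turn all other inner connections into
Hadamard edges. What results is a graph: green vertices with phases, Hadamard edges, and legs
leading to the inputs and outputs (`Valid.graphLike`). Parallel edges cancel by the Hopf law and a
loop becomes a phase π (`GraphLike.simplify`).

A vertex with phase ±π/2 and no leg is removed by local complementation: colour change makes it a
red node wired directly to its neighbours, and `Rel.star` trades this node for edges among them, at
the cost of a phase shift at each neighbour and some scalar segments (`GraphLike.eliminate`). A
vertex with phase 0 or π and no leg is a scalar if it is isolated. Otherwise a neighbour `j` is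
used: unless `j` can itself be eliminated at once, a new vertex attached to `j` takes over the leg
or the excess phase of `j`, so that `j` has phase π/2 and no leg. Eliminating `j` then makes the
phase of the first vertex odd, and it is eliminated as well. One vertex is created and two
disappear, so `GraphLike.reduce` terminates, with exactly one leg at each vertex. The remaining
phases are pushed into the chains at the legs, which gives the GS-LC form.

For the zero criterion, the two sides of every rule are proportional with a non-zero factor, so
vanishing is invariant under rewriting (`Diagram.Rewrites.interp_eq_zero`). In normal form the
matrix is the product of the segment values and the GS-LC part. A single node has value 1 + e^{iα},
and a pair has value (1 + e^{iα} + e^{iβ} - e^{i(α+β)})/√2; these vanish exactly for the four listed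
segments. The GS-LC part never vanishes: its chains consist of invertible matrices, and the all-zero
amplitude of a graph state is a positive power of 1/√2 (`IsGSLC.nonZero`).

Decidability does not use the normal form. Up to one common non-zero factor, the terms of the
contraction are Gaussian integers, so all matrix entries can be summed by brute force in a primitive
recursive way (`isZeroCode_iff`). -/

/-- The wire ends of a multiset of pieces. -/
def legs (P : Multiset (Piece n m)) : Multiset (Wire n m) := P.bind Piece.legs

@[simp] theorem legs_zero : legs (0 : Multiset (Piece n m)) = 0 := rfl

@[simp] theorem legs_cons (e : Piece n m) (P : Multiset (Piece n m)) :
    legs (e ::ₘ P) = e.legs + legs P := Multiset.cons_bind ..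

@[simp] theorem legs_add (P Q : Multiset (Piece n m)) : legs (P + Q) = legs P + legs Q :=
  Multiset.add_bind ..

@[simp] theorem legs_singleton (e : Piece n m) : legs {e} = e.legs := Multiset.singleton_bind ..

/-- The conditions on the wire ends of a diagram. -/
structure ValidLegs (M : Multiset (Wire n m)) : Prop where
  count_input : ∀ i, M.count (input i) = 1
  count_output : ∀ j, M.count (output j) = 1
  count_inner : ∀ k, M.count (inner k) = 0 ∨ M.count (inner k) = 2

/-- The two displayed ends use up the count of `k`, so no third end exists. Most validity checks
below amount to removing or adding both ends of inner wires. -/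
theorem ValidLegs.drop {k : ℕ} {M : Multiset (Wire n m)}
    (h : ValidLegs (inner k ::ₘ inner k ::ₘ M)) : ValidLegs M ∧ inner k ∉ M := by
  obtain ⟨h1, h2, h3⟩ := h
  have hk := h3 k
  simp only [Multiset.count_cons_self] at hk
  have hk0 : M.count (Wire.inner k) = 0 := by omega
  refine ⟨⟨fun i => by simpa using h1 i, fun j => by simpa using h2 j, fun l => ?_⟩,
    Multiset.count_eq_zero.mp hk0⟩
  rcases eq_or_ne l k with rfl | hl
  · exact Or.inl hk0
  · have hl' : (Wire.inner l : Wire n m) ≠ Wire.inner k := by simpa using hl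
    simpa [Multiset.count_cons_of_ne hl'] using h3 l

theorem ValidLegs.add {k : ℕ} {M : Multiset (Wire n m)} (h : ValidLegs M) (hk : Wire.inner k ∉ M) :
    ValidLegs (inner k ::ₘ inner k ::ₘ M) := by
  obtain ⟨h1, h2, h3⟩ := h
  refine ⟨fun i => by simpa using h1 i, fun j => by simpa using h2 j, fun l => ?_⟩
  rcases eq_or_ne l k with rfl | hl
  · simp [Multiset.count_eq_zero.mpr hk]
  · have hl' : (Wire.inner l : Wire n m) ≠ Wire.inner k := by simpa using hl
    simpa [Multiset.count_cons_of_ne hl'] using h3 l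

theorem ValidLegs.drop' {k : ℕ} {M M' : Multiset (Wire n m)} (h : ValidLegs M)
    (e : M = inner k ::ₘ inner k ::ₘ M') : ValidLegs M' := (e ▸ h).drop.1

theorem ValidLegs.not_mem {k : ℕ} {M M' : Multiset (Wire n m)} (h : ValidLegs M)
    (e : M = inner k ::ₘ inner k ::ₘ M') : Wire.inner k ∉ M' := (e ▸ h).drop.2

theorem ValidLegs.add' {k : ℕ} {M M' : Multiset (Wire n m)} (h : ValidLegs M)
    (hk : Wire.inner k ∉ M) (e : M' = inner k ::ₘ inner k ::ₘ M) : ValidLegs M' := e ▸ h.add hk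

/-- A multiset of pieces that forms a diagram. -/
def Valid (P : Multiset (Piece n m)) : Prop := ValidLegs (legs P)

/-- The diagram formed by a valid multiset of pieces. -/
def Valid.toDiagram {P : Multiset (Piece n m)} (h : Valid P) : Diagram n m :=
  ⟨P, h.count_input, h.count_output, h.count_inner⟩

theorem Diagram.valid (D : Diagram n m) : Valid D.pieces :=
  ⟨D.input_once, D.output_once, D.inner_twice⟩

/-- Graphical derivability between multisets of pieces. -/
def Rel (P Q : Multiset (Piece n m)) : Prop :=
  ∃ (hP : Valid P) (hQ : Valid Q), hP.toDiagram.Rewrites hQ.toDiagram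

theorem Rel.right {P Q : Multiset (Piece n m)} (h : Rel P Q) : Valid Q := h.2.1

theorem Rel.refl {P : Multiset (Piece n m)} (h : Valid P) : Rel P P := ⟨h, h, .refl _⟩

theorem Rel.of_eq {P Q : Multiset (Piece n m)} (h : Valid P) (e : P = Q) : Rel P Q :=
  e ▸ Rel.refl h

theorem Rel.symm {P Q : Multiset (Piece n m)} (h : Rel P Q) : Rel Q P :=
  ⟨h.2.1, h.1, .symm _ _ h.2.2⟩

theorem Rel.trans {P Q R : Multiset (Piece n m)} (h : Rel P Q) (h' : Rel Q R) : Rel P R :=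
  ⟨h.1, h'.2.1, .trans _ _ _ h.2.2 h'.2.2⟩

theorem Rel.trans_eq {P Q R : Multiset (Piece n m)} (h : Rel P Q) (e : Q = R) : Rel P R := e ▸ h

theorem Rel.of_rule {P Q L R : Multiset (Piece n m)} (C : Multiset (Piece n m)) (h : Rule L R)
    (hP : Valid P) (hQ : Valid Q) (eP : P = L + C) (eQ : Q = R + C) : Rel P Q :=
  ⟨hP, hQ, .rule _ _ L R C h eP eQ⟩

theorem exists_fresh_above (P : Multiset (Piece n m)) :
    ∃ N : ℕ, ∀ k, N ≤ k → Wire.inner k ∉ legs P := by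
  -- The sum of `k + 1` over all inner wire ends exceeds every name in use.
  refine ⟨((legs P).map fun w => match w with | .inner k => k + 1 | _ => 0).sum, fun k hk h => ?_⟩
  have h1 : k + 1 ∈ (legs P).map fun w : Wire n m => match w with | .inner k => k + 1 | _ => 0 :=
    Multiset.mem_map.mpr ⟨_, h, rfl⟩
  have := Multiset.single_le_sum (by simp) _ h1
  omega

theorem exists_fresh (P : Multiset (Piece n m)) : ∃ k : ℕ, Wire.inner k ∉ legs P :=
  let ⟨N, h⟩ := exists_fresh_above P
  ⟨N, h N le_rfl⟩

end Relation

/-! ### The rules in both directions, with validity of the result -/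

section Basic

variable {n m : ℕ} {P C : Multiset (Piece n m)} {c : Colour} {a b : Wire n m}
  {α β γ : ZMod 4} {k : ℕ} {A B M : Multiset (Wire n m)}

theorem Rel.had_symm (hv : Valid P) (hP : P = had a b ::ₘ C) : Rel P (had b a ::ₘ C) := by
  refine .of_rule C (.had_symm a b) hv ?_ (by simp [hP]) (by simp)
  have : legs P = legs (had b a ::ₘ C) := by
    simp [hP, Piece.legs, Multiset.cons_swap b a]
  rw [Valid, ← this]; exact hv

theorem map_replace_of_not_mem (h : Wire.inner k ∉ A) :
    A.map (fun w => if w = Wire.inner k then a else w) = A := by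
  conv_rhs => rw [← Multiset.map_id A]
  refine Multiset.map_congr rfl fun w hw => ?_
  rw [if_neg (by rintro rfl; exact h hw), id]

/-- The rule `cord_join` wants exactly one end of `k` at the node. Validity ensures this, because
the bare wire holds the other end. -/
theorem Rel.join_node (hv : Valid P)
    (hP : P = cord a (inner k) ::ₘ node c α (inner k ::ₘ A) ::ₘ C) :
    Rel P (node c α (a ::ₘ A) ::ₘ C) := by
  have e : legs P = inner k ::ₘ inner k ::ₘ (a ::ₘ (A + legs C)) := by
    rw [hP]
    simp only [legs_cons, Piece.legs, Multiset.insert_eq_cons]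
    simp only [← Multiset.singleton_add]; abel
  have h1 := hv.not_mem e
  simp only [Multiset.mem_cons, Multiset.mem_add, not_or] at h1
  have hr := Rule.cord_join a k (node c α (inner k ::ₘ A))
    (by simp [Piece.legs, Multiset.count_eq_zero.mpr h1.2.1])
  simp only [Piece.map, Multiset.map_cons, if_true, map_replace_of_not_mem h1.2.1] at hr
  exact .of_rule C hr hv (by simpa [Valid, Piece.legs] using hv.drop' e) (by simp [hP]) (by simp)

/-- Rewriting is symmetric, but the reversed rule has to name the wire that it creates; hence the
fresh `k`, here and in the other reversed rules. -/
theorem Rel.unjoin_node (hv : Valid P) (hP : P = node c α (a ::ₘ A) ::ₘ C) :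
    ∃ k, Rel P (cord a (inner k) ::ₘ node c α (inner k ::ₘ A) ::ₘ C) := by
  obtain ⟨k, hk⟩ := exists_fresh P
  refine ⟨k, (Rel.join_node ?_ rfl).symm.trans_eq rfl |> fun h => hP ▸ h⟩
  refine hv.add' hk ?_
  rw [hP]
  simp only [legs_cons, Piece.legs, Multiset.insert_eq_cons]
  simp only [← Multiset.singleton_add]; abel

theorem Rel.join_had (hv : Valid P) (hP : P = cord a (inner k) ::ₘ had (inner k) b ::ₘ C) :
    Rel P (had a b ::ₘ C) := by
  have e : legs P = inner k ::ₘ inner k ::ₘ (a ::ₘ b ::ₘ legs C) := by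
    rw [hP]
    simp only [legs_cons, Piece.legs, Multiset.insert_eq_cons]
    simp only [← Multiset.singleton_add]; abel
  have h1 := hv.not_mem e
  simp only [Multiset.mem_cons, not_or] at h1
  have hr := Rule.cord_join a k (had (inner k) b)
    (by simp [Piece.legs, h1.2.1])
  simp only [Piece.map, if_true, if_neg (Ne.symm h1.2.1)] at hr
  exact .of_rule C hr hv (by simpa [Valid, Piece.legs] using hv.drop' e) (by simp [hP]) (by simp)

theorem Rel.unjoin_had (hv : Valid P) (hP : P = had a b ::ₘ C) :
    ∃ k, Rel P (cord a (inner k) ::ₘ had (inner k) b ::ₘ C) := by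
  obtain ⟨k, hk⟩ := exists_fresh P
  refine ⟨k, hP ▸ (Rel.join_had ?_ rfl).symm⟩
  refine hv.add' hk ?_
  rw [hP]
  simp only [legs_cons, Piece.legs, Multiset.insert_eq_cons]
  simp only [← Multiset.singleton_add]; abel

theorem Rel.spider (hv : Valid P)
    (hP : P = node c α (inner k ::ₘ A) ::ₘ node c β (inner k ::ₘ B) ::ₘ C)
    (hγ : α + β = γ) (hM : A + B = M) : Rel P (node c γ M ::ₘ C) := by
  subst hγ hM
  have e : legs P = inner k ::ₘ inner k ::ₘ (A + B + legs C) := by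
    rw [hP]; simp only [legs_cons, Piece.legs]; simp only [← Multiset.singleton_add]; abel
  exact .of_rule C (.spider c α β k A B) hv (by simpa [Valid, Piece.legs] using hv.drop' e)
    (by simp [hP]) (by simp)

theorem Rel.unspider (hv : Valid P) (hP : P = node c γ M ::ₘ C) (hγ : α + β = γ) (hM : A + B = M) :
    ∃ k, Rel P (node c α (inner k ::ₘ A) ::ₘ node c β (inner k ::ₘ B) ::ₘ C) := by
  obtain ⟨k, hk⟩ := exists_fresh P
  refine ⟨k, hP ▸ (Rel.spider ?_ rfl hγ hM).symm⟩
  refine hv.add' hk ?_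
  rw [hP, ← hM]
  simp only [legs_cons, Piece.legs]; simp only [← Multiset.singleton_add]; abel

theorem Rel.cup (hv : Valid P) (hP : P = node c 0 {a, b} ::ₘ C) : Rel P (cord a b ::ₘ C) :=
  .of_rule C (.cup c a b) hv (by subst hP; simpa [Valid, Piece.legs] using hv)
    (by simp [hP]) (by simp)

theorem Rel.uncup (c : Colour) (hv : Valid P) (hP : P = cord a b ::ₘ C) :
    Rel P (node c 0 {a, b} ::ₘ C) :=
  hP ▸ (Rel.cup (by subst hP; simpa [Valid, Piece.legs] using hv) rfl).symm

theorem Rel.copy (hv : Valid P)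
    (hP : P = node c.swap 0 {inner k} ::ₘ node c 0 {inner k, a, b} ::ₘ C) :
    Rel P (node c.swap 0 {a} ::ₘ node c.swap 0 {b} ::ₘ C) := by
  have e : legs P = inner k ::ₘ inner k ::ₘ (a ::ₘ b ::ₘ legs C) := by
    rw [hP]
    simp only [legs_cons, Piece.legs, Multiset.insert_eq_cons]
    simp only [← Multiset.singleton_add]; abel
  exact .of_rule C (.copy c k a b) hv
    (by
      simp only [Valid, Piece.legs, legs_cons]
      exact hv.drop' e)
    (by simp [hP]) (by simp)

/-- Bialgebra rule, from the square to the bridge. -/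
theorem Rel.bialgebra {a₁ a₂ b₁ b₂ : Wire n m} {k₁₁ k₁₂ k₂₁ k₂₂ : ℕ} (hv : Valid P)
    (hP : P = node c 0 {a₁, inner k₁₁, inner k₁₂} ::ₘ node c 0 {a₂, inner k₂₁, inner k₂₂} ::ₘ
      node c.swap 0 {inner k₁₁, inner k₂₁, b₁} ::ₘ node c.swap 0 {inner k₁₂, inner k₂₂, b₂} ::ₘ C) :
    ∃ k, Rel P (node c.swap 0 {a₁, a₂, inner k} ::ₘ node c 0 {inner k, b₁, b₂} ::ₘ C) := by
  obtain ⟨k, hk⟩ := exists_fresh P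
  refine ⟨k, .of_rule C (.bialgebra c a₁ a₂ b₁ b₂ k₁₁ k₁₂ k₂₁ k₂₂ k) hv ?_
    (by simp [hP]) (by simp)⟩
  have e : legs P = inner k₁₁ ::ₘ inner k₁₁ ::ₘ inner k₁₂ ::ₘ inner k₁₂ ::ₘ inner k₂₁ ::ₘ
      inner k₂₁ ::ₘ inner k₂₂ ::ₘ inner k₂₂ ::ₘ (a₁ ::ₘ a₂ ::ₘ b₁ ::ₘ b₂ ::ₘ legs C) := by
    rw [hP]
    simp only [legs_cons, Piece.legs, Multiset.insert_eq_cons]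
    simp only [← Multiset.singleton_add]; abel
  refine ((((hv.drop' e).drop' rfl).drop' rfl).drop' rfl).add' (k := k) ?_ ?_
  · rw [e] at hk; simp only [Multiset.mem_cons, not_or] at hk ⊢; tauto
  · simp only [legs_cons, Piece.legs, Multiset.insert_eq_cons]; simp only [← Multiset.singleton_add]; abel

/-- Bialgebra rule, from the bridge to the square. -/
theorem Rel.unbialgebra {a₁ a₂ b₁ b₂ : Wire n m} (hv : Valid P)
    (hP : P = node c.swap 0 {a₁, a₂, inner k} ::ₘ node c 0 {inner k, b₁, b₂} ::ₘ C) :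
    ∃ k₁₁ k₁₂ k₂₁ k₂₂, Rel P
      (node c 0 {a₁, inner k₁₁, inner k₁₂} ::ₘ node c 0 {a₂, inner k₂₁, inner k₂₂} ::ₘ
      node c.swap 0 {inner k₁₁, inner k₂₁, b₁} ::ₘ
      node c.swap 0 {inner k₁₂, inner k₂₂, b₂} ::ₘ C) := by
  obtain ⟨N, hN⟩ := exists_fresh_above P
  refine ⟨N, N + 1, N + 2, N + 3,
    (Rel.of_rule C (.bialgebra c a₁ a₂ b₁ b₂ N (N + 1) (N + 2) (N + 3) k) ?_ hv
    (by simp) (by simp [hP])).symm⟩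
  have e : legs P = inner k ::ₘ inner k ::ₘ (a₁ ::ₘ a₂ ::ₘ b₁ ::ₘ b₂ ::ₘ legs C) := by
    rw [hP]
    simp only [legs_cons, Piece.legs, Multiset.insert_eq_cons]
    simp only [← Multiset.singleton_add]; abel
  have h0 := hN N le_rfl
  have h1 := hN (N + 1) (by omega)
  have h2 := hN (N + 2) (by omega)
  have h3 := hN (N + 3) (by omega)
  rw [e] at h0 h1 h2 h3
  simp only [Multiset.mem_cons, not_or] at h0 h1 h2 h3
  refine ((((hv.drop' e).add' (k := N) ?_ rfl).add' (k := N + 1) ?_ rfl).add'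
    (k := N + 2) ?_ rfl).add' (k := N + 3) ?_ ?_
  · simp only [Multiset.mem_cons, not_or]; tauto
  · simp only [Multiset.mem_cons, not_or, Wire.inner.injEq]
    refine ⟨by omega, by omega, ?_⟩; tauto
  · simp only [Multiset.mem_cons, not_or, Wire.inner.injEq]
    refine ⟨by omega, by omega, by omega, by omega, ?_⟩; tauto
  · simp only [Multiset.mem_cons, not_or, Wire.inner.injEq]
    refine ⟨by omega, by omega, by omega, by omega, by omega, by omega, ?_⟩; tauto
  · simp only [legs_cons, Piece.legs, Multiset.insert_eq_cons]; simp only [← Multiset.singleton_add]; abel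

theorem Rel.euler {c : Colour} (hv : Valid P) (hP : P = had a b ::ₘ C) :
    ∃ k k', Rel P (node c 1 {a, inner k} ::ₘ node c.swap 1 {inner k, inner k'} ::ₘ
      node c 1 {inner k', b} ::ₘ C) := by
  obtain ⟨N, hN⟩ := exists_fresh_above P
  refine ⟨N, N + 1, .of_rule C (.euler c a b N (N + 1)) hv ?_ (by simp [hP]) (by simp)⟩
  have h0 := hN N le_rfl
  have h1 := hN (N + 1) (by omega)
  refine (ValidLegs.add' hv h0 rfl).add' (k := N + 1) ?_ ?_
  · simp only [Multiset.mem_cons, not_or]; simp [h1]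
  · rw [hP]
    simp only [legs_cons, Piece.legs, Multiset.insert_eq_cons]
    simp only [← Multiset.singleton_add]; abel

theorem Rel.uneuler {c : Colour} {k' : ℕ} (hv : Valid P)
    (hP : P = node c 1 {a, inner k} ::ₘ node c.swap 1 {inner k, inner k'} ::ₘ
      node c 1 {inner k', b} ::ₘ C) : Rel P (had a b ::ₘ C) := by
  refine (Rel.of_rule C (.euler c a b k k') ?_ hv (by simp) (by simp [hP])).symm
  have e : legs P = inner k ::ₘ inner k ::ₘ inner k' ::ₘ inner k' ::ₘ (legs (had a b ::ₘ C)) := by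
    rw [hP]
    simp only [legs_cons, Piece.legs, Multiset.insert_eq_cons]
    simp only [← Multiset.singleton_add]; abel
  exact (hv.drop' e).drop' rfl

end Basic

/-! ### The colour change rule for any number of legs -/

section Colour

variable {n m : ℕ} {P C : Multiset (Piece n m)} {c : Colour} {α : ZMod 4}

theorem legs_map_had {σ : Type*} (T : Multiset σ) (f g : σ → Wire n m) :
    legs (T.map fun p => had (f p) (g p)) = T.map f + T.map g := by
  induction T using Multiset.induction with
  | empty => simp
  | cons a T ih => simp [Piece.legs, ih, ← Multiset.singleton_add]; abel

/-- The version of `ValidLegs.drop'` for rules with arbitrarily many private wires. -/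
theorem ValidLegs.drop_map {T : Multiset ℕ} {M M' : Multiset (Wire n m)} (h : ValidLegs M)
    (e : M = T.map Wire.inner + T.map Wire.inner + M') : ValidLegs M' := by
  induction T using Multiset.induction generalizing M with
  | empty => simpa [e] using h
  | cons a T ih =>
    refine ih (M := T.map Wire.inner + T.map Wire.inner + M') (h.drop' (k := a) ?_) rfl
    rw [e]; simp only [Multiset.map_cons]; simp only [← Multiset.singleton_add]; abel

theorem ValidLegs.add_map {T : Multiset ℕ} {M M' : Multiset (Wire n m)} (h : ValidLegs M)
    (hT : T.Nodup) (hM : ∀ k ∈ T, Wire.inner k ∉ M)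
    (e : M' = T.map Wire.inner + T.map Wire.inner + M) : ValidLegs M' := by
  induction T using Multiset.induction generalizing M' with
  | empty => simpa [e] using h
  | cons a T ih =>
    rw [Multiset.nodup_cons] at hT
    refine (ih (M' := T.map Wire.inner + T.map Wire.inner + M) hT.2
      (fun k hk => hM k (Multiset.mem_cons_of_mem hk)) rfl).add' (k := a) ?_ ?_
    · simp [hT.1, hM a (Multiset.mem_cons_self a T)]
    · rw [e]; simp only [Multiset.map_cons]; simp only [← Multiset.singleton_add]; abel

/-- Colour change rule, removing the Hadamard nodes. -/
theorem Rel.colour {σ : Type*} {T : Multiset σ} {f : σ → ℕ} {g : σ → Wire n m} (hv : Valid P)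
    (hP : P = node c α (T.map fun p => inner (f p)) ::ₘ
      ((T.map fun p => had (inner (f p)) (g p)) + C)) :
    Rel P (node c.swap α (T.map g) ::ₘ C) := by
  have hr := Rule.colour c α (T.map fun p => (f p, g p))
  simp only [Multiset.map_map, Function.comp_def] at hr
  refine .of_rule C hr hv ?_ (by rw [hP]; simp) (by simp)
  refine hv.drop_map (T := T.map f) ?_
  rw [hP]
  simp only [legs_cons, legs_add, legs_map_had, Piece.legs, Multiset.map_map, Function.comp_def]
  abel

/-- The elements of a multiset can be named by distinct numbers above any bound. -/
theorem exists_naming {σ : Type*} (S : Multiset σ) (N : ℕ) :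
    ∃ T : Multiset (ℕ × σ), T.map Prod.snd = S ∧ (T.map Prod.fst).Nodup ∧
      ∀ k ∈ T.map Prod.fst, N ≤ k := by
  induction S using Quotient.inductionOn with | _ l =>
  refine ⟨(((l.zipIdx N).map Prod.swap : List (ℕ × σ)) : Multiset (ℕ × σ)), ?_, ?_, ?_⟩
  · simp [Function.comp_def]
  · have : ((((l.zipIdx N).map Prod.swap : List (ℕ × σ)) : Multiset (ℕ × σ))).map Prod.fst =
        (List.range' N l.length : Multiset ℕ) := by simp [Function.comp_def]
    rw [this]; exact List.nodup_range'
  · intro k hk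
    have : ((((l.zipIdx N).map Prod.swap : List (ℕ × σ)) : Multiset (ℕ × σ))).map Prod.fst =
        (List.range' N l.length : Multiset ℕ) := by simp [Function.comp_def]
    rw [this] at hk
    simp only [Multiset.mem_coe, List.mem_range'_1] at hk
    exact hk.1

/-- Colour change rule, creating the Hadamard nodes. -/
theorem Rel.uncolour {σ : Type*} {S : Multiset σ} {g : σ → Wire n m} (hv : Valid P)
    (hP : P = node c.swap α (S.map g) ::ₘ C) :
    ∃ T : Multiset (ℕ × σ), T.map Prod.snd = S ∧
      Rel P (node c α (T.map fun p => inner p.1) ::ₘ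
        ((T.map fun p => had (inner p.1) (g p.2)) + C)) := by
  obtain ⟨N, hN⟩ := exists_fresh_above P
  obtain ⟨T, rfl, hT, hTN⟩ := exists_naming S N
  refine ⟨T, rfl, ?_⟩
  rw [Multiset.map_map, Function.comp_def] at hP
  subst hP
  refine (Rel.colour (f := Prod.fst) (g := fun p => g p.2) ?_ rfl).symm
  refine hv.add_map hT (fun k hk => hN k (hTN k hk)) ?_
  simp only [legs_cons, legs_add, legs_map_had, Piece.legs, Multiset.map_map, Function.comp_def]
  abel

end Colour

/-! ### Derived rules: cancelling Hadamard nodes, quarter turns, Hopf law -/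

section Derived

variable {n m : ℕ} {P C : Multiset (Piece n m)} {c : Colour} {a b : Wire n m}
  {α β γ φ ψ ε : ZMod 4} {k : ℕ} {A B M : Multiset (Wire n m)}

@[simp] theorem Colour.swap_swap (c : Colour) : c.swap.swap = c := by cases c <;> rfl

theorem exists_cons_of_map_eq_cons {σ τ : Type*} {f : σ → τ} {T : Multiset σ} {x : τ}
    {S : Multiset τ} (h : T.map f = x ::ₘ S) : ∃ t T', T = t ::ₘ T' ∧ f t = x ∧ T'.map f = S := by
  have hx : x ∈ T.map f := h ▸ Multiset.mem_cons_self x S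
  obtain ⟨t, ht, rfl⟩ := Multiset.mem_map.mp hx
  obtain ⟨T', rfl⟩ := Multiset.exists_cons_of_mem ht
  exact ⟨t, T', rfl, rfl, by simpa using h⟩

theorem Rel.uncolour_one (hv : Valid P) (hP : P = node c.swap α {a} ::ₘ C) :
    ∃ k, Rel P (node c α {inner k} ::ₘ had (inner k) a ::ₘ C) := by
  obtain ⟨T, hT, h⟩ := Rel.uncolour (S := {a}) (g := id) hv (by simpa using hP)
  obtain ⟨⟨t, _⟩, T', rfl, rfl, hT'⟩ := exists_cons_of_map_eq_cons (S := 0) hT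
  rw [Multiset.map_eq_zero] at hT'
  subst hT'
  exact ⟨t, h.trans_eq (by simp)⟩

theorem Rel.uncolour_two (hv : Valid P) (hP : P = node c.swap α {a, b} ::ₘ C) :
    ∃ k l, Rel P (node c α {inner k, inner l} ::ₘ had (inner k) a ::ₘ had (inner l) b ::ₘ C) := by
  obtain ⟨T, hT, h⟩ := Rel.uncolour (S := {a, b}) (g := id) hv (by simpa using hP)
  obtain ⟨⟨t, _⟩, T', rfl, rfl, hT'⟩ := exists_cons_of_map_eq_cons (S := {b}) hT
  obtain ⟨⟨t', _⟩, T'', rfl, rfl, hT''⟩ := exists_cons_of_map_eq_cons (S := 0) hT'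
  rw [Multiset.map_eq_zero] at hT''
  subst hT''
  exact ⟨t, t', h.trans_eq (by simp)⟩

/-- Two Hadamard nodes in a row cancel. -/
theorem Rel.had_had (hv : Valid P) (hP : P = had a (inner k) ::ₘ had (inner k) b ::ₘ C) :
    Rel P (cord a b ::ₘ C) := by
  -- A phaseless green node is inserted between the two Hadamard nodes. Colour change absorbs both
  -- and leaves a phaseless red node, which is a bare wire again.
  obtain ⟨l, h1⟩ := Rel.unjoin_had (C := had a (inner k) ::ₘ C) hv
    (hP.trans (Multiset.cons_swap ..))
  have h2 := h1.trans (Rel.uncup Colour.green h1.right rfl)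
  have h3 := (h2.trans_eq (by simp only [← Multiset.singleton_add]; abel)).trans
    (Rel.had_symm (a := a) (b := inner k)
      (C := node .green 0 {inner k, inner l} ::ₘ had (inner l) b ::ₘ C)
      (h2.trans_eq (by simp only [← Multiset.singleton_add]; abel)).right rfl)
  have h4 := h3.trans (Rel.colour (c := .green) (α := 0) (T := {(k, a), (l, b)}) (f := Prod.fst)
    (g := Prod.snd) (C := C) h3.right
    (by simp only [Multiset.insert_eq_cons, Multiset.map_cons, Multiset.map_singleton]
        simp only [← Multiset.singleton_add]; abel))
  exact h4.trans (Rel.cup h4.right (by simp; rfl))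

theorem Rel.unhad_had (hv : Valid P) (hP : P = cord a b ::ₘ C) :
    ∃ k, Rel P (had a (inner k) ::ₘ had (inner k) b ::ₘ C) := by
  obtain ⟨k, hk⟩ := exists_fresh P
  refine ⟨k, hP ▸ (Rel.had_had ?_ rfl).symm⟩
  refine hv.add' hk ?_
  rw [hP]
  simp only [legs_cons, Piece.legs, Multiset.insert_eq_cons]; simp only [← Multiset.singleton_add]
  abel

/-- Phase shifts are absorbed by the unit of the other colour. -/
theorem Rel.absorb_phase (hv : Valid P)
    (hP : P = node c.swap 0 {inner k} ::ₘ node c α {inner k, b} ::ₘ C) :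
    ∃ w, Rel P (node c.swap 0 {b} ::ₘ node c α {inner w} ::ₘ node c.swap 0 {inner w} ::ₘ C) := by
  -- The phase is moved to a one-legged node of its own, so that the copy rule, which needs a
  -- phaseless node, applies. The second copy closes up with this node to a scalar.
  obtain ⟨w, h1⟩ := Rel.unspider (α := 0) (β := α) (A := {inner k, b}) (B := 0)
    (C := node c.swap 0 {inner k} ::ₘ C) hv (hP.trans (Multiset.cons_swap ..)) (zero_add _)
    (add_zero _)
  have h2 := h1.trans (Rel.copy (c := c) (k := k) (a := inner w) (b := b)
    (C := node c α {inner w} ::ₘ C) h1.right (by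
      simp only [Multiset.insert_eq_cons, Multiset.cons_swap (inner k) (inner w),
        Multiset.cons_zero]
      simp only [← Multiset.singleton_add]; abel))
  exact ⟨w, h2.trans_eq (by simp only [← Multiset.singleton_add]; abel)⟩

/-- Euler decomposition of quarter turns. -/
theorem Rel.quarter_turn (hε : ε = 1 ∨ ε = -1) (hv : Valid P)
    (hP : P = node c.swap ε {a, b} ::ₘ C) :
    ∃ h h', Rel P (node c (-ε) {a, inner h} ::ₘ had (inner h) (inner h') ::ₘ
      node c (-ε) {inner h', b} ::ₘ C) := by
  rcases hε with rfl | rfl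
  -- At either end a phaseless node is inserted and split into phases `-1` and `1`. The inner phases
  -- `1` complete the Euler decomposition of a Hadamard node.
  · obtain ⟨k, h1⟩ := Rel.unjoin_node hv hP
    have h2 := h1.trans (Rel.uncup c h1.right rfl)
    obtain ⟨x, h3⟩ := Rel.unspider (α := -1) (β := 1) (A := {a}) (B := {inner k}) h2.right rfl
      (by decide) rfl
    have h3 := h2.trans h3
    have h4 := h3.trans_eq (Q := _) (R := node c.swap 1 (b ::ₘ {inner k}) ::ₘ
      node c (-1) (inner x ::ₘ {a}) ::ₘ node c 1 (inner x ::ₘ {inner k}) ::ₘ C) (by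
        rw [← Multiset.cons_zero b, Multiset.cons_swap, Multiset.cons_zero]
        simp only [← Multiset.singleton_add]; abel_nf)
    obtain ⟨l, h5⟩ := Rel.unjoin_node h4.right rfl
    have h5 := h4.trans h5
    have h6 := h5.trans (Rel.uncup c h5.right rfl)
    obtain ⟨y, h7⟩ := Rel.unspider (α := -1) (β := 1) (A := {b}) (B := {inner l}) h6.right rfl
      (by decide) rfl
    have h7 := h6.trans h7
    have h8 := h7.trans (Rel.uneuler (c := c) (a := inner x) (k := k) (k' := l) (b := inner y)
      (C := node c (-1) (inner x ::ₘ {a}) ::ₘ node c (-1) (inner y ::ₘ {b}) ::ₘ C) h7.right (by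
        rw [Multiset.pair_comm (inner k) (inner l), Multiset.pair_comm (inner l) (inner y)]
        simp only [Multiset.insert_eq_cons]
        simp only [← Multiset.singleton_add]; abel))
    refine ⟨x, y, h8.trans_eq ?_⟩
    rw [Multiset.pair_comm a (inner x)]
    simp only [Multiset.insert_eq_cons]
    simp only [← Multiset.singleton_add]; abel
  -- For the other sign, two Hadamard nodes are inserted at `b`. One is decomposed with the colours
  -- exchanged, so that its last phase cancels `-1`; the other is consumed by changing the colour of
  -- the first phase.
  · rw [neg_neg]
    rw [Multiset.pair_comm] at hP
    obtain ⟨x, h1⟩ := Rel.unjoin_node hv hP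
    obtain ⟨y, h2⟩ := Rel.unhad_had h1.right rfl
    have h2 := (h1.trans h2).trans_eq (Q := _) (R := had (inner y) (inner x) ::ₘ
      had b (inner y) ::ₘ node c.swap (-1) (inner x ::ₘ {a}) ::ₘ C) (Multiset.cons_swap ..)
    obtain ⟨k, k', h3⟩ := Rel.euler (c := c.swap) h2.right rfl
    have h3 := h2.trans h3
    rw [Colour.swap_swap] at h3
    have h4 := h3.trans (Rel.spider (c := c.swap) (α := 1) (β := -1) (k := x) (A := {inner k'})
      (B := {a}) (C := node c.swap 1 {inner y, inner k} ::ₘ node c 1 {inner k, inner k'} ::ₘ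
        had b (inner y) ::ₘ C) h3.right (by
          rw [Multiset.pair_comm (inner k') (inner x)]; simp only [Multiset.insert_eq_cons]
          simp only [← Multiset.singleton_add]; abel) (by decide : _ = (0 : ZMod 4))
          (by rw [add_comm, Multiset.singleton_add]; rfl : _ = {a, inner k'}))
    have h5 := h4.trans (Rel.cup h4.right rfl)
    have h6 := h5.trans (Rel.join_node (a := a) (k := k') (c := c) (α := 1) (A := {inner k})
      (C := node c.swap 1 {inner y, inner k} ::ₘ had b (inner y) ::ₘ C) h5.right (by
        rw [Multiset.pair_comm (inner k) (inner k')]; simp only [Multiset.insert_eq_cons]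
        simp only [← Multiset.singleton_add]; abel))
    obtain ⟨s, t, h7⟩ := Rel.uncolour_two (C := node c 1 {a, inner k} ::ₘ had b (inner y) ::ₘ C)
      h6.right (Multiset.cons_swap ..)
    have h7 := h6.trans h7
    have h8 := (h7.trans (Rel.had_symm (a := inner s) (b := inner y) (C := node c 1 {inner s, inner t} ::ₘ had (inner t) (inner k) ::ₘ
      node c 1 {a, inner k} ::ₘ had b (inner y) ::ₘ C) h7.right (Multiset.cons_swap ..)))
    have h9 := h8.trans (Rel.had_had (a := b) (k := y) (b := inner s) (C := node c 1 {inner s, inner t} ::ₘ had (inner t) (inner k) ::ₘ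
      node c 1 {a, inner k} ::ₘ C) h8.right (by simp only [← Multiset.singleton_add]; abel))
    have h10 := h9.trans (Rel.join_node h9.right rfl)
    have h11 := h10.trans (Rel.had_symm (a := inner t) (b := inner k) (C := node c 1 {b, inner t} ::ₘ
      node c 1 {a, inner k} ::ₘ C) h10.right (Multiset.cons_swap ..))
    refine ⟨k, t, h11.trans_eq ?_⟩
    rw [Multiset.pair_comm b]
    simp only [← Multiset.singleton_add]; abel

/-- The eigenstates of the third Pauli operator can be written in either colour. -/
theorem Rel.odd_state (hε : ε = 1 ∨ ε = -1) (hv : Valid P)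
    (hP : P = node c.swap ε {a} ::ₘ C) :
    ∃ w, Rel P (node c (-ε) {a} ::ₘ node c (-ε) {inner w} ::ₘ node c.swap 0 {inner w} ::ₘ C) := by
  -- The node is regarded as a quarter turn applied to the phaseless state. After `quarter_turn`,
  -- this state absorbs the nearer phase and changes colour at the Hadamard node, so that just the
  -- outer phase survives.
  obtain ⟨x, h1⟩ := Rel.unspider (α := ε) (β := 0) (A := {a}) (B := 0) hv hP (add_zero _)
    (add_zero _)
  obtain ⟨h, h', h2⟩ := Rel.quarter_turn (a := a) (b := inner x) (C := node c.swap 0 {inner x} ::ₘ C) hε h1.right (by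
    rw [Multiset.pair_comm]; rfl)
  have h2 := h1.trans h2
  obtain ⟨w, h3⟩ := Rel.absorb_phase (c := c) (k := x) (α := -ε) (b := inner h')
    (C := node c (-ε) {a, inner h} ::ₘ had (inner h) (inner h') ::ₘ C) h2.right (by
      rw [Multiset.pair_comm (inner h')]; simp only [← Multiset.singleton_add]; abel)
  have h3 := h2.trans h3
  obtain ⟨t, h4⟩ := Rel.uncolour_one h3.right rfl
  have h4 := h3.trans h4
  have h5 := h4.trans (Rel.had_symm (C := node c 0 {inner t} ::ₘ node c (-ε) {inner w} ::ₘ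
    node c.swap 0 {inner w} ::ₘ node c (-ε) {a, inner h} ::ₘ had (inner h) (inner h') ::ₘ C)
    h4.right (Multiset.cons_swap ..))
  have h6 := h5.trans (Rel.had_had (a := inner h) (k := h') (b := inner t)
    (C := node c 0 {inner t} ::ₘ node c (-ε) {inner w} ::ₘ
    node c.swap 0 {inner w} ::ₘ node c (-ε) {a, inner h} ::ₘ C)
    h5.right (by simp only [← Multiset.singleton_add]; abel))
  have h7 := h6.trans (Rel.join_node (A := 0) h6.right rfl)
  have h8 := h7.trans (Rel.spider (c := c) (k := h) (A := 0) (B := {a}) (C := node c (-ε) {inner w} ::ₘ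
    node c.swap 0 {inner w} ::ₘ C) h7.right (by
      rw [Multiset.pair_comm]; simp only [Multiset.insert_eq_cons]
      simp only [← Multiset.singleton_add]; abel) (zero_add _) (zero_add _))
  exact ⟨w, h8⟩

/-- Hopf law: two parallel wires between nodes of different colours can be cut. -/
theorem Rel.hopf {k l : ℕ} (hv : Valid P)
    (hP : P = node c α (inner k ::ₘ inner l ::ₘ A) ::ₘ
      node c.swap β (inner k ::ₘ inner l ::ₘ B) ::ₘ C) :
    Rel P (node c α A ::ₘ node c.swap β B ::ₘ C) := by
  -- The two parallel wires are made part of a bialgebra square. Its two missing corners are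
  -- obtained by attaching one-legged phaseless nodes, on the wires `u` and `v`.
  obtain ⟨x, h1⟩ := Rel.unspider (α := α) (β := 0) (A := A) (B := {inner k, inner l}) hv hP
    (add_zero _) (by simp only [Multiset.insert_eq_cons]; simp only [← Multiset.singleton_add]; abel)
  obtain ⟨y, h2⟩ := Rel.unspider (c := c.swap) (α := β) (β := 0) (A := B)
    (B := {inner k, inner l}) (C := node c α (inner x ::ₘ A) ::ₘ
      node c 0 (inner x ::ₘ {inner k, inner l}) ::ₘ C) h1.right
    (by simp only [Multiset.insert_eq_cons]; simp only [← Multiset.singleton_add]; abel_nf)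
    (add_zero _) rfl
  have h2 := h1.trans h2
  obtain ⟨z, h3⟩ := Rel.unspider (c := c.swap) (α := 0) (β := 0) (A := {inner k, inner y})
    (B := {inner l}) (M := inner y ::ₘ {inner k, inner l}) (C := node c.swap β (inner y ::ₘ B) ::ₘ
      node c α (inner x ::ₘ A) ::ₘ
      node c 0 (inner x ::ₘ {inner k, inner l}) ::ₘ C) h2.right
    (by simp only [← Multiset.singleton_add]; abel)
    (add_zero _) (by simp only [Multiset.insert_eq_cons]; simp only [← Multiset.singleton_add]; abel)
  have h3 := h2.trans h3
  obtain ⟨v, h4⟩ := Rel.unspider (c := c.swap) (α := 0) (β := 0) (A := {inner l, inner z})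
    (B := 0) (M := inner z ::ₘ {inner l})
    (C := node c.swap 0 (inner z ::ₘ {inner k, inner y}) ::ₘ node c.swap β (inner y ::ₘ B) ::ₘ
      node c α (inner x ::ₘ A) ::ₘ
      node c 0 (inner x ::ₘ {inner k, inner l}) ::ₘ C) h3.right
    (by simp only [← Multiset.singleton_add]; abel)
    (add_zero _) (by simp only [Multiset.insert_eq_cons]; simp only [← Multiset.singleton_add]; abel)
  have h4 := h3.trans h4
  obtain ⟨z', h5⟩ := Rel.unjoin_node (c := c.swap) (α := 0) (a := inner z)
    (A := {inner k, inner y})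
    (C := node c.swap 0 (inner v ::ₘ {inner l, inner z}) ::ₘ node c.swap 0 {inner v} ::ₘ
      node c.swap β (inner y ::ₘ B) ::ₘ node c α (inner x ::ₘ A) ::ₘ
      node c 0 (inner x ::ₘ {inner k, inner l}) ::ₘ C) h4.right
    (by simp only [← Multiset.cons_zero]; simp only [← Multiset.singleton_add]; abel)
  have h5 := h4.trans h5
  have h6 := h5.trans (Rel.uncup c h5.right rfl)
  obtain ⟨u, h7⟩ := Rel.unspider (α := 0) (β := 0) (A := {inner z', inner z}) (B := 0) h6.right rfl
    (add_zero _) (by rw [add_zero, Multiset.pair_comm])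
  have h7 := h6.trans h7
  -- The square shrinks to a bridge `j` between the two sides. The one-legged node at `u` is copied
  -- through the bridge and thereby cuts it; what is left merges with the two original nodes.
  obtain ⟨j, h8⟩ := Rel.bialgebra (c := c) (a₁ := inner x) (k₁₁ := k) (k₁₂ := l) (a₂ := inner u)
    (k₂₁ := z') (k₂₂ := z) (b₁ := inner y) (b₂ := inner v)
    (C := node c 0 {inner u} ::ₘ node c.swap 0 {inner v} ::ₘ
      node c.swap β (inner y ::ₘ B) ::ₘ node c α (inner x ::ₘ A) ::ₘ C) h7.right (by
      have e1 : ({inner k, inner z', inner y} : Multiset (Wire n m)) =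
          inner z' ::ₘ {inner k, inner y} := by
        simp only [Multiset.insert_eq_cons]; simp only [← Multiset.singleton_add]; abel
      have e2 : ({inner l, inner z, inner v} : Multiset (Wire n m)) =
          inner v ::ₘ {inner l, inner z} := by
        simp only [Multiset.insert_eq_cons]; simp only [← Multiset.singleton_add]; abel
      rw [e1, e2]
      simp only [Multiset.insert_eq_cons, Multiset.cons_zero]
      simp only [← Multiset.singleton_add]; abel)
  have h8 := h7.trans h8
  have h9 := h8.trans (Rel.copy (c := c.swap) (k := u) (a := inner x) (b := inner j)
    (C := node c 0 {inner j, inner y, inner v} ::ₘ node c.swap 0 {inner v} ::ₘ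
      node c.swap β (inner y ::ₘ B) ::ₘ node c α (inner x ::ₘ A) ::ₘ C) h8.right (by
      have e1 : ({inner u, inner x, inner j} : Multiset (Wire n m)) =
          {inner x, inner u, inner j} := Multiset.cons_swap ..
      rw [Colour.swap_swap, e1]
      simp only [← Multiset.singleton_add]; abel))
  rw [Colour.swap_swap] at h9
  have h10 := h9.trans (Rel.spider (c := c) (k := x) (α := α) (β := 0) (A := A) (B := 0)
    (C := node c 0 {inner j} ::ₘ node c 0 {inner j, inner y, inner v} ::ₘ
      node c.swap 0 {inner v} ::ₘ node c.swap β (inner y ::ₘ B) ::ₘ C) h9.right (by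
      simp only [Multiset.cons_zero]
      simp only [← Multiset.singleton_add]; abel) (add_zero _) (add_zero _))
  have h11 := h10.trans (Rel.spider (c := c) (k := j) (α := 0) (β := 0) (A := 0)
    (B := {inner y, inner v}) (C := node c α A ::ₘ
      node c.swap 0 {inner v} ::ₘ node c.swap β (inner y ::ₘ B) ::ₘ C) h10.right (by
      simp only [Multiset.cons_zero, Multiset.insert_eq_cons]
      simp only [← Multiset.singleton_add]; abel) (add_zero _) (zero_add _))
  have h12 := h11.trans (Rel.cup h11.right rfl)
  have h13 := h12.trans (Rel.join_node (c := c.swap) (A := 0) (a := inner y) (k := v)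
    (C := node c α A ::ₘ node c.swap β (inner y ::ₘ B) ::ₘ C) h12.right (by
      simp only [Multiset.cons_zero]
      simp only [← Multiset.singleton_add]; abel))
  exact (h13.trans (Rel.spider (c := c.swap) (k := y) (α := β) (β := 0) (A := B) (B := 0)
    (C := node c α A ::ₘ C) h13.right (by
      simp only [Multiset.cons_zero]
      simp only [← Multiset.singleton_add]; abel) (add_zero _) (add_zero _))).trans_eq
        (Multiset.cons_swap ..)

/-- A Hadamard loop at a green node is a phase of `π`. -/
theorem Rel.had_loop {l r : ℕ} (hv : Valid P)
    (hP : P = node .green φ (inner l ::ₘ inner r ::ₘ A) ::ₘ had (inner l) (inner r) ::ₘ C) :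
    Rel P (node .green (φ + 2) A ::ₘ node .red 1 0 ::ₘ C) := by
  -- The two outer Euler phases add up to π at the vertex. The middle node hangs on two parallel
  -- wires, which the Hopf law cuts.
  obtain ⟨s, t, h1⟩ := Rel.euler (c := .green) hv (hP.trans (Multiset.cons_swap ..))
  have h2 := h1.trans (Rel.spider (c := .green) (k := l) (α := φ) (β := 1) (A := inner r ::ₘ A)
    (B := {inner s}) (M := inner r ::ₘ inner s ::ₘ A)
    (C := node Colour.green.swap 1 {inner s, inner t} ::ₘ node .green 1 {inner t, inner r} ::ₘ C)
    h1.right (by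
      simp only [Multiset.insert_eq_cons]; simp only [← Multiset.singleton_add]; abel) rfl
      (by simp only [← Multiset.singleton_add]; abel))
  have h3 := h2.trans (Rel.spider (c := .green) (k := r) (α := φ + 1) (β := 1) (γ := φ + 2)
    (A := inner s ::ₘ A) (B := {inner t}) (M := inner s ::ₘ inner t ::ₘ A)
    (C := node Colour.green.swap 1 {inner s, inner t} ::ₘ C)
    h2.right (by
      rw [Multiset.pair_comm (inner t)]
      simp only [Multiset.insert_eq_cons]; simp only [← Multiset.singleton_add]; abel)
      (by rw [add_assoc]; rfl)
      (by simp only [← Multiset.singleton_add]; abel))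
  exact h3.trans (Rel.hopf (c := .green) (k := s) (l := t) (A := A) (B := 0) (C := C) h3.right rfl)

/-- Parallel Hadamard edges between green nodes cancel. -/
theorem Rel.had_parallel {l₁ l₂ r₁ r₂ : ℕ} (hv : Valid P)
    (hP : P = node .green φ (inner l₁ ::ₘ inner l₂ ::ₘ A) ::ₘ
      node .green ψ (inner r₁ ::ₘ inner r₂ ::ₘ B) ::ₘ had (inner l₁) (inner r₁) ::ₘ
      had (inner l₂) (inner r₂) ::ₘ C) :
    Rel P (node .green φ A ::ₘ node .green ψ B ::ₘ C) := by
  -- A pair of Hadamard nodes is inserted on the wire `z` that splits the second vertex. Colour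
  -- change then consumes one of them and both parallel Hadamard nodes, leaving parallel plain wires
  -- between different colours, which the Hopf law cuts.
  obtain ⟨z, h1⟩ := Rel.unspider (c := .green) (α := ψ) (β := 0) (A := B) (B := {inner r₁, inner r₂})
    hv (hP.trans (Multiset.cons_swap ..)) (add_zero _)
    (by simp only [Multiset.insert_eq_cons]; simp only [← Multiset.singleton_add]; abel)
  obtain ⟨z', h2⟩ := Rel.unjoin_node (c := .green) (a := inner z) (A := {inner r₁, inner r₂})
    (C := node .green ψ (inner z ::ₘ B) ::ₘ node .green φ (inner l₁ ::ₘ inner l₂ ::ₘ A) ::ₘ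
      had (inner l₁) (inner r₁) ::ₘ had (inner l₂) (inner r₂) ::ₘ C) h1.right
    (Multiset.cons_swap ..)
  have h2 := h1.trans h2
  obtain ⟨t, h3⟩ := Rel.unhad_had h2.right rfl
  have h3 := h2.trans h3
  have h4 := h3.trans (Rel.had_symm (a := inner t) (b := inner z') (C := had (inner z) (inner t) ::ₘ
    node .green 0 (inner z' ::ₘ {inner r₁, inner r₂}) ::ₘ
    node .green ψ (inner z ::ₘ B) ::ₘ node .green φ (inner l₁ ::ₘ inner l₂ ::ₘ A) ::ₘ
      had (inner l₁) (inner r₁) ::ₘ had (inner l₂) (inner r₂) ::ₘ C) h3.right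
      (Multiset.cons_swap ..))
  have h5 := h4.trans (Rel.had_symm (a := inner l₁) (b := inner r₁)
    (C := had (inner z') (inner t) ::ₘ had (inner z) (inner t) ::ₘ
    node .green 0 (inner z' ::ₘ {inner r₁, inner r₂}) ::ₘ
    node .green ψ (inner z ::ₘ B) ::ₘ node .green φ (inner l₁ ::ₘ inner l₂ ::ₘ A) ::ₘ
      had (inner l₂) (inner r₂) ::ₘ C) h4.right
      (by simp only [← Multiset.singleton_add]; abel))
  have h6 := h5.trans (Rel.had_symm (a := inner l₂) (b := inner r₂)
    (C := had (inner r₁) (inner l₁) ::ₘ had (inner z') (inner t) ::ₘ had (inner z) (inner t) ::ₘ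
    node .green 0 (inner z' ::ₘ {inner r₁, inner r₂}) ::ₘ
    node .green ψ (inner z ::ₘ B) ::ₘ node .green φ (inner l₁ ::ₘ inner l₂ ::ₘ A) ::ₘ C) h5.right
      (by simp only [← Multiset.singleton_add]; abel))
  have h7 := h6.trans (Rel.colour (c := .green) (α := 0)
    (T := {(z', t), (r₁, l₁), (r₂, l₂)}) (f := Prod.fst)
    (g := fun p => inner p.2) (C := had (inner z) (inner t) ::ₘ
    node .green ψ (inner z ::ₘ B) ::ₘ node .green φ (inner l₁ ::ₘ inner l₂ ::ₘ A) ::ₘ C) h6.right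
    (by simp only [Multiset.insert_eq_cons, Multiset.map_cons, Multiset.map_singleton]
        simp only [← Multiset.singleton_add]; abel))
  have h8 := h7.trans (Rel.hopf (c := .green) (k := l₁) (l := l₂) (A := A) (B := {inner t})
    (α := φ) (β := 0)
    (C := had (inner z) (inner t) ::ₘ node .green ψ (inner z ::ₘ B) ::ₘ C) h7.right (by
      simp only [Multiset.insert_eq_cons, Multiset.map_cons, Multiset.map_singleton]
      rw [Multiset.cons_swap (inner t), ← Multiset.cons_zero (inner l₂),
        Multiset.cons_swap (inner t)]
      simp only [Multiset.cons_zero]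
      simp only [← Multiset.singleton_add]; abel))
  obtain ⟨s, h9⟩ := Rel.uncolour_one (c := .green) (C := node .green φ A ::ₘ
    had (inner z) (inner t) ::ₘ node .green ψ (inner z ::ₘ B) ::ₘ C) h8.right
    (Multiset.cons_swap ..)
  have h9 := h8.trans h9
  have h10 := h9.trans (Rel.had_symm (a := inner s) (b := inner t) (C := node .green 0 {inner s} ::ₘ
    node .green φ A ::ₘ had (inner z) (inner t) ::ₘ node .green ψ (inner z ::ₘ B) ::ₘ C) h9.right
    (Multiset.cons_swap ..))
  have h11 := h10.trans (Rel.had_had (a := inner z) (k := t) (b := inner s)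
    (C := node .green 0 {inner s} ::ₘ
    node .green φ A ::ₘ node .green ψ (inner z ::ₘ B) ::ₘ C) h10.right
    (by simp only [← Multiset.singleton_add]; abel))
  have h12 := h11.trans (Rel.join_node (A := 0) h11.right rfl)
  exact (h12.trans (Rel.spider (c := .green) (k := z) (A := B) (B := 0) (C := node .green φ A ::ₘ C)
    h12.right (by simp only [← Multiset.singleton_add]; abel) (add_zero _)
    (add_zero _))).trans_eq (Multiset.cons_swap ..)

end Derived

/-! ### Graphs of green vertices, and local complementation at a red node -/

section Graph

variable {n m : ℕ}

/-- The wires attached to the vertex `v`, given a list of incidences. -/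
def legsAt (L : Multiset (ℕ × Wire n m)) (v : ℕ) : Multiset (Wire n m) :=
  (L.filter fun p => p.1 = v).map Prod.snd

@[simp] theorem legsAt_zero (v : ℕ) : legsAt (0 : Multiset (ℕ × Wire n m)) v = 0 := rfl

@[simp] theorem legsAt_add (L L' : Multiset (ℕ × Wire n m)) (v : ℕ) :
    legsAt (L + L') v = legsAt L v + legsAt L' v := by simp [legsAt]

theorem legsAt_cons_self (v : ℕ) (w : Wire n m) (L : Multiset (ℕ × Wire n m)) :
    legsAt ((v, w) ::ₘ L) v = w ::ₘ legsAt L v := by simp [legsAt]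

theorem legsAt_cons_of_ne {u v : ℕ} (h : u ≠ v) (w : Wire n m) (L : Multiset (ℕ × Wire n m)) :
    legsAt ((u, w) ::ₘ L) v = legsAt L v := by simp [legsAt, h]

theorem legsAt_eq_zero {L : Multiset (ℕ × Wire n m)} {v : ℕ} (h : ∀ p ∈ L, p.1 ≠ v) :
    legsAt L v = 0 := by
  rw [legsAt, Multiset.filter_eq_nil.mpr h, Multiset.map_zero]

theorem legsAt_eq_map {L : Multiset (ℕ × Wire n m)} {v : ℕ} (h : ∀ p ∈ L, p.1 = v) :
    legsAt L v = L.map Prod.snd := by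
  rw [legsAt, Multiset.filter_eq_self.mpr h]

@[simp] theorem legsAt_map_mk_self (v : ℕ) (A : Multiset (Wire n m)) :
    legsAt (A.map (Prod.mk v)) v = A := by
  rw [legsAt_eq_map (by simp), Multiset.map_map]; simp

/-- The green nodes of a graph with vertices `vs`, phases `φ` and incidences `L`. -/
def vertices (vs : Finset ℕ) (φ : ℕ → ZMod 4) (L : Multiset (ℕ × Wire n m)) :
    Multiset (Piece n m) :=
  vs.val.map fun v => node .green (φ v) (legsAt L v)

theorem vertices_congr {vs : Finset ℕ} {φ φ' : ℕ → ZMod 4} {L L' : Multiset (ℕ × Wire n m)}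
    (h : ∀ v ∈ vs, φ v = φ' v) (h' : ∀ v ∈ vs, legsAt L v = legsAt L' v) :
    vertices vs φ L = vertices vs φ' L' :=
  Multiset.map_congr rfl fun v hv => by rw [h v hv, h' v hv]

theorem vertices_insert {vs : Finset ℕ} {v : ℕ} (hv : v ∉ vs) (φ : ℕ → ZMod 4)
    (L : Multiset (ℕ × Wire n m)) : vertices (insert v vs) φ L =
      node .green (φ v) (legsAt L v) ::ₘ vertices vs φ L := by
  rw [vertices, Finset.insert_val_of_notMem hv, Multiset.map_cons]; rfl

theorem vertices_erase {vs : Finset ℕ} {v : ℕ} (hv : v ∈ vs) (φ : ℕ → ZMod 4)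
    (L : Multiset (ℕ × Wire n m)) : vertices vs φ L =
      node .green (φ v) (legsAt L v) ::ₘ vertices (vs.erase v) φ L := by
  rw [← vertices_insert (Finset.notMem_erase v vs), Finset.insert_erase hv]

variable {P C X : Multiset (Piece n m)} {vs : Finset ℕ} {φ : ℕ → ZMod 4}
  {L L₀ : Multiset (ℕ × Wire n m)} {u x : ℕ} {α ε : ZMod 4} {A : Multiset (Wire n m)}

/-- A green node attached to a vertex is merged with the vertex. -/
theorem Rel.absorb (hv : Valid P) (hu : u ∈ vs)
    (hP : P = node .green α (inner x ::ₘ A) ::ₘ (vertices vs φ L₀ + X))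
    (hL : L₀ = (u, inner x) ::ₘ L) :
    Rel P (vertices vs (φ + Pi.single u α) (A.map (Prod.mk u) + L) + X) := by
  subst hL
  rw [vertices_erase hu, legsAt_cons_self] at hP
  refine (Rel.spider (c := .green) (k := x) (α := α) (β := φ u) (A := A) (B := legsAt L u)
    (C := vertices (vs.erase u) φ ((u, inner x) ::ₘ L) + X) hv
    (by rw [hP, Multiset.cons_add]) (add_comm _ _) rfl).trans_eq ?_
  rw [vertices_erase hu, Multiset.cons_add]
  congr 2
  · simp
  · simp
  · refine vertices_congr (fun v hv => ?_) (fun v hv => ?_)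
    · simp [Pi.single_eq_of_ne (Finset.ne_of_mem_erase hv)]
    · have hvu := Finset.ne_of_mem_erase hv
      rw [legsAt_cons_of_ne hvu.symm, legsAt_add, legsAt_eq_zero (L := A.map (Prod.mk u)), zero_add]
      intro p hp
      obtain ⟨w, _, rfl⟩ := Multiset.mem_map.mp hp
      exact hvu.symm

/-- A green node is split off from a vertex. -/
theorem Rel.unabsorb (α : ZMod 4) (hv : Valid P) (hu : u ∈ vs)
    (hP : P = vertices vs φ L₀ + X) (hL : L₀ = A.map (Prod.mk u) + L) :
    ∃ x, Rel P (node .green α (inner x ::ₘ A) ::ₘ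
      (vertices vs (φ - Pi.single u α) ((u, inner x) ::ₘ L) + X)) := by
  subst hL
  rw [vertices_erase hu, legsAt_add, legsAt_map_mk_self, Multiset.cons_add] at hP
  obtain ⟨x, h⟩ := Rel.unspider (c := .green) (α := α) (β := φ u - α) (A := A) (B := legsAt L u)
    hv hP (by ring) rfl
  refine ⟨x, h.trans_eq ?_⟩
  rw [vertices_erase hu, Multiset.cons_add]
  congr 3
  · simp
  · rw [legsAt_cons_self]
  · refine vertices_congr (fun v hv => ?_) (fun v hv => ?_)
    · simp [Pi.single_eq_of_ne (Finset.ne_of_mem_erase hv)]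
    · have hvu := Finset.ne_of_mem_erase hv
      rw [legsAt_cons_of_ne hvu.symm, legsAt_add, legsAt_eq_zero (L := A.map (Prod.mk u)), zero_add]
      intro p hp
      obtain ⟨w, _, rfl⟩ := Multiset.mem_map.mp hp
      exact hvu.symm

/-- The incidences given by pairs of a vertex and the name of an inner wire. -/
def incid (S : Multiset (ℕ × ℕ)) : Multiset (ℕ × Wire n m) := S.map fun s => (s.1, inner s.2)

/-- The wires of a multiset of incidences. -/
def names (S : Multiset (ℕ × ℕ)) : Multiset (Wire n m) := S.map fun s => inner s.2

@[simp] theorem incid_zero : incid (n := n) (m := m) 0 = 0 := rfl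
@[simp] theorem names_zero : names (n := n) (m := m) 0 = 0 := rfl
@[simp] theorem incid_cons (s : ℕ × ℕ) (S : Multiset (ℕ × ℕ)) :
    incid (n := n) (m := m) (s ::ₘ S) = (s.1, inner s.2) ::ₘ incid S := Multiset.map_cons ..
@[simp] theorem names_cons (s : ℕ × ℕ) (S : Multiset (ℕ × ℕ)) :
    names (n := n) (m := m) (s ::ₘ S) = inner s.2 ::ₘ names S := Multiset.map_cons ..
@[simp] theorem incid_add (S T : Multiset (ℕ × ℕ)) :
    incid (n := n) (m := m) (S + T) = incid S + incid T := Multiset.map_add ..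

/-- A red node together with a green node at one of its legs is doubled. -/
theorem Rel.fork {S : Multiset (ℕ × ℕ)} {y : ℕ} {h g : Wire n m} (hS : ∀ s ∈ S, s.1 ∈ vs)
    (hv : Valid P)
    (hP : P = node .red 0 (inner y ::ₘ names S) ::ₘ node .green 0 {inner y, h, g} ::ₘ
      (vertices vs φ L₀ + X)) (hL : L₀ = incid S + L) :
    ∃ Sp Sq : Multiset (ℕ × ℕ), Sp.map Prod.fst = S.map Prod.fst ∧
      Sq.map Prod.fst = S.map Prod.fst ∧
      Rel P (node .red 0 (h ::ₘ names Sp) ::ₘ node .red 0 (g ::ₘ names Sq) ::ₘ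
        (vertices vs φ (incid Sp + incid Sq + L) + X)) := by
  induction S using Multiset.induction generalizing P y h g X L L₀ with
  | empty =>
    refine ⟨0, 0, rfl, rfl, ?_⟩
    simp only [incid_zero, zero_add] at hL
    subst hL
    exact (Rel.copy (c := .green) hv hP).trans_eq (by simp; rfl)
  | cons s S ih =>
    obtain ⟨u, x⟩ := s
    rw [names_cons] at hP
    -- The bialgebra rule is for nodes with three legs, so one leg is split off at a time. Of the
    -- green corners of the square, one merges with `u` and the other is the fork for the remaining
    -- legs.
    obtain ⟨z, h1⟩ := Rel.unspider (c := .red) (α := 0) (β := 0) (A := {inner x, inner y})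
      (B := names S) hv hP (add_zero _)
      (by simp only [Multiset.insert_eq_cons]; simp only [← Multiset.singleton_add]; abel)
    obtain ⟨k₁, k₂, k₃, k₄, h2⟩ := Rel.unbialgebra (c := .green) (k := y) (a₁ := inner x)
      (a₂ := inner z) (b₁ := h) (b₂ := g) (C := node .red 0 (inner z ::ₘ names S) ::ₘ
        (vertices vs φ L₀ + X)) h1.right (by
          have : ({inner x, inner z, inner y} : Multiset (Wire n m)) =
              inner z ::ₘ {inner x, inner y} := Multiset.cons_swap ..
          rw [this]
          simp only [Colour.swap]
          simp only [← Multiset.singleton_add]; abel)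
    have h2 := h1.trans h2
    have hu : u ∈ vs := hS (u, x) (Multiset.mem_cons_self ..)
    have h3 := h2.trans (Rel.absorb (u := u) (x := x) (α := 0) (A := {inner k₁, inner k₂})
      (vs := vs) (φ := φ) (L₀ := L₀) (L := incid S + L) (X := node .green 0 {inner z, inner k₃, inner k₄} ::ₘ
      node .red 0 {inner k₁, inner k₃, h} ::ₘ node .red 0 {inner k₂, inner k₄, g} ::ₘ
      node .red 0 (inner z ::ₘ names S) ::ₘ X) h2.right hu
      (by simp only [Colour.swap, Multiset.insert_eq_cons]; simp only [← Multiset.singleton_add]; abel)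
      (by rw [hL, incid_cons, Multiset.cons_add]))
    rw [Pi.single_zero, add_zero] at h3
    obtain ⟨Sp, Sq, hp, hq, h4⟩ := ih (L := (u, inner k₁) ::ₘ (u, inner k₂) ::ₘ L)
      (y := z) (h := inner k₃) (g := inner k₄) (X := node .red 0 {inner k₁, inner k₃, h} ::ₘ
        node .red 0 {inner k₂, inner k₄, g} ::ₘ X)
      (fun s hs => hS s (Multiset.mem_cons_of_mem hs)) h3.right
      (by simp only [← Multiset.singleton_add]; abel)
      (by simp only [Multiset.insert_eq_cons, Multiset.map_cons, Multiset.map_singleton]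
          simp only [← Multiset.singleton_add]; abel)
    have h4 := h3.trans h4
    have h5 := h4.trans (Rel.spider (c := .red) (k := k₃) (α := 0) (β := 0)
      (A := {inner k₁, h}) (B := names Sp) (M := h ::ₘ names ((u, k₁) ::ₘ Sp))
      (C := node .red 0 (inner k₄ ::ₘ names Sq) ::ₘ node .red 0 {inner k₂, inner k₄, g} ::ₘ
        (vertices vs φ (incid Sp + incid Sq + ((u, inner k₁) ::ₘ (u, inner k₂) ::ₘ L)) + X))
      h4.right (by
        have : ({inner k₁, inner k₃, h} : Multiset (Wire n m)) =
            inner k₃ ::ₘ {inner k₁, h} := Multiset.cons_swap ..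
        rw [this]; simp only [← Multiset.singleton_add]; abel) (add_zero _) (by
        simp only [Multiset.insert_eq_cons, names_cons]
        simp only [← Multiset.singleton_add]; abel))
    have h6 := h5.trans (Rel.spider (c := .red) (k := k₄) (α := 0) (β := 0)
      (A := {inner k₂, g}) (B := names Sq) (M := g ::ₘ names ((u, k₂) ::ₘ Sq))
      (C := node .red 0 (h ::ₘ names ((u, k₁) ::ₘ Sp)) ::ₘ
        (vertices vs φ (incid Sp + incid Sq + ((u, inner k₁) ::ₘ (u, inner k₂) ::ₘ L)) + X))
      h5.right (by
        have : ({inner k₂, inner k₄, g} : Multiset (Wire n m)) =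
            inner k₄ ::ₘ {inner k₂, g} := Multiset.cons_swap ..
        rw [this]; simp only [← Multiset.singleton_add]; abel) (add_zero _) (by
        simp only [Multiset.insert_eq_cons, names_cons]
        simp only [← Multiset.singleton_add]; abel))
    refine ⟨(u, k₁) ::ₘ Sp, (u, k₂) ::ₘ Sq, by simp [hp], by simp [hq], h6.trans_eq ?_⟩
    have : incid (n := n) (m := m) ((u, k₁) ::ₘ Sp) + incid ((u, k₂) ::ₘ Sq) + L =
        incid Sp + incid Sq + ((u, inner k₁) ::ₘ (u, inner k₂) ::ₘ L) := by
      simp only [incid_cons]; simp only [← Multiset.singleton_add]; abel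
    rw [this, Multiset.cons_swap]

/-- An edge `((u, l), (w, r))` joins the vertices `u` and `w` by a Hadamard node between the inner
wires `l` and `r`. -/
abbrev Edge : Type := (ℕ × ℕ) × (ℕ × ℕ)

/-- The incidences of a multiset of edges. -/
def ends (E : Multiset Edge) : Multiset (ℕ × Wire n m) :=
  incid (E.map Prod.fst) + incid (E.map Prod.snd)

/-- The Hadamard nodes of a multiset of edges. -/
def hads (E : Multiset Edge) : Multiset (Piece n m) :=
  E.map fun e => had (inner e.1.2) (inner e.2.2)

@[simp] theorem ends_zero : ends (n := n) (m := m) 0 = 0 := rfl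
@[simp] theorem hads_zero : hads (n := n) (m := m) 0 = 0 := rfl
@[simp] theorem hads_cons (e : Edge) (E : Multiset Edge) :
    hads (n := n) (m := m) (e ::ₘ E) = had (inner e.1.2) (inner e.2.2) ::ₘ hads E :=
  Multiset.map_cons ..
@[simp] theorem hads_add (E F : Multiset Edge) :
    hads (n := n) (m := m) (E + F) = hads E + hads F := Multiset.map_add ..
@[simp] theorem ends_add (E F : Multiset Edge) :
    ends (n := n) (m := m) (E + F) = ends E + ends F := by
  simp only [ends, Multiset.map_add, incid_add]; abel
@[simp] theorem ends_cons (e : Edge) (E : Multiset Edge) :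
    ends (n := n) (m := m) (e ::ₘ E) =
      (e.1.1, inner e.1.2) ::ₘ (e.2.1, inner e.2.2) ::ₘ ends E := by
  simp only [ends, Multiset.map_cons, incid_cons]; simp only [← Multiset.singleton_add]; abel

/-- A red node joined to a vertex by a Hadamard node amounts to edges from that vertex. -/
theorem Rel.fan {S : Multiset (ℕ × ℕ)} {h h' : ℕ} (hu : u ∈ vs) (hv : Valid P)
    (hP : P = had (inner h) (inner h') ::ₘ node .red 0 (inner h' ::ₘ names S) ::ₘ
      (vertices vs φ L₀ + X)) (hL : L₀ = (u, inner h) ::ₘ (incid S + L)) :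
    ∃ E : Multiset Edge, (∀ e ∈ E, e.1.1 = u ∧ e.2.1 ∈ S.map Prod.fst) ∧
      Rel P (vertices vs φ (ends E + L) + (hads E + X)) := by
  -- Colour change puts a Hadamard node on every leg. The one on `h'` cancels the given one, so the
  -- node merges with `u`; the others become edges. The vertex `0` paired with `h'` is a dummy,
  -- since only wire names matter here.
  obtain ⟨T, hT, h1⟩ := Rel.uncolour (c := .green) (α := 0) (S := (0, h') ::ₘ S)
    (g := fun s => inner s.2) (C := had (inner h) (inner h') ::ₘ (vertices vs φ L₀ + X)) hv (by
      rw [hP, Multiset.cons_swap, Multiset.map_cons]; rfl)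
  obtain ⟨⟨k, s⟩, T, rfl, hs, rfl⟩ := exists_cons_of_map_eq_cons hT
  dsimp only at hs
  subst hs
  simp only [Multiset.map_cons] at h1
  have h2 := h1.trans (Rel.had_symm (a := inner k) (b := inner h')
    (C := had (inner h) (inner h') ::ₘ node .green 0 (inner k ::ₘ T.map fun p => inner p.1) ::ₘ
      ((T.map fun p => had (inner p.1) (inner p.2.2)) + (vertices vs φ L₀ + X))) h1.right
      (by simp only [← Multiset.singleton_add]; abel))
  have h3 := h2.trans (Rel.had_had (a := inner h) (k := h') (b := inner k)
    (C := node .green 0 (inner k ::ₘ T.map fun p => inner p.1) ::ₘ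
      ((T.map fun p => had (inner p.1) (inner p.2.2)) + (vertices vs φ L₀ + X))) h2.right
      (by simp only [← Multiset.singleton_add]; abel))
  have h4 := h3.trans (Rel.join_node h3.right rfl)
  have h5 := h4.trans (Rel.absorb (u := u) (x := h) (α := 0) (A := T.map fun p => inner p.1)
    (vs := vs) (φ := φ) (L₀ := L₀) (L := incid (T.map Prod.snd) + L)
    (X := (T.map fun p => had (inner p.1) (inner p.2.2)) + X) h4.right hu
    (by simp only [← Multiset.singleton_add]; abel) hL)
  rw [Pi.single_zero, add_zero] at h5
  refine ⟨T.map fun p => ((u, p.1), p.2), ?_, h5.trans_eq ?_⟩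
  · intro e he
    obtain ⟨p, hp, rfl⟩ := Multiset.mem_map.mp he
    refine ⟨rfl, Multiset.mem_map_of_mem _ (Multiset.mem_map_of_mem Prod.snd hp)⟩
  · simp only [ends, incid, hads, Multiset.map_map, Function.comp_def]
    rw [add_assoc]

/-- Scalar diagrams that are decomposed into segments. -/
def IsScalars (Sc : Multiset (Piece n m)) : Prop :=
  ∃ S : Multiset (Multiset (Piece n m)), (∀ s ∈ S, ScalarSegment s) ∧ S.sum = Sc

theorem IsScalars.zero : IsScalars (0 : Multiset (Piece n m)) := ⟨0, by simp, rfl⟩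

theorem IsScalars.add {Sc Sc' : Multiset (Piece n m)} (h : IsScalars Sc) (h' : IsScalars Sc') :
    IsScalars (Sc + Sc') := by
  obtain ⟨S, hS, rfl⟩ := h
  obtain ⟨S', hS', rfl⟩ := h'
  refine ⟨S + S', fun s hs => ?_, Multiset.sum_add ..⟩
  rcases Multiset.mem_add.mp hs with h | h
  exacts [hS s h, hS' s h]

theorem IsScalars.of_segment {s : Multiset (Piece n m)} (h : ScalarSegment s) : IsScalars s :=
  ⟨{s}, by simpa using h, by simp⟩

theorem IsScalars.single (c : Colour) (α : ZMod 4) :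
    IsScalars ({node c α 0} : Multiset (Piece n m)) := .of_segment (.single c α)

theorem IsScalars.pair (α β : ZMod 4) (k : ℕ) :
    IsScalars ({node .green α {inner k}, node .red β {inner k}} : Multiset (Piece n m)) :=
  .of_segment (.pair α β k)

/-- Local complementation: a red node with an odd phase whose legs are attached to vertices is
replaced by edges between these vertices. -/
theorem Rel.star (hε : ε = 1 ∨ ε = -1) {S : Multiset (ℕ × ℕ)} (hS : ∀ s ∈ S, s.1 ∈ vs)
    (hv : Valid P) (hP : P = node .red ε (names S) ::ₘ (vertices vs φ L₀ + X))
    (hL : L₀ = incid S + L) :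
    ∃ (E : Multiset Edge) (Sc : Multiset (Piece n m)), IsScalars Sc ∧
      (∀ e ∈ E, e.1.1 ∈ vs ∧ e.2.1 ∈ vs) ∧
      Rel P (vertices vs (fun u => φ u - (S.map Prod.fst).count u * ε) (ends E + L) +
        (hads E + (Sc + X))) := by
  -- The induction runs over the multiset of vertices and not over `S`, because `Rel.fork` renames
  -- the wires.
  obtain ⟨U, hU⟩ : ∃ U, S.map Prod.fst = U := ⟨_, rfl⟩
  rw [hU]
  induction U using Multiset.induction generalizing P X S L L₀ φ with
  | empty =>
    rw [Multiset.map_eq_zero] at hU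
    subst hU
    refine ⟨0, _, .single .red ε, by simp, Rel.of_eq hv ?_⟩
    simp only [incid_zero, zero_add] at hL
    subst hL
    simp only [names_zero] at hP
    simp only [ends_zero, hads_zero, zero_add, Multiset.count_zero,
      Nat.cast_zero, zero_mul, sub_zero, hP]
    simp only [← Multiset.singleton_add]; abel
  | cons u U ih =>
    obtain ⟨⟨u, x⟩, S, rfl, rfl, rfl⟩ := exists_cons_of_map_eq_cons hU
    have hu : u ∈ vs := hS (u, x) (Multiset.mem_cons_self ..)
    have hS' : ∀ s ∈ S, s.1 ∈ vs := fun s hs => hS s (Multiset.mem_cons_of_mem hs)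
    have hS'' : ∀ v ∈ S.map Prod.fst, v ∈ vs := by
      intro v hv
      obtain ⟨s, hs, rfl⟩ := Multiset.mem_map.mp hv
      exact hS' s hs
    rw [names_cons] at hP
    -- The leg at `u` is detached together with the whole phase, which becomes two green phases `-ε`
    -- around a Hadamard node. One of these merges with `u`; the other is split off, so that a
    -- phaseless green fork remains.
    obtain ⟨y, h1⟩ := Rel.unspider (c := .red) (α := ε) (β := 0) (A := {inner x})
      (B := names S) hv hP (add_zero _) (Multiset.singleton_add ..)
    obtain ⟨h, h', h2⟩ := Rel.quarter_turn (c := .green) (a := inner x) (b := inner y)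
      (C := node .red 0 (inner y ::ₘ names S) ::ₘ (vertices vs φ L₀ + X)) hε h1.right (by
        rw [Multiset.pair_comm]; rfl)
    have h2 := h1.trans h2
    have h3 := h2.trans (Rel.absorb (u := u) (x := x) (α := -ε) (A := {inner h})
      (vs := vs) (φ := φ) (L₀ := L₀) (L := incid S + L)
      (X := had (inner h) (inner h') ::ₘ node .green (-ε) {inner h', inner y} ::ₘ
      node .red 0 (inner y ::ₘ names S) ::ₘ X) h2.right hu
      (by simp only [Multiset.insert_eq_cons]; simp only [← Multiset.singleton_add]; abel)
      (by rw [hL, incid_cons, Multiset.cons_add]))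
    simp only [Multiset.map_singleton] at h3
    obtain ⟨g, h4⟩ := Rel.unspider (c := .green) (α := 0) (β := -ε) (A := {inner y, inner h'})
      (B := 0) (M := {inner h', inner y})
      (C := had (inner h) (inner h') ::ₘ node .red 0 (inner y ::ₘ names S) ::ₘ
        (vertices vs (φ + Pi.single u (-ε)) ({(u, inner h)} + (incid S + L)) + X)) h3.right
      (by simp only [← Multiset.singleton_add]; abel) (zero_add _)
      (by rw [add_zero, Multiset.pair_comm])
    have h4 := h3.trans h4
    obtain ⟨Sp, Sq, hp, hq, h5⟩ := Rel.fork (y := y) (h := inner h') (g := inner g) (S := S)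
      (L := {(u, inner h)} + L) (φ := φ + Pi.single u (-ε)) (L₀ := {(u, inner h)} + (incid S + L))
      (X := node .green (-ε) {inner g} ::ₘ had (inner h) (inner h') ::ₘ X) hS' h4.right
      (by
        have : ({inner y, inner h', inner g} : Multiset (Wire n m)) =
            inner g ::ₘ {inner y, inner h'} := by
          simp only [Multiset.insert_eq_cons]; simp only [← Multiset.singleton_add]; abel
        rw [this]
        simp only [Multiset.cons_zero]
        simp only [← Multiset.singleton_add]; abel)
      (by abel)
    have h5 := h4.trans h5
    -- Of the two copies of the red node, the one at `g` recovers the phase `ε` from the green state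
    -- there, and the induction hypothesis applies to it.
    obtain ⟨w, h6⟩ := Rel.odd_state (c := .red) (ε := -ε) (a := inner g)
      (C := node .red 0 (inner h' ::ₘ names Sp) ::ₘ node .red 0 (inner g ::ₘ names Sq) ::ₘ
        (vertices vs (φ + Pi.single u (-ε)) (incid Sp + incid Sq + ({(u, inner h)} + L)) +
        (had (inner h) (inner h') ::ₘ X)))
      (by rcases hε with rfl | rfl <;> simp) h5.right
      (by simp only [Colour.swap]; simp only [← Multiset.singleton_add]; abel)
    have h6 := h5.trans h6
    rw [neg_neg] at h6
    have h7 := h6.trans (Rel.spider (c := .red) (k := g) (α := ε) (β := 0) (A := 0)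
      (B := names Sq)
      (C := node .red ε {inner w} ::ₘ node .green 0 {inner w} ::ₘ
        node .red 0 (inner h' ::ₘ names Sp) ::ₘ
        (vertices vs (φ + Pi.single u (-ε)) (incid Sp + incid Sq + ({(u, inner h)} + L)) +
        (had (inner h) (inner h') ::ₘ X))) h6.right
      (by simp only [Multiset.cons_zero, Colour.swap]; simp only [← Multiset.singleton_add]; abel)
      (add_zero _) (zero_add _))
    have hmem : ∀ T : Multiset (ℕ × ℕ), T.map Prod.fst = S.map Prod.fst → ∀ s ∈ T, s.1 ∈ vs :=
      fun T hT s hs => hS'' _ (hT ▸ Multiset.mem_map_of_mem _ hs)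
    obtain ⟨E, Sc, hSc, hE, h8⟩ := ih (hmem Sq hq) h7.right
      (X := node .red ε {inner w} ::ₘ node .green 0 {inner w} ::ₘ
        node .red 0 (inner h' ::ₘ names Sp) ::ₘ had (inner h) (inner h') ::ₘ X)
      (by simp only [← Multiset.singleton_add]; abel)
      (L := incid Sp + ({(u, inner h)} + L)) (by abel) hq
    have h8 := h7.trans h8
    -- The phaseless copy supplies the edges from `u` to all vertices still in the list; altogether
    -- the graph on the neighbours is complemented.
    obtain ⟨F, hF, h9⟩ := Rel.fan (u := u) (h := h) (h' := h') (S := Sp) (L := ends E + L)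
      (X := hads E + (Sc + (node .red ε {inner w} ::ₘ node .green 0 {inner w} ::ₘ X)))
      hu h8.right (by simp only [← Multiset.singleton_add]; abel)
      (by simp only [← Multiset.singleton_add]; abel)
    refine ⟨E + F, Sc + {node .green 0 {inner w}, node .red ε {inner w}}, hSc.add (.pair ..),
      fun e he => ?_, (h8.trans h9).trans_eq ?_⟩
    · rcases Multiset.mem_add.mp he with he | he
      · exact hE e he
      · obtain ⟨h1, h2⟩ := hF e he
        exact ⟨h1 ▸ hu, hS'' _ (hp ▸ h2)⟩
    · have e1 : ends (n := n) (m := m) F + (ends E + L) = ends (E + F) + L := by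
        rw [ends_add]; abel
      have e2 : (fun u' => (φ + Pi.single u (-ε) : ℕ → ZMod 4) u' - (S.map Prod.fst).count u' * ε) =
          fun u' => φ u' - (u ::ₘ S.map Prod.fst).count u' * ε := by
        funext u'
        rw [Multiset.count_cons, Pi.add_apply, Pi.single_apply]
        split_ifs <;> push_cast <;> ring
      rw [e1, e2, hads_add]
      simp only [Multiset.insert_eq_cons]; simp only [← Multiset.singleton_add]; abel

end Graph

/-! ### Graphs with legs: elimination of vertices, loops and parallel edges -/

section GraphLike

variable {n m : ℕ}

/-- Chains are defined by growing at the boundary end, while the reduction pushes operators out of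
the graph at the vertex end. -/
theorem LocalClifford.prepend_shift {a b : Wire n m} {E : Multiset (Piece n m)}
    (h : LocalClifford a b E) (c : Colour) (α : ZMod 4) (k : ℕ) :
    LocalClifford (inner k) b (node c α {inner k, a} ::ₘ E) := by
  induction h with
  | nil => exact .shift c α _ _ k 0 (.nil _)
  | shift c' α' a b l E _ ih =>
    rw [Multiset.cons_swap]; exact .shift _ _ _ _ _ _ ih
  | had a b l E _ ih =>
    rw [Multiset.cons_swap]; exact .had _ _ _ _ ih

theorem LocalClifford.prepend_had {a b : Wire n m} {E : Multiset (Piece n m)}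
    (h : LocalClifford a b E) (k : ℕ) :
    LocalClifford (inner k) b (Piece.had (inner k) a ::ₘ E) := by
  induction h with
  | nil => exact .had _ _ k 0 (.nil _)
  | shift c' α' a b l E _ ih =>
    rw [Multiset.cons_swap]; exact .shift _ _ _ _ _ _ ih
  | had a b l E _ ih =>
    rw [Multiset.cons_swap]; exact .had _ _ _ _ ih

/-- An input or output, joined by a chain of single-qubit operators to a vertex of a graph. -/
structure Leg (n m : ℕ) : Type where
  vertex : ℕ
  wire : Wire n m
  bdry : Fin n ⊕ Fin m
  chain : Multiset (Piece n m)

/-- The incidences of the wires that lead to the inputs and outputs. -/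
def outs (K : Multiset (Leg n m)) : Multiset (ℕ × Wire n m) := K.map fun κ => (κ.vertex, κ.wire)

/-- The chains of single-qubit operators at the inputs and outputs. -/
def chains (K : Multiset (Leg n m)) : Multiset (Piece n m) := (K.map Leg.chain).sum

@[simp] theorem outs_cons (κ : Leg n m) (K : Multiset (Leg n m)) :
    outs (κ ::ₘ K) = (κ.vertex, κ.wire) ::ₘ outs K := Multiset.map_cons ..
@[simp] theorem chains_cons (κ : Leg n m) (K : Multiset (Leg n m)) :
    chains (κ ::ₘ K) = κ.chain + chains K := by simp [chains]

/-- The pieces of a graph with vertices `vs`, phases `φ`, edges `E` and legs `K`. -/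
def graph (vs : Finset ℕ) (φ : ℕ → ZMod 4) (E : Multiset Edge) (K : Multiset (Leg n m)) :
    Multiset (Piece n m) :=
  vertices vs φ (ends E + outs K) + (hads E + chains K)

/-- `P` can be rewritten into a graph next to decomposed scalars. -/
structure GraphLike (P : Multiset (Piece n m)) (vs : Finset ℕ) (φ : ℕ → ZMod 4)
    (E : Multiset Edge) (K : Multiset (Leg n m)) : Prop where
  edge_mem : ∀ e ∈ E, e.1.1 ∈ vs ∧ e.2.1 ∈ vs
  leg_mem : ∀ κ ∈ K, κ.vertex ∈ vs
  chain : ∀ κ ∈ K, LocalClifford κ.wire (boundary κ.bdry) κ.chain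
  bdry : K.map Leg.bdry = Finset.univ.val
  rel : ∃ Sc, IsScalars Sc ∧ Rel P (graph vs φ E K + Sc)

/-- The unordered pair of vertices joined by an edge. -/
def Edge.sym (e : Edge) : Sym2 ℕ := s(e.1.1, e.2.1)

/-- Turn around an edge that leads to `v`. -/
def Edge.orient (v : ℕ) (e : Edge) : Edge := if e.2.1 = v then e.swap else e

theorem Rel.flip {P C : Multiset (Piece n m)} {E : Multiset Edge} {f : Edge → Edge}
    (hf : ∀ e, f e = e ∨ f e = e.swap) (hv : Valid P) (hP : P = hads E + C) :
    Rel P (hads (E.map f) + C) := by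
  induction E using Multiset.induction generalizing P C with
  | empty => exact Rel.of_eq hv (by simpa using hP)
  | cons e E ih =>
    have h1 := ih (C := had (inner e.1.2) (inner e.2.2) ::ₘ C) hv
      (by rw [hP, hads_cons]; simp only [← Multiset.singleton_add]; abel)
    rw [Multiset.map_cons]
    rcases hf e with he | he
    · exact h1.trans_eq (by rw [he, hads_cons]; simp only [← Multiset.singleton_add]; abel)
    · refine (h1.trans (Rel.had_symm (a := inner e.1.2) (b := inner e.2.2)
        (C := hads (E.map f) + C) h1.right
        (by simp only [← Multiset.singleton_add]; abel))).trans_eq ?_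
      rw [he, hads_cons, Multiset.cons_add]; rfl

theorem ends_map_flip {E : Multiset Edge} {f : Edge → Edge}
    (hf : ∀ e, f e = e ∨ f e = e.swap) :
    ends (n := n) (m := m) (E.map f) = ends E := by
  induction E using Multiset.induction with
  | empty => rfl
  | cons e E ih =>
    rw [Multiset.map_cons, ends_cons, ends_cons, ih]
    rcases hf e with he | he
    · rw [he]
    · rw [he, Multiset.cons_swap]; rfl

theorem Edge.orient_eq (v : ℕ) (e : Edge) : e.orient v = e ∨ e.orient v = e.swap := by
  unfold Edge.orient; split_ifs <;> simp

/-- Expresses the leg counts in the phases of `Rel.star` by edge multiplicities, which do not depend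
on the orientation of edges. -/
theorem count_neighbours (E : Multiset Edge) (v u : ℕ) :
    (((E.map (Edge.orient v)).filter fun e => e.1.1 = v).map fun e => e.2.1).count u =
      (E.map Edge.sym).count s(v, u) := by
  induction E using Multiset.induction with
  | empty => rfl
  | cons e E ih =>
    obtain ⟨⟨a, k⟩, ⟨b, l⟩⟩ := e
    simp only [Multiset.map_cons, Multiset.filter_cons, Multiset.map_add, Multiset.count_add, ih,
      Multiset.count_cons]
    rw [add_comm]
    congr 1
    unfold Edge.orient Edge.sym
    simp only [Sym2.eq_iff]
    by_cases h1 : b = v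
    · subst h1
      by_cases h2 : a = u
      · subst h2; simp
      · simp [Ne.symm h2]
        rintro rfl h
        exact h2 h.symm
    · by_cases h2 : a = v
      · subst h2; simp [h1, Multiset.count_singleton, Ne.symm h1]
      · simp [h1, h2, Ne.symm h1, Ne.symm h2]

variable {P : Multiset (Piece n m)} {vs : Finset ℕ} {φ : ℕ → ZMod 4} {E : Multiset Edge}
  {K : Multiset (Leg n m)}

/-- Elimination of an inner vertex with an odd phase. -/
theorem GraphLike.eliminate {v : ℕ} (h : GraphLike P (insert v vs) φ E K) (hv : v ∉ vs)
    (hK : ∀ κ ∈ K, κ.vertex ≠ v) (hφ : φ v = 1 ∨ φ v = -1) (hl : ∀ e ∈ E, e.sym ≠ s(v, v)) :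
    ∃ E', GraphLike P vs (fun u => φ u - (E.map Edge.sym).count s(v, u) * φ v) E' K := by
  obtain ⟨hE, hKv, hc, hb, Sc, hSc, h0⟩ := h
  unfold graph at h0
  -- All edges at `v` are turned so that `v` is their first end.
  have h1 := h0.trans (Rel.flip (f := Edge.orient v) (E := E) (Edge.orient_eq v)
    (C := vertices (insert v vs) φ (ends E + outs K) + chains K + Sc) h0.right (by abel))
  set F := E.map (Edge.orient v) with hF
  have hFE : ends (n := n) (m := m) F = ends E := ends_map_flip (Edge.orient_eq v)
  have hFl : ∀ e ∈ F, e.2.1 ≠ v := by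
    intro e he
    obtain ⟨e, he', rfl⟩ := Multiset.mem_map.mp he
    have := hl e he'
    unfold Edge.orient
    split_ifs with h2
    · intro h3; apply this; simp only [Edge.sym, Prod.snd_swap] at h3 ⊢; rw [h3, h2]
    · exact h2
  have hFm : ∀ e ∈ F, e.1.1 ∈ insert v vs ∧ e.2.1 ∈ insert v vs := by
    intro e he
    obtain ⟨e, he', rfl⟩ := Multiset.mem_map.mp he
    rcases Edge.orient_eq v e with h | h <;> rw [h]
    · exact hE e he'
    · exact (hE e he').symm
  set A := F.filter fun e => e.1.1 = v with hA
  set B := F.filter fun e => ¬ e.1.1 = v with hB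
  have hAB : F = A + B := (Multiset.filter_add_not _ F).symm
  -- In the absence of legs and loops at `v`, its wires are exactly the near ends of the edges in
  -- `A`.
  have hat : legsAt (ends (n := n) (m := m) E + outs K) v = A.map fun e => inner e.1.2 := by
    rw [← hFE, hAB, legsAt_add, ends_add, legsAt_add, legsAt_eq_zero (L := outs K),
      legsAt_eq_zero (L := ends B), add_zero, add_zero, ends, legsAt_add,
      legsAt_eq_zero (L := incid (A.map Prod.snd)), legsAt_eq_map, incid, Multiset.map_map,
      Multiset.map_map, add_zero]
    · rfl
    · intro p hp
      simp only [incid, Multiset.map_map, Multiset.mem_map] at hp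
      obtain ⟨e, he, rfl⟩ := hp
      exact (Multiset.mem_filter.mp he).2
    · intro p hp
      simp only [incid, Multiset.map_map, Multiset.mem_map] at hp
      obtain ⟨e, he, rfl⟩ := hp
      exact hFl e (Multiset.mem_filter.mp he).1
    · intro p hp
      simp only [ends, incid, Multiset.map_map, Multiset.mem_map, Multiset.mem_add] at hp
      rcases hp with ⟨e, he, rfl⟩ | ⟨e, he, rfl⟩
      · exact (Multiset.mem_filter.mp he).2
      · exact hFl e (Multiset.mem_filter.mp he).1
    · intro p hp
      simp only [outs, Multiset.mem_map] at hp
      obtain ⟨κ, hκ, rfl⟩ := hp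
      exact hK κ hκ
  -- The Hadamard nodes of the edges in `A` are consumed, and `v` becomes a red node wired directly
  -- to its neighbours, as `Rel.star` requires.
  have h2 := h1.trans (Rel.colour (c := .green) (α := φ v) (T := A) (f := fun e => e.1.2)
    (g := fun e => inner e.2.2) (C := vertices vs φ (ends E + outs K) + chains K + hads B + Sc)
    h1.right (by
      rw [vertices_insert hv, hat, hAB, hads_add]
      simp only [hads]
      simp only [← Multiset.singleton_add]; abel))
  have hAv : ∀ s ∈ A.map Prod.snd, s.1 ∈ vs := by
    intro s hs
    obtain ⟨e, he, rfl⟩ := Multiset.mem_map.mp hs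
    have h3 := hFl e (Multiset.mem_filter.mp he).1
    exact (Finset.mem_insert.mp (hFm e (Multiset.mem_filter.mp he).1).2).resolve_left h3
  obtain ⟨E', Sc', hSc', hE', h3⟩ := Rel.star (S := A.map Prod.snd) (vs := vs) (φ := φ)
    (L₀ := incid (A.map Prod.snd) + (ends B + outs K)) (L := ends B + outs K) (ε := φ v)
    (X := chains K + hads B + Sc) hφ hAv h2.right (by
      have e1 : vertices vs φ (ends E + outs K) =
          vertices vs φ (incid (A.map Prod.snd) + (ends B + outs K)) := by
        refine vertices_congr (fun _ _ => rfl) fun u hu => ?_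
        rw [← hFE, hAB, ends_add]
        simp only [legsAt_add]
        rw [ends, legsAt_add, legsAt_eq_zero (L := incid (A.map Prod.fst)), zero_add, add_assoc]
        intro p hp
        simp only [incid, Multiset.map_map, Multiset.mem_map] at hp
        obtain ⟨e, he, rfl⟩ := hp
        have := (Multiset.mem_filter.mp he).2
        simp only [Function.comp_apply, this]
        rintro rfl
        exact hv hu
      rw [e1, names, Multiset.map_map]
      simp only [Colour.swap, Function.comp_def]
      simp only [← Multiset.singleton_add]; abel) rfl
  refine ⟨E' + B, ⟨?_, ?_, hc, hb, Sc + Sc', hSc.add hSc', (h2.trans h3).trans_eq ?_⟩⟩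
  · intro e he
    rcases Multiset.mem_add.mp he with he | he
    · exact hE' e he
    · obtain ⟨h4, h5⟩ := Multiset.mem_filter.mp he
      exact ⟨(Finset.mem_insert.mp (hFm e h4).1).resolve_left h5,
        (Finset.mem_insert.mp (hFm e h4).2).resolve_left (hFl e h4)⟩
  · intro κ hκ
    exact (Finset.mem_insert.mp (hKv κ hκ)).resolve_left (hK κ hκ)
  · have e2 : (fun u => φ u - (((A.map Prod.snd).map Prod.fst).count u : ZMod 4) * φ v) =
        fun u => φ u - ((E.map Edge.sym).count s(v, u) : ZMod 4) * φ v := by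
      funext u
      rw [← count_neighbours, Multiset.map_map]; rfl
    rw [e2]
    unfold graph
    rw [ends_add, hads_add, add_assoc (ends E')]
    abel

/-- A vertex without edges and legs is a scalar. -/
theorem GraphLike.isolated {v : ℕ} (h : GraphLike P (insert v vs) φ E K) (hv : v ∉ vs)
    (hK : ∀ κ ∈ K, κ.vertex ≠ v) (hl : ∀ e ∈ E, e.1.1 ≠ v ∧ e.2.1 ≠ v) :
    GraphLike P vs φ E K := by
  obtain ⟨hE, hKv, hc, hb, Sc, hSc, h0⟩ := h
  refine ⟨fun e he => ⟨?_, ?_⟩, fun κ hκ => ?_, hc, hb, Sc + {node .green (φ v) 0},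
    hSc.add (.single ..), h0.trans_eq ?_⟩
  · exact (Finset.mem_insert.mp (hE e he).1).resolve_left (hl e he).1
  · exact (Finset.mem_insert.mp (hE e he).2).resolve_left (hl e he).2
  · exact (Finset.mem_insert.mp (hKv κ hκ)).resolve_left (hK κ hκ)
  · unfold graph
    rw [vertices_insert hv, legsAt_eq_zero]
    · simp only [← Multiset.singleton_add]; abel
    · intro p hp
      simp only [ends, incid, outs, Multiset.map_map, Multiset.mem_map, Multiset.mem_add] at hp
      rcases hp with (⟨e, he, rfl⟩ | ⟨e, he, rfl⟩) | ⟨κ, hκ, rfl⟩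
      · exact (hl e he).1
      · exact (hl e he).2
      · exact hK κ hκ

/-- A loop is replaced by a phase of `π`. -/
theorem GraphLike.remove_loop {e : Edge} (h : GraphLike P vs φ (e ::ₘ E) K)
    (he : e.1.1 = e.2.1) : GraphLike P vs (φ + Pi.single e.1.1 2) E K := by
  obtain ⟨hE, hKv, hc, hb, Sc, hSc, h0⟩ := h
  have hu := (hE e (Multiset.mem_cons_self ..)).1
  unfold graph at h0
  rw [ends_cons, ← he, Multiset.cons_add, Multiset.cons_add, vertices_erase hu, legsAt_cons_self,
    legsAt_cons_self] at h0
  refine ⟨fun e' he' => hE e' (Multiset.mem_cons_of_mem he'), hKv, hc, hb,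
    Sc + {node .red 1 0}, hSc.add (.single ..),
    (h0.trans (Rel.had_loop (l := e.1.2) (r := e.2.2) (φ := φ e.1.1)
      (A := legsAt (ends E + outs K) e.1.1) (C := vertices (vs.erase e.1.1) φ
        ((e.1.1, inner e.1.2) ::ₘ (e.1.1, inner e.2.2) ::ₘ (ends E + outs K)) + hads E + chains K +
        Sc) h0.right (by rw [hads_cons]; simp only [← Multiset.singleton_add]; abel))).trans_eq ?_⟩
  unfold graph
  rw [vertices_erase hu]
  have e1 : vertices (vs.erase e.1.1) φ
      ((e.1.1, inner e.1.2) ::ₘ (e.1.1, inner e.2.2) ::ₘ (ends E + outs K)) =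
      vertices (vs.erase e.1.1) (φ + Pi.single e.1.1 2) (ends E + outs K) := by
    refine vertices_congr (fun v hv => ?_) fun v hv => ?_
    · simp [Pi.single_eq_of_ne (Finset.ne_of_mem_erase hv)]
    · have := (Finset.ne_of_mem_erase hv).symm
      rw [legsAt_cons_of_ne this, legsAt_cons_of_ne this]
  rw [e1]
  simp only [Pi.add_apply, Pi.single_eq_same]
  simp only [← Multiset.singleton_add]; abel

/-- Parallel edges cancel. -/
theorem GraphLike.remove_parallel {e f : Edge} (h : GraphLike P vs φ (e ::ₘ f ::ₘ E) K)
    (he : e.1.1 ≠ e.2.1) (h1 : e.1.1 = f.1.1) (h2 : e.2.1 = f.2.1) : GraphLike P vs φ E K := by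
  obtain ⟨hE, hKv, hc, hb, Sc, hSc, h0⟩ := h
  have hu := hE e (Multiset.mem_cons_self ..)
  have hw : e.2.1 ∈ vs.erase e.1.1 := Finset.mem_erase.mpr ⟨he.symm, hu.2⟩
  refine ⟨fun e' he' => hE e' (Multiset.mem_cons_of_mem (Multiset.mem_cons_of_mem he')), hKv, hc,
    hb, Sc, hSc, ?_⟩
  have e0 : ends (n := n) (m := m) (e ::ₘ f ::ₘ E) + outs K = (e.1.1, inner e.1.2) ::ₘ
      (e.1.1, inner f.1.2) ::ₘ (e.2.1, inner e.2.2) ::ₘ (e.2.1, inner f.2.2) ::ₘ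
      (ends E + outs K) := by
    rw [ends_cons, ends_cons, h1, h2]; simp only [← Multiset.singleton_add]; abel
  unfold graph at h0
  rw [e0, vertices_erase hu.1, vertices_erase hw] at h0
  simp only [legsAt_cons_self, legsAt_cons_of_ne he, legsAt_cons_of_ne he.symm] at h0
  refine (h0.trans (Rel.had_parallel (l₁ := e.1.2) (l₂ := f.1.2) (r₁ := e.2.2) (r₂ := f.2.2)
    (φ := φ e.1.1) (ψ := φ e.2.1)
    (A := legsAt (ends E + outs K) e.1.1) (B := legsAt (ends E + outs K) e.2.1)
    (C := vertices ((vs.erase e.1.1).erase e.2.1) φ ((e.1.1, inner e.1.2) ::ₘ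
      (e.1.1, inner f.1.2) ::ₘ (e.2.1, inner e.2.2) ::ₘ (e.2.1, inner f.2.2) ::ₘ
      (ends E + outs K)) + hads E + chains K + Sc) h0.right (by
        rw [hads_cons, hads_cons]; simp only [← Multiset.singleton_add]; abel))).trans_eq ?_
  unfold graph
  rw [vertices_erase hu.1, vertices_erase hw]
  have e1 : vertices ((vs.erase e.1.1).erase e.2.1) φ ((e.1.1, inner e.1.2) ::ₘ
      (e.1.1, inner f.1.2) ::ₘ (e.2.1, inner e.2.2) ::ₘ (e.2.1, inner f.2.2) ::ₘ
      (ends E + outs K)) =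
      vertices ((vs.erase e.1.1).erase e.2.1) φ (ends E + outs K) := by
    refine vertices_congr (fun v hv => rfl) fun v hv => ?_
    have h3 := (Finset.ne_of_mem_erase hv).symm
    have h4 := (Finset.ne_of_mem_erase (Finset.mem_of_mem_erase hv)).symm
    simp only [legsAt_cons_of_ne h3, legsAt_cons_of_ne h4]
  rw [e1]
  simp only [← Multiset.singleton_add]; abel

theorem GraphLike.flip_edge {e : Edge} (h : GraphLike P vs φ (e ::ₘ E) K) :
    GraphLike P vs φ (e.swap ::ₘ E) K := by
  obtain ⟨hE, hKv, hc, hb, Sc, hSc, h0⟩ := h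
  refine ⟨?_, hKv, hc, hb, Sc, hSc, (h0.trans (Rel.had_symm (a := inner e.1.2) (b := inner e.2.2)
    (C := vertices vs φ (ends (e ::ₘ E) + outs K) + hads E + chains K + Sc) h0.right ?_)).trans_eq
    ?_⟩
  · intro e' he'
    rcases Multiset.mem_cons.mp he' with rfl | he'
    · exact (hE e (Multiset.mem_cons_self ..)).symm
    · exact hE e' (Multiset.mem_cons_of_mem he')
  · unfold graph; rw [hads_cons]; simp only [← Multiset.singleton_add]; abel
  · unfold graph
    rw [hads_cons, ends_cons, ends_cons, Multiset.cons_swap (e.1.1, inner e.1.2)]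
    simp only [Prod.fst_swap, Prod.snd_swap]
    simp only [← Multiset.singleton_add]; abel

/-- Without loops and parallel edges. -/
def IsSimple (E : Multiset Edge) : Prop :=
  (∀ e ∈ E, e.1.1 ≠ e.2.1) ∧ (E.map Edge.sym).Nodup

/-- Loops and parallel edges can be removed. -/
theorem GraphLike.simplify (h : GraphLike P vs φ E K) :
    ∃ φ' E', IsSimple E' ∧ (∀ u, φ' u = φ u ∨ φ' u = φ u + 2) ∧ GraphLike P vs φ' E' K := by
  induction hN : Multiset.card E using Nat.strong_induction_on generalizing φ E with
  | _ N ih =>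
  subst hN
  by_cases h1 : ∃ e ∈ E, e.1.1 = e.2.1
  · obtain ⟨e, he, h1⟩ := h1
    obtain ⟨E, rfl⟩ := Multiset.exists_cons_of_mem he
    obtain ⟨φ', E', hE', hφ', h'⟩ := ih _ (by simp) (h.remove_loop h1) rfl
    refine ⟨φ', E', hE', fun u => ?_, h'⟩
    have h2 := hφ' u
    -- Phases are known up to π only: each loop adds `2`, and two of them cancel modulo `4`. Parity
    -- is all that the elimination of odd vertices needs.
    have h3 : ∀ a b : ZMod 4, a = b + 2 ∨ a = b + 2 + 2 → a = b ∨ a = b + 2 := by decide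
    simp only [Pi.add_apply] at h2
    by_cases hu : u = e.1.1
    · subst hu; simp only [Pi.single_eq_same] at h2; exact h3 _ _ h2
    · simpa [Pi.single_eq_of_ne hu] using h2
  · push Not at h1
    by_cases h2 : (E.map Edge.sym).Nodup
    · exact ⟨φ, E, ⟨h1, h2⟩, fun u => Or.inl rfl, h⟩
    · have : ∃ e f E', E = e ::ₘ f ::ₘ E' ∧ e.sym = f.sym := by
        by_contra hne
        push Not at hne
        apply h2
        rw [Multiset.nodup_iff_ne_cons_cons]
        intro s t hst
        obtain ⟨e, E', rfl, he, h3⟩ := exists_cons_of_map_eq_cons hst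
        obtain ⟨f, E'', rfl, hf, h4⟩ := exists_cons_of_map_eq_cons h3
        exact hne e f E'' rfl (he.trans hf.symm)
      obtain ⟨e, f, E, rfl, hef⟩ := this
      have hne := h1 e (Multiset.mem_cons_self ..)
      have h3 : GraphLike P vs φ E K := by
        rcases Sym2.eq_iff.mp hef with ⟨h4, h5⟩ | ⟨h4, h5⟩
        · exact h.remove_parallel hne h4 h5
        · refine GraphLike.remove_parallel (e := e) (f := f.swap) ?_ hne h4 h5
          rw [Multiset.cons_swap] at h ⊢
          exact h.flip_edge
      exact ih _ (by simp) h3 rfl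

end GraphLike

/-! ### Elimination of all vertices without legs -/

section Reduction

variable {n m : ℕ} {P : Multiset (Piece n m)} {vs : Finset ℕ} {φ : ℕ → ZMod 4}
  {E : Multiset Edge} {K : Multiset (Leg n m)}

/-- A green node can be regarded as a new vertex. -/
theorem vertices_insert_update {i : ℕ} {L : Multiset (ℕ × Wire n m)} (hi : i ∉ vs)
    (hL : ∀ p ∈ L, p.1 ∈ vs) (α : ZMod 4) (A : Multiset (Wire n m)) :
    vertices (insert i vs) (Function.update φ i α) (A.map (Prod.mk i) + L) =
      node .green α A ::ₘ vertices vs φ L := by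
  rw [vertices_insert hi, Function.update_self, legsAt_add, legsAt_map_mk_self,
    legsAt_eq_zero (L := L), add_zero]
  · congr 1
    refine vertices_congr (fun v hv => ?_) fun v hv => ?_
    · rw [Function.update_of_ne]; rintro rfl; exact hi hv
    · rw [legsAt_add, legsAt_eq_zero (L := A.map (Prod.mk i)), zero_add]
      intro p hp
      obtain ⟨w, _, rfl⟩ := Multiset.mem_map.mp hp
      rintro rfl
      exact hi hv
  · rintro p hp rfl
    exact hi (hL p hp)

theorem mem_ends {E : Multiset Edge} (hE : ∀ e ∈ E, e.1.1 ∈ vs ∧ e.2.1 ∈ vs) :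
    ∀ p ∈ ends (n := n) (m := m) E, p.1 ∈ vs := by
  intro p hp
  simp only [ends, incid, Multiset.map_map, Multiset.mem_map, Multiset.mem_add] at hp
  rcases hp with ⟨e, he, rfl⟩ | ⟨e, he, rfl⟩
  · exact (hE e he).1
  · exact (hE e he).2

theorem mem_outs (hK : ∀ κ ∈ K, κ.vertex ∈ vs) : ∀ p ∈ outs K, p.1 ∈ vs := by
  intro p hp
  obtain ⟨κ, hκ, rfl⟩ := Multiset.mem_map.mp hp
  exact hK κ hκ

/-- An inner vertex with an even phase obtains the phase `π/2` by attaching a new vertex. -/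
theorem GraphLike.pendant {i j : ℕ} (h : GraphLike P vs φ E K) (hj : j ∈ vs) (hi : i ∉ vs)
    (hφ : φ j = 0 ∨ φ j = 2) :
    ∃ x s, GraphLike P (insert i vs)
      (Function.update (φ - Pi.single j (φ j - 1)) i (-(φ j - 1))) (((j, x), (i, s)) ::ₘ E) K := by
  obtain ⟨hE, hKv, hc, hb, Sc, hSc, h0⟩ := h
  unfold graph at h0
  -- The phase at `j` is split into `1` and `φ j - 1`. The latter is odd, so its one-legged node can
  -- be written in red, and colour change makes it a green vertex behind a Hadamard node.
  obtain ⟨x, h1⟩ := Rel.unabsorb (φ j - 1) (A := 0) (L := ends E + outs K)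
    (X := hads E + chains K + Sc) h0.right hj (by abel) (by simp)
  have h1 := h0.trans h1
  have hodd : φ j - 1 = 1 ∨ φ j - 1 = -1 := by
    rcases hφ with h | h <;> rw [h] <;> decide
  obtain ⟨w, h2⟩ := Rel.odd_state (c := .red) (a := inner x) hodd h1.right rfl
  have h2 := h1.trans h2
  obtain ⟨s, h3⟩ := Rel.uncolour_one (c := .green) h2.right rfl
  have h3 := h2.trans h3
  have h4 := h3.trans (Rel.had_symm (a := inner s) (b := inner x) h3.right (Multiset.cons_swap ..))
  refine ⟨x, s, ⟨?_, fun κ hκ => Finset.mem_insert_of_mem (hKv κ hκ), hc, hb,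
    Sc + {node .green 0 {inner w}, node .red (-(φ j - 1)) {inner w}}, hSc.add (.pair ..),
    h4.trans_eq ?_⟩⟩
  · intro e he
    rcases Multiset.mem_cons.mp he with rfl | he
    · exact ⟨Finset.mem_insert_of_mem hj, Finset.mem_insert_self ..⟩
    · exact ⟨Finset.mem_insert_of_mem (hE e he).1, Finset.mem_insert_of_mem (hE e he).2⟩
  · have e1 := vertices_insert_update (φ := φ - Pi.single j (φ j - 1)) (i := i)
      (L := (j, inner x) ::ₘ (ends E + outs K)) hi (by
        intro p hp
        rcases Multiset.mem_cons.mp hp with rfl | hp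
        · exact hj
        · rcases Multiset.mem_add.mp hp with hp | hp
          exacts [mem_ends hE p hp, mem_outs hKv p hp]) (-(φ j - 1)) {inner s}
    have e2 : ends (((j, x), (i, s)) ::ₘ E) + outs K =
        ({inner s} : Multiset (Wire n m)).map (Prod.mk i) +
          ((j, inner x) ::ₘ (ends E + outs K)) := by
      rw [ends_cons, Multiset.map_singleton]; simp only [← Multiset.singleton_add]; abel
    unfold graph
    rw [e2, e1, hads_cons]
    simp only [Multiset.insert_eq_cons, Colour.swap]
    simp only [← Multiset.singleton_add]; abel

/-- A phase is moved from a vertex to the chain of single-qubit operators of one of its legs. -/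
theorem GraphLike.push_phase {κ : Leg n m} (h : GraphLike P vs φ E (κ ::ₘ K)) (β : ZMod 4) :
    ∃ κ' : Leg n m, κ'.vertex = κ.vertex ∧ κ'.bdry = κ.bdry ∧
      GraphLike P vs (φ - Pi.single κ.vertex β) E (κ' ::ₘ K) := by
  obtain ⟨hE, hKv, hc, hb, Sc, hSc, h0⟩ := h
  have hκ := hKv κ (Multiset.mem_cons_self ..)
  unfold graph at h0
  obtain ⟨x, h1⟩ := Rel.unabsorb β (A := {κ.wire}) (u := κ.vertex) (L := ends E + outs K)
    (L₀ := ends E + outs (κ ::ₘ K))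
    (X := hads E + chains (κ ::ₘ K) + Sc) h0.right hκ (by abel)
    (by rw [outs_cons, Multiset.map_singleton]; simp only [← Multiset.singleton_add]; abel)
  refine ⟨⟨κ.vertex, inner x, κ.bdry, node .green β {inner x, κ.wire} ::ₘ κ.chain⟩, rfl, rfl,
    ⟨hE, ?_, ?_, ?_, Sc, hSc, (h0.trans h1).trans_eq ?_⟩⟩
  · intro κ' hκ'
    rcases Multiset.mem_cons.mp hκ' with rfl | hκ'
    · exact hκ
    · exact hKv κ' (Multiset.mem_cons_of_mem hκ')
  · intro κ' hκ'
    rcases Multiset.mem_cons.mp hκ' with rfl | hκ'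
    · exact (hc κ (Multiset.mem_cons_self ..)).prepend_shift ..
    · exact hc κ' (Multiset.mem_cons_of_mem hκ')
  · rw [← hb, Multiset.map_cons, Multiset.map_cons]
  · unfold graph
    rw [outs_cons, chains_cons, chains_cons, Multiset.add_cons]
    simp only [Multiset.insert_eq_cons]
    simp only [← Multiset.singleton_add]; abel

/-- A leg is moved to a new vertex that is joined to the old one. -/
theorem GraphLike.extend_leg {κ : Leg n m} {i : ℕ} (h : GraphLike P vs φ E (κ ::ₘ K))
    (hi : i ∉ vs) :
    ∃ (x y : ℕ) (κ' : Leg n m), κ'.vertex = i ∧ κ'.bdry = κ.bdry ∧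
      GraphLike P (insert i vs) (Function.update φ i 0) (((κ.vertex, x), (i, y)) ::ₘ E)
        (κ' ::ₘ K) := by
  obtain ⟨hE, hKv, hc, hb, Sc, hSc, h0⟩ := h
  have hκ := hKv κ (Multiset.mem_cons_self ..)
  have hK' : ∀ κ ∈ K, κ.vertex ∈ vs := fun κ' hκ' => hKv κ' (Multiset.mem_cons_of_mem hκ')
  unfold graph at h0
  -- The wire to the leg is replaced by two Hadamard nodes with a phaseless green node in between.
  -- The first one is the new edge, the second one joins the chain.
  obtain ⟨x, h1⟩ := Rel.unabsorb 0 (A := {κ.wire}) (u := κ.vertex) (L := ends E + outs K)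
    (L₀ := ends E + outs (κ ::ₘ K))
    (X := hads E + chains (κ ::ₘ K) + Sc) h0.right hκ (by abel)
    (by rw [outs_cons, Multiset.map_singleton]; simp only [← Multiset.singleton_add]; abel)
  rw [Pi.single_zero, sub_zero] at h1
  have h1 := h0.trans h1
  have h2 := h1.trans (Rel.cup h1.right rfl)
  obtain ⟨y, h3⟩ := Rel.unhad_had h2.right rfl
  have h3 := h2.trans h3
  obtain ⟨t, h4⟩ := Rel.unjoin_had h3.right (Multiset.cons_swap ..)
  have h4 := h3.trans h4
  have h5 := h4.trans (Rel.uncup .green h4.right rfl)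
  refine ⟨x, y, ⟨i, inner t, κ.bdry, had (inner t) κ.wire ::ₘ κ.chain⟩, rfl, rfl,
    ⟨?_, ?_, ?_, ?_, Sc, hSc, h5.trans_eq ?_⟩⟩
  · intro e he
    rcases Multiset.mem_cons.mp he with rfl | he
    · exact ⟨Finset.mem_insert_of_mem hκ, Finset.mem_insert_self ..⟩
    · exact ⟨Finset.mem_insert_of_mem (hE e he).1, Finset.mem_insert_of_mem (hE e he).2⟩
  · intro κ' hκ'
    rcases Multiset.mem_cons.mp hκ' with rfl | hκ'
    · exact Finset.mem_insert_self ..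
    · exact Finset.mem_insert_of_mem (hK' κ' hκ')
  · intro κ' hκ'
    rcases Multiset.mem_cons.mp hκ' with rfl | hκ'
    · exact (hc κ (Multiset.mem_cons_self ..)).prepend_had _
    · exact hc κ' (Multiset.mem_cons_of_mem hκ')
  · rw [← hb, Multiset.map_cons, Multiset.map_cons]
  · have e1 := vertices_insert_update (φ := φ) (i := i)
      (L := (κ.vertex, inner x) ::ₘ (ends E + outs K)) hi (by
        intro p hp
        rcases Multiset.mem_cons.mp hp with rfl | hp
        · exact hκ
        · rcases Multiset.mem_add.mp hp with hp | hp
          exacts [mem_ends hE p hp, mem_outs hK' p hp]) 0 {inner y, inner t}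
    unfold graph
    have e2 : ends (((κ.vertex, x), (i, y)) ::ₘ E) +
        outs ((⟨i, inner t, κ.bdry, had (inner t) κ.wire ::ₘ κ.chain⟩ : Leg n m) ::ₘ K) =
        ({inner y, inner t} : Multiset (Wire n m)).map (Prod.mk i) +
          ((κ.vertex, inner x) ::ₘ (ends E + outs K)) := by
      rw [ends_cons, outs_cons, Multiset.insert_eq_cons, Multiset.map_cons, Multiset.map_singleton]
      simp only [← Multiset.singleton_add]; abel
    rw [e2, e1, hads_cons, chains_cons, chains_cons]
    simp only [← Multiset.singleton_add]; abel

/-- The vertices of a graph without inner vertices all carry a leg. -/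
def IsReduced (vs : Finset ℕ) (E : Multiset Edge) (K : Multiset (Leg n m)) : Prop :=
  IsSimple E ∧ (K.map Leg.vertex).Nodup ∧ ∀ v ∈ vs, ∃ κ ∈ K, κ.vertex = v

theorem IsSimple.no_loop (h : IsSimple E) (v : ℕ) : ∀ e ∈ E, e.sym ≠ s(v, v) := by
  intro e he h'
  have : e.1.1 = e.2.1 := by
    rcases Sym2.eq_iff.mp h' with ⟨h1, h2⟩ | ⟨h1, h2⟩ <;> rw [h1, h2]
  exact h.1 e he this

/-- Inner vertices with an odd phase can be eliminated. -/
theorem GraphLike.eliminate_odd {v : ℕ} (h : GraphLike P vs φ E K) (hv : v ∈ vs)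
    (hK : ∀ κ ∈ K, κ.vertex ≠ v) (hφ : φ v = 1 ∨ φ v = -1) :
    ∃ φ' E', GraphLike P (vs.erase v) φ' E' K := by
  obtain ⟨φ', E', hE', hφ', h'⟩ := h.simplify
  rw [← Finset.insert_erase hv] at h'
  have h3 : ∀ a b : ZMod 4, (a = b ∨ a = b + 2) → (b = 1 ∨ b = -1) → (a = 1 ∨ a = -1) := by decide
  obtain ⟨E'', h''⟩ := h'.eliminate (Finset.notMem_erase v vs) hK (h3 _ _ (hφ' v) hφ)
    (hE'.no_loop v)
  exact ⟨_, E'', h''⟩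

/-- All inner vertices can be eliminated. -/
theorem GraphLike.reduce (h : GraphLike P vs φ E K) (hK : (K.map Leg.vertex).Nodup) :
    ∃ vs' φ' E' K', GraphLike (n := n) (m := m) P vs' φ' E' K' ∧ IsReduced vs' E' K' := by
  induction hN : vs.card using Nat.strong_induction_on generalizing vs φ E K with
  | _ N ih =>
  subst hN
  obtain ⟨φ₁, E₁, hE₁, _, h₁⟩ := h.simplify
  by_cases hr : ∀ v ∈ vs, ∃ κ ∈ K, κ.vertex = v
  · exact ⟨vs, φ₁, E₁, K, h₁, hE₁, hK, hr⟩
  push Not at hr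
  obtain ⟨v, hv, hvK⟩ := hr
  have hcard : ∀ w ∈ vs, (vs.erase w).card < vs.card := fun w hw => Finset.card_erase_lt_of_mem hw
  have hpar : ∀ a : ZMod 4, (a = 1 ∨ a = -1) ∨ (a = 0 ∨ a = 2) := by decide
  rcases hpar (φ₁ v) with hodd | heven
  · obtain ⟨φ₂, E₂, h₂⟩ := h₁.eliminate_odd hv hvK hodd
    exact ih _ (hcard v hv) h₂ hK rfl
  by_cases hiso : ∀ e ∈ E₁, e.1.1 ≠ v ∧ e.2.1 ≠ v
  · rw [← Finset.insert_erase hv] at h₁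
    exact ih _ (hcard v hv) (h₁.isolated (Finset.notMem_erase v vs) hvK hiso) hK rfl
  obtain ⟨e, he, j, hj⟩ : ∃ e ∈ E₁, ∃ j, e.sym = s(j, v) := by
    push Not at hiso
    obtain ⟨e, he, hiso⟩ := hiso
    by_cases h1 : e.1.1 = v
    · exact ⟨e, he, e.2.1, by rw [← h1]; exact Sym2.eq_swap⟩
    · exact ⟨e, he, e.1.1, by rw [← hiso h1]; rfl⟩
  have hjvs : j ∈ vs := by
    have := h₁.edge_mem e he
    rcases Sym2.eq_iff.mp hj with ⟨h1, h2⟩ | ⟨h1, h2⟩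
    · exact h1 ▸ this.1
    · exact h2 ▸ this.2
  have hjv : j ≠ v := by
    rintro rfl
    exact hE₁.no_loop _ e he hj
  have hcount : (E₁.map Edge.sym).count s(j, v) = 1 :=
    Multiset.count_eq_one_of_mem hE₁.2 (hj ▸ Multiset.mem_map_of_mem _ he)
  -- If the neighbour is already odd and has no leg, it is eliminated instead of `v`.
  by_cases hjo : (∀ κ ∈ K, κ.vertex ≠ j) ∧ (φ₁ j = 1 ∨ φ₁ j = -1)
  · obtain ⟨φ₂, E₂, h₂⟩ := h₁.eliminate_odd hjvs hjo.1 hjo.2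
    exact ih _ (hcard j hjvs) h₂ hK rfl
  obtain ⟨i, hi⟩ := Infinite.exists_notMem_finset vs
  have hij : i ≠ j := by rintro rfl; exact hi hjvs
  have hiv : i ≠ v := by rintro rfl; exact hi hv
  -- At the cost of one new vertex `i`, joined to `j` only, the neighbour `j` gets phase π/2 and no
  -- leg, while `v` keeps its phase.
  obtain ⟨x, s, K₂, φ₂, h₂, hφj, hφv, hK₂, hK₂j, hK₂v⟩ : ∃ (x s : ℕ) (K₂ : Multiset (Leg n m))
      (φ₂ : ℕ → ZMod 4), GraphLike P (insert i vs) φ₂ (((j, x), (i, s)) ::ₘ E₁) K₂ ∧ φ₂ j = 1 ∧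
      φ₂ v = φ₁ v ∧ (K₂.map Leg.vertex).Nodup ∧ (∀ κ ∈ K₂, κ.vertex ≠ j) ∧
      (∀ κ ∈ K₂, κ.vertex ≠ v) := by
    by_cases hjK : ∀ κ ∈ K, κ.vertex ≠ j
    · have hje := (hpar (φ₁ j)).resolve_left fun h => hjo ⟨hjK, h⟩
      obtain ⟨x, s, h₂⟩ := h₁.pendant hjvs hi hje
      refine ⟨x, s, K, _, h₂, ?_, ?_, hK, hjK, hvK⟩
      · rw [Function.update_of_ne hij.symm]; simp
      · rw [Function.update_of_ne hiv.symm]; simp [Pi.single_eq_of_ne hjv.symm]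
    · push Not at hjK
      obtain ⟨κ, hκ, hκj⟩ := hjK
      obtain ⟨K₀, rfl⟩ := Multiset.exists_cons_of_mem hκ
      -- Everything but π/2 of the phase of `j` goes into the chain of its leg, and then the leg
      -- itself moves to `i`.
      obtain ⟨κ₁, hκ₁, _, h₂⟩ := h₁.push_phase (φ₁ j - 1)
      obtain ⟨x, s, κ₂, hκ₂, _, h₃⟩ := h₂.extend_leg hi
      rw [hκ₁, hκj] at h₃
      rw [Multiset.map_cons, Multiset.nodup_cons] at hK
      have hmem : ∀ κ ∈ K₀, κ.vertex ∈ vs := fun κ hκ =>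
        h₁.leg_mem κ (Multiset.mem_cons_of_mem hκ)
      refine ⟨x, s, _, _, h₃, ?_, ?_, ?_, ?_, ?_⟩
      · rw [Function.update_of_ne hij.symm]; simp
      · rw [Function.update_of_ne hiv.symm]; simp [Pi.single_eq_of_ne hjv.symm]
      · rw [Multiset.map_cons, Multiset.nodup_cons, hκ₂]
        refine ⟨fun hm => ?_, hK.2⟩
        obtain ⟨κ', hκ', rfl⟩ := Multiset.mem_map.mp hm
        exact hi (hmem κ' hκ')
      · intro κ' hκ'
        rcases Multiset.mem_cons.mp hκ' with rfl | hκ'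
        · rwa [hκ₂]
        · rintro h
          exact hK.1 (Multiset.mem_map.mpr ⟨κ', hκ', h.trans hκj.symm⟩)
      · intro κ' hκ'
        rcases Multiset.mem_cons.mp hκ' with rfl | hκ'
        · rwa [hκ₂]
        · exact hvK κ' (Multiset.mem_cons_of_mem hκ')
  have hjvs' : j ∈ insert i vs := Finset.mem_insert_of_mem hjvs
  rw [← Finset.insert_erase hjvs'] at h₂
  -- The form with explicit phases is needed here rather than `eliminate_odd`: the graph is simple,
  -- so exactly one edge joins `j` and `v`, and the even phase of `v` drops by `1`.
  obtain ⟨E₃, h₃⟩ := h₂.eliminate (Finset.notMem_erase j _) hK₂j (Or.inl hφj) (by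
    intro e he
    rcases Multiset.mem_cons.mp he with rfl | he
    · intro h; rcases Sym2.eq_iff.mp h with ⟨_, h2⟩ | ⟨_, h2⟩ <;> exact hij h2
    · exact hE₁.no_loop j e he)
  have hvvs' : v ∈ (insert i vs).erase j :=
    Finset.mem_erase.mpr ⟨hjv.symm, Finset.mem_insert_of_mem hv⟩
  obtain ⟨φ₄, E₄, h₄⟩ := h₃.eliminate_odd hvvs' hK₂v (by
    have hne : s(j, v) ≠ Edge.sym ((j, x), (i, s)) := by
      intro h
      rcases Sym2.eq_iff.mp h with ⟨_, h2⟩ | ⟨h1, _⟩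
      · exact hiv h2.symm
      · exact hij h1.symm
    rw [Multiset.map_cons, Multiset.count_cons_of_ne hne, hcount, hφj, hφv]
    rcases heven with h | h <;> rw [h] <;> decide)
  -- One vertex was added and two were removed.
  refine ih _ ?_ h₄ hK₂ rfl
  rw [Finset.card_erase_of_mem hvvs', Finset.card_erase_of_mem hjvs',
    Finset.card_insert_of_notMem hi]
  have := Finset.card_pos.mpr ⟨v, hv⟩
  omega

/-- The legs can be moved to distinct vertices. -/
theorem GraphLike.separate {K₁ K₂ : Multiset (Leg n m)} (h : GraphLike P vs φ E (K₁ + K₂))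
    (hK : (K₁.map Leg.vertex).Nodup) :
    ∃ vs' φ' E' K', GraphLike (n := n) (m := m) P vs' φ' E' K' ∧ (K'.map Leg.vertex).Nodup := by
  -- `K₁` collects the legs that already sit at distinct vertices; each further leg gets a fresh
  -- vertex.
  induction K₂ using Multiset.induction generalizing vs φ E K₁ with
  | empty => exact ⟨vs, φ, E, K₁ + 0, h, by rwa [add_zero]⟩
  | cons κ K₂ ih =>
    obtain ⟨i, hi⟩ := Infinite.exists_notMem_finset vs
    rw [Multiset.add_cons] at h
    obtain ⟨x, y, κ', hκ', _, h'⟩ := h.extend_leg hi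
    rw [← Multiset.cons_add] at h'
    refine ih h' ?_
    rw [Multiset.map_cons, Multiset.nodup_cons, hκ']
    refine ⟨fun hm => ?_, hK⟩
    obtain ⟨κ₁, hκ₁, rfl⟩ := Multiset.mem_map.mp hm
    exact hi (h.leg_mem κ₁ (Multiset.mem_cons_of_mem (Multiset.mem_add.mpr (Or.inl hκ₁))))

/-- The phases can be moved to the chains of the legs. -/
theorem GraphLike.push_phases {K₁ K₂ : Multiset (Leg n m)} (h : GraphLike P vs φ E (K₁ + K₂))
    (hK : ((K₁ + K₂).map Leg.vertex).Nodup) (hφ : ∀ κ ∈ K₁, φ κ.vertex = 0) :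
    ∃ φ' K', GraphLike P vs φ' E K' ∧ K'.map Leg.vertex = (K₁ + K₂).map Leg.vertex ∧
      ∀ κ ∈ K', φ' κ.vertex = 0 := by
  -- `K₁` collects the legs whose vertices already have phase `0`. Since legs sit at distinct
  -- vertices, clearing another one leaves these alone.
  induction K₂ using Multiset.induction generalizing φ K₁ with
  | empty => exact ⟨φ, K₁ + 0, h, rfl, by rwa [add_zero]⟩
  | cons κ K₂ ih =>
    rw [Multiset.add_cons] at h hK ⊢
    obtain ⟨κ', hκ', _, h'⟩ := h.push_phase (φ κ.vertex)
    have e : (κ' ::ₘ K₁ + K₂).map Leg.vertex = (κ ::ₘ (K₁ + K₂)).map Leg.vertex := by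
      rw [Multiset.cons_add, Multiset.map_cons, Multiset.map_cons, hκ']
    rw [← Multiset.cons_add] at h'
    obtain ⟨φ', K', h1, h2, h3⟩ := ih h' (e ▸ hK) (by
      intro κ₁ hκ₁
      rcases Multiset.mem_cons.mp hκ₁ with rfl | hκ₁
      · rw [hκ']; simp
      · have hne : κ₁.vertex ≠ κ.vertex := by
          intro heq
          rw [Multiset.map_cons, Multiset.nodup_cons] at hK
          exact hK.1 (Multiset.mem_map.mpr ⟨κ₁, Multiset.mem_add.mpr (Or.inl hκ₁), heq⟩)
        simp [Pi.single_eq_of_ne hne, hφ κ₁ hκ₁])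
    exact ⟨φ', K', h1, h2.trans e, h3⟩

end Reduction

/-! ### From an arbitrary diagram to a graph -/

section Initial

variable {n m : ℕ} {P X Y : Multiset (Piece n m)} {vs : Finset ℕ} {φ : ℕ → ZMod 4}
  {E : Multiset Edge} {O : Multiset (ℕ × Wire n m)}

theorem legs_vertices {L : Multiset (ℕ × Wire n m)} (hL : ∀ p ∈ L, p.1 ∈ vs) :
    legs (vertices vs φ L) = L.map Prod.snd := by
  induction L using Multiset.induction with
  | empty =>
    rw [Multiset.map_zero, legs, vertices, Multiset.bind_map]
    simp [Piece.legs]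
  | cons p L ih =>
    obtain ⟨u, w⟩ := p
    have hu := hL (u, w) (Multiset.mem_cons_self ..)
    have ih := ih fun p hp => hL p (Multiset.mem_cons_of_mem hp)
    rw [vertices_erase hu, legs_cons] at ih ⊢
    rw [Multiset.map_cons, ← ih, Piece.legs, Piece.legs, legsAt_cons_self, Multiset.cons_add]
    congr 3
    exact vertices_congr (fun _ _ => rfl) fun v hv =>
      legsAt_cons_of_ne (Finset.ne_of_mem_erase hv).symm ..

theorem legs_hads (E : Multiset Edge) :
    legs (hads (n := n) (m := m) E) = (ends E).map Prod.snd := by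
  simp only [hads, legs_map_had, ends, incid, Multiset.map_add, Multiset.map_map,
    Function.comp_def]

/-- `P` can be rewritten into a graph whose vertices have the legs listed in `O`, next to the
pieces `X`. -/
structure PartialGraph (P : Multiset (Piece n m)) (vs : Finset ℕ) (φ : ℕ → ZMod 4)
    (E : Multiset Edge) (O : Multiset (ℕ × Wire n m)) (X : Multiset (Piece n m)) : Prop where
  edge_mem : ∀ e ∈ E, e.1.1 ∈ vs ∧ e.2.1 ∈ vs
  leg_mem : ∀ p ∈ O, p.1 ∈ vs
  rel : Rel P (vertices vs φ (ends E + O) + (hads E + X))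

theorem PartialGraph.rewrite (h : PartialGraph P vs φ E O X)
    (hr : ∀ C, Valid (X + C) → Rel (X + C) (Y + C)) : PartialGraph P vs φ E O Y := by
  obtain ⟨hE, hO, h0⟩ := h
  have e : ∀ Z, vertices vs φ (ends E + O) + (hads E + Z) =
    Z + (vertices vs φ (ends E + O) + hads E) := fun Z => by abel
  refine ⟨hE, hO, ?_⟩
  rw [e] at h0 ⊢
  exact h0.trans (hr _ h0.right)

/-- A green node becomes a vertex. -/
theorem PartialGraph.add_vertex {α : ZMod 4} {A : Multiset (Wire n m)} {i : ℕ}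
    (h : PartialGraph P vs φ E O (node .green α A ::ₘ X)) (hi : i ∉ vs) :
    PartialGraph P (insert i vs) (Function.update φ i α) E (A.map (Prod.mk i) + O) X := by
  obtain ⟨hE, hO, h0⟩ := h
  refine ⟨fun e he => ?_, fun p hp => ?_, h0.trans_eq ?_⟩
  · exact ⟨Finset.mem_insert_of_mem (hE e he).1, Finset.mem_insert_of_mem (hE e he).2⟩
  · rcases Multiset.mem_add.mp hp with hp | hp
    · obtain ⟨w, _, rfl⟩ := Multiset.mem_map.mp hp
      exact Finset.mem_insert_self ..
    · exact Finset.mem_insert_of_mem (hO p hp)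
  · have e1 := vertices_insert_update (φ := φ) (L := ends E + O) hi (by
      intro p hp
      rcases Multiset.mem_add.mp hp with hp | hp
      exacts [mem_ends hE p hp, hO p hp]) α A
    rw [show ends E + (A.map (Prod.mk i) + O) = A.map (Prod.mk i) + (ends E + O) by abel, e1]
    simp only [← Multiset.singleton_add]; abel

/-- A Hadamard node between vertices becomes an edge. -/
theorem PartialGraph.add_edge {u w x y : ℕ}
    (h : PartialGraph P vs φ E O (had (inner x) (inner y) ::ₘ X))
    {O' : Multiset (ℕ × Wire n m)} (hO : O = (u, inner x) ::ₘ (w, inner y) ::ₘ O') :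
    PartialGraph P vs φ (((u, x), (w, y)) ::ₘ E) O' X := by
  obtain ⟨hE, hO', h0⟩ := h
  subst hO
  refine ⟨fun e he => ?_, fun p hp => hO' p (by simp [hp]), h0.trans_eq ?_⟩
  · rcases Multiset.mem_cons.mp he with rfl | he
    · exact ⟨hO' (u, inner x) (by simp), hO' (w, inner y) (by simp)⟩
    · exact hE e he
  · rw [ends_cons, hads_cons]
    rw [show ends E + ((u, inner x) ::ₘ (w, inner y) ::ₘ O') =
      (u, inner x) ::ₘ (w, inner y) ::ₘ ends E + O' by simp only [← Multiset.singleton_add]; abel]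
    simp only [← Multiset.singleton_add]; abel

/-- A Hadamard node with arbitrary ends becomes an edge between two new vertices. -/
theorem PartialGraph.add_had {a b : Wire n m} (h : PartialGraph P vs φ E O (had a b ::ₘ X)) :
    ∃ vs' φ' E' O', PartialGraph P vs' φ' E' O' X := by
  -- A phaseless green node is inserted at either end, so that the edge lies between vertices even
  -- when `a` or `b` is an input or output.
  obtain ⟨x, h1⟩ := Rel.unjoin_had (a := a) (b := b)
    (C := vertices vs φ (ends E + O) + hads E + X) h.rel.right
    (by simp only [← Multiset.singleton_add]; abel)
  have h2 := h1.trans (Rel.uncup .green h1.right rfl)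
  have h3 := h2.trans (Rel.had_symm h2.right (Multiset.cons_swap ..))
  obtain ⟨y, h4⟩ := Rel.unjoin_had h3.right rfl
  have h4 := h3.trans h4
  have h5 := h4.trans (Rel.uncup .green h4.right rfl)
  have h6 : PartialGraph P vs φ E O (node .green 0 {b, inner y} ::ₘ node .green 0 {a, inner x} ::ₘ
      had (inner y) (inner x) ::ₘ X) :=
    ⟨h.edge_mem, h.leg_mem, (h.rel.trans h5).trans_eq
      (by simp only [← Multiset.singleton_add]; abel)⟩
  obtain ⟨i, hi⟩ := Infinite.exists_notMem_finset vs
  have h7 := h6.add_vertex hi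
  obtain ⟨j, hj⟩ := Infinite.exists_notMem_finset (insert i vs)
  have h8 := h7.add_vertex hj
  exact ⟨_, _, _, _, h8.add_edge (u := i) (w := j) (O' := (i, b) ::ₘ (j, a) ::ₘ O) (by
    simp only [Multiset.insert_eq_cons, Multiset.map_cons, Multiset.map_singleton]
    simp only [← Multiset.singleton_add]; abel)⟩

/-- All pieces other than Hadamard nodes become vertices. -/
theorem PartialGraph.add_nodes {T : Multiset (Wire n m × Wire n m)}
    (h : PartialGraph P vs φ E O (X + T.map fun p => had p.1 p.2)) :
    ∃ vs' φ' E' O', ∃ T' : Multiset (Wire n m × Wire n m), PartialGraph P vs' φ' E' O'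
      (T'.map fun p : Wire n m × Wire n m => had p.1 p.2) := by
  induction X using Multiset.induction generalizing vs φ E O T with
  | empty => exact ⟨vs, φ, E, O, T, by rwa [zero_add] at h⟩
  | cons e X ih =>
    obtain ⟨i, hi⟩ := Infinite.exists_notMem_finset vs
    rcases e with ⟨c, α, A⟩ | ⟨a, b⟩ | ⟨a, b⟩
    · cases c with
      | green =>
        rw [Multiset.cons_add] at h
        exact ih (h.add_vertex hi)
      | red =>
        -- A red node becomes a vertex at the price of Hadamard nodes, which are stored in `T` until
        -- all other pieces have been treated.
        obtain ⟨U, -, h1⟩ := Rel.uncolour (c := .green) (α := α) (S := A) (g := id)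
          (C := vertices vs φ (ends E + O) + hads E + (X + T.map fun p => had p.1 p.2))
          h.rel.right (by
            simp only [Colour.swap, Multiset.map_id]
            simp only [← Multiset.singleton_add]; abel)
        have h2 : PartialGraph P vs φ E O (node .green α (U.map fun p => inner p.1) ::ₘ
            (X + (T + U.map fun p => ((inner p.1 : Wire n m), p.2)).map
              fun p => had p.1 p.2)) := by
          refine ⟨h.edge_mem, h.leg_mem, (h.rel.trans h1).trans_eq ?_⟩
          simp only [Multiset.map_add, Multiset.map_map, Function.comp_def, id]
          simp only [← Multiset.singleton_add]; abel
        exact ih (h2.add_vertex hi)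
    · refine ih (T := (a, b) ::ₘ T) (vs := vs) (φ := φ) (E := E) (O := O) ?_
      convert h using 1
      rw [Multiset.map_cons]; simp only [← Multiset.singleton_add]; abel
    · have h1 : PartialGraph P vs φ E O (node .green 0 {a, b} ::ₘ
          (X + T.map fun p => had p.1 p.2)) := by
        refine h.rewrite fun C hC => ?_
        exact (Rel.uncup .green hC (by rw [Multiset.cons_add, Multiset.cons_add])).trans_eq
          (by rw [Multiset.cons_add])
      exact ih (h1.add_vertex hi)

theorem PartialGraph.add_hads {T : Multiset (Wire n m × Wire n m)}
    (h : PartialGraph P vs φ E O (T.map fun p => had p.1 p.2)) :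
    ∃ vs' φ' E' O', PartialGraph (n := n) (m := m) P vs' φ' E' O' 0 := by
  induction T using Multiset.induction generalizing vs φ E O with
  | empty => exact ⟨vs, φ, E, O, h⟩
  | cons p T ih =>
    rw [Multiset.map_cons] at h
    obtain ⟨vs', φ', E', O', h'⟩ := h.add_had
    exact ih h'

theorem count_ends_boundary (E : Multiset Edge) (b : Fin n ⊕ Fin m) :
    ((ends E).map Prod.snd).count (boundary b) = 0 := by
  rw [Multiset.count_eq_zero]
  simp only [ends, incid, Multiset.map_add, Multiset.map_map, Multiset.mem_add, Multiset.mem_map]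
  rintro (⟨e, _, h⟩ | ⟨e, _, h⟩) <;> cases b <;> simp [boundary] at h

/-- A wire of an edge has one end at a vertex and one at its Hadamard node, whereas a wire listed in
`O` ends at vertices only. -/
theorem PartialGraph.count_leg (h : PartialGraph P vs φ E O 0) (w : Wire n m) :
    (legs (vertices vs φ (ends E + O) + (hads E + 0))).count w =
      2 * ((ends E).map Prod.snd).count w + (O.map Prod.snd).count w := by
  rw [legs_add, legs_add, legs_zero, add_zero, legs_hads, legs_vertices, Multiset.map_add,
    Multiset.count_add, Multiset.count_add]
  · ring
  · intro p hp
    rcases Multiset.mem_add.mp hp with hp | hp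
    exacts [mem_ends h.edge_mem p hp, h.leg_mem p hp]

/-- Bare wires between vertices are replaced by pairs of edges. -/
theorem PartialGraph.subdivide (h : PartialGraph P vs φ E O 0) :
    ∃ vs' φ' E' O', PartialGraph (n := n) (m := m) P vs' φ' E' O' 0 ∧
      ∀ p ∈ O', ∃ b, p.2 = boundary b := by
  induction hN : Multiset.card O using Nat.strong_induction_on generalizing vs φ E O with
  | _ N ih =>
  subst hN
  by_cases hb : ∀ p ∈ O, ∃ b, p.2 = boundary b
  · exact ⟨vs, φ, E, O, h, hb⟩
  push Not at hb
  obtain ⟨⟨v, w⟩, hp, hw⟩ := hb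
  obtain ⟨k, rfl⟩ : ∃ k, w = inner k := by
    cases w with
    | input i => exact absurd rfl (hw (.inl i))
    | output j => exact absurd rfl (hw (.inr j))
    | inner k => exact ⟨k, rfl⟩
  have hc := h.count_leg (inner k)
  have hc' := h.rel.right.count_inner k
  obtain ⟨O, rfl⟩ := Multiset.exists_cons_of_mem hp
  rw [Multiset.map_cons, Multiset.count_cons_self] at hc
  -- The edges contribute an even count and `k` has two ends in all, so its other end is in `O` as
  -- well: `k` is a bare wire between vertices.
  have hm : (inner k : Wire n m) ∈ O.map Prod.snd := by
    rw [← Multiset.count_pos]; omega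
  obtain ⟨⟨u, _⟩, hu, rfl⟩ := Multiset.mem_map.mp hm
  obtain ⟨O, rfl⟩ := Multiset.exists_cons_of_mem hu
  have huv : u ∈ vs := h.leg_mem (u, inner k) (by simp)
  -- Two Hadamard nodes with a phaseless green node between them are inserted on this wire. The
  -- green node is a new vertex, joined to `u` and `v` by edges.
  obtain ⟨x, h1⟩ := Rel.unabsorb 0 (u := u) (A := {inner k}) (L := ends E + (v, inner k) ::ₘ O)
    (X := hads E) h.rel.right huv (by rw [add_zero])
    (by rw [Multiset.map_singleton]; simp only [← Multiset.singleton_add]; abel)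
  rw [Pi.single_zero, sub_zero] at h1
  have h2 := h1.trans (Rel.cup h1.right rfl)
  obtain ⟨y, h3⟩ := Rel.unhad_had h2.right rfl
  have h3 := h2.trans h3
  obtain ⟨t, h4⟩ := Rel.unjoin_had h3.right (Multiset.cons_swap ..)
  have h4 := h3.trans h4
  have h5 := h4.trans (Rel.uncup .green h4.right rfl)
  have h6 : PartialGraph P vs φ E ((u, inner x) ::ₘ (v, inner k) ::ₘ O)
      (node .green 0 {inner y, inner t} ::ₘ had (inner x) (inner y) ::ₘ
        had (inner t) (inner k) ::ₘ 0) := by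
    refine ⟨h.edge_mem, fun p hp => ?_, (h.rel.trans h5).trans_eq ?_⟩
    · simp only [Multiset.mem_cons] at hp
      rcases hp with rfl | rfl | hp
      · exact huv
      · exact h.leg_mem (v, inner k) (by simp)
      · exact h.leg_mem p (by simp [hp])
    · rw [show ends E + (u, inner x) ::ₘ (v, inner k) ::ₘ O =
        (u, inner x) ::ₘ (ends E + (v, inner k) ::ₘ O) by
        simp only [← Multiset.singleton_add]; abel]
      simp only [← Multiset.singleton_add]; abel
  obtain ⟨i, hi⟩ := Infinite.exists_notMem_finset vs
  have h7 := h6.add_vertex hi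
  have h8 := h7.add_edge (u := u) (w := i) (O' := (i, inner t) ::ₘ (v, inner k) ::ₘ O) (by
    simp only [Multiset.insert_eq_cons, Multiset.map_cons, Multiset.map_singleton]
    simp only [← Multiset.singleton_add]; abel)
  have h9 := h8.add_edge rfl
  exact ih _ (by simp) h9 rfl

theorem boundary_injective : Function.Injective (boundary : Fin n ⊕ Fin m → Wire n m) := by
  rintro (a | a) (b | b) h <;> simp_all [boundary]

theorem PartialGraph.graphLike (h : PartialGraph P vs φ E O 0)
    (hO : ∀ p ∈ O, ∃ b, p.2 = boundary b) : ∃ K, GraphLike P vs φ E K := by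
  obtain ⟨K, hK1, hK2⟩ : ∃ K : Multiset (Leg n m), O = outs K ∧
      ∀ κ ∈ K, κ.wire = boundary κ.bdry ∧ κ.chain = 0 := by
    have hO' := hO
    clear hO h
    induction O using Multiset.induction with
    | empty => exact ⟨0, rfl, by simp⟩
    | cons p O ih =>
      obtain ⟨K, rfl, hK⟩ := ih fun p hp => hO' p (Multiset.mem_cons_of_mem hp)
      obtain ⟨b, hb⟩ := hO' p (Multiset.mem_cons_self ..)
      refine ⟨⟨p.1, p.2, b, 0⟩ ::ₘ K, by simp, fun κ hκ => ?_⟩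
      rcases Multiset.mem_cons.mp hκ with rfl | hκ
      exacts [⟨hb, rfl⟩, hK κ hκ]
  subst hK1
  have hch : chains K = 0 := by
    rw [chains]
    refine Multiset.sum_eq_zero fun c hc => ?_
    obtain ⟨κ, hκ, rfl⟩ := Multiset.mem_map.mp hc
    exact (hK2 κ hκ).2
  refine ⟨K, h.edge_mem, fun κ hκ => h.leg_mem _ (Multiset.mem_map_of_mem _ hκ),
    fun κ hκ => ?_, ?_, 0, .zero, h.rel.trans_eq ?_⟩
  · rw [(hK2 κ hκ).1, (hK2 κ hκ).2]; exact .nil _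
  -- A boundary wire has one end in the diagram and none among the edges, so exactly one leg leads
  -- to it.
  · ext b
    have h1 := h.count_leg (boundary b)
    have h2 : (legs (vertices vs φ (ends E + outs K) + (hads E + 0))).count (boundary b) = 1 := by
      cases b with
      | inl i => exact h.rel.right.count_input i
      | inr j => exact h.rel.right.count_output j
    rw [h2, count_ends_boundary] at h1
    have h3 : (outs K).map Prod.snd = (K.map Leg.bdry).map boundary := by
      rw [outs, Multiset.map_map, Multiset.map_map]
      exact Multiset.map_congr rfl fun κ hκ => (hK2 κ hκ).1
    rw [h3, Multiset.count_map_eq_count' _ _ boundary_injective] at h1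
    rw [Multiset.count_eq_one_of_mem Finset.univ.nodup (Finset.mem_univ b)]
    omega
  · rw [graph, hch]; abel

/-- Every diagram can be rewritten into a graph with legs at distinct vertices. -/
theorem Valid.graphLike (h : Valid P) : ∃ vs φ E K,
    GraphLike (n := n) (m := m) P vs φ E K ∧ (K.map Leg.vertex).Nodup := by
  have h0 : PartialGraph P ∅ 0 0 0 (P + (0 : Multiset (Wire n m × Wire n m)).map
      fun p => had p.1 p.2) :=
    ⟨by simp, by simp, Rel.of_eq h (by simp [vertices])⟩
  obtain ⟨_, _, _, _, T, h1⟩ := h0.add_nodes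
  obtain ⟨_, _, _, _, h2⟩ := h1.add_hads
  obtain ⟨_, _, _, _, h3, hb⟩ := h2.subdivide
  obtain ⟨K, h4⟩ := h3.graphLike hb
  exact GraphLike.separate (K₁ := 0) (K₂ := K) (by rwa [zero_add]) (by simp)

end Initial

/-! ### From a reduced graph to the GS-LC form -/

section Final

variable {n m : ℕ} {P : Multiset (Piece n m)} {vs : Finset ℕ} {φ : ℕ → ZMod 4}
  {E : Multiset Edge} {K : Multiset (Leg n m)}

/-- Renames the vertices by the legs they carry. In a simple graph an edge is determined by its two
vertices, so its wire names become functions `l`, `r` of the pair of vertices, as `GraphState`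
demands. -/
theorem exists_lift_edges {σ : Type*} [DecidableEq σ] {E : Multiset Edge} (β : σ → ℕ)
    (hβ : ∀ e ∈ E, (∃ a, β a = e.1.1) ∧ ∃ b, β b = e.2.1) (hE : IsSimple E) :
    ∃ (edges : Finset (σ × σ)) (l r : σ × σ → ℕ), (∀ e ∈ edges, e.1 ≠ e.2 ∧ e.swap ∉ edges) ∧
      E = edges.val.map fun p => ((β p.1, l p), (β p.2, r p)) := by
  classical
  obtain ⟨F, hF⟩ : ∃ F : Multiset ((σ × ℕ) × (σ × ℕ)),
      E = F.map fun e => ((β e.1.1, e.1.2), (β e.2.1, e.2.2)) := by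
    clear hE
    induction E using Multiset.induction with
    | empty => exact ⟨0, rfl⟩
    | cons e E ih =>
      obtain ⟨F, rfl⟩ := ih fun e he => hβ e (Multiset.mem_cons_of_mem he)
      obtain ⟨⟨a, ha⟩, b, hb⟩ := hβ e (Multiset.mem_cons_self ..)
      exact ⟨((a, e.1.2), (b, e.2.2)) ::ₘ F, by simp [ha, hb]⟩
  subst hF
  obtain ⟨h1, h2⟩ := hE
  rw [Multiset.map_map] at h2
  set π : (σ × ℕ) × (σ × ℕ) → σ × σ := fun e => (e.1.1, e.2.1) with hπ
  have hnd : (F.map π).Nodup := by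
    refine Multiset.Nodup.of_map (fun p : σ × σ => s(β p.1, β p.2)) ?_
    rw [Multiset.map_map]; exact h2
  have hinj := Multiset.inj_on_of_nodup_map h2
  have hsec : ∀ p : σ × σ, ∃ lr : ℕ × ℕ, p ∈ F.map π → ((p.1, lr.1), (p.2, lr.2)) ∈ F := by
    intro p
    by_cases hp : p ∈ F.map π
    · obtain ⟨e, he, rfl⟩ := Multiset.mem_map.mp hp
      exact ⟨(e.1.2, e.2.2), fun _ => he⟩
    · exact ⟨(0, 0), fun h => absurd h hp⟩
  choose g hg using hsec
  refine ⟨⟨F.map π, hnd⟩, fun p => (g p).1, fun p => (g p).2, ?_, ?_⟩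
  · intro p hp
    replace hp : p ∈ F.map π := hp
    obtain ⟨e, he, rfl⟩ := Multiset.mem_map.mp hp
    have hne := h1 _ (Multiset.mem_map_of_mem _ he)
    refine ⟨fun h => hne (congrArg β h), fun hs => ?_⟩
    replace hs : (π e).swap ∈ F.map π := hs
    obtain ⟨f, hf, hfe⟩ := Multiset.mem_map.mp hs
    have h3 : f.1.1 = e.2.1 := by simpa [hπ] using congrArg Prod.fst hfe
    have h4 : f.2.1 = e.1.1 := by simpa [hπ] using congrArg Prod.snd hfe
    have := hinj f hf e he (by
      simp only [Function.comp_apply, Edge.sym, h3, h4]; exact Sym2.eq_swap)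
    subst this
    exact hne (congrArg β h4.symm)
  · rw [Multiset.map_map]
    refine Multiset.map_congr rfl fun e he => ?_
    have h3 := hg (π e) (Multiset.mem_map_of_mem _ he)
    have h4 := hinj _ h3 e he rfl
    exact congrArg (fun e : (σ × ℕ) × (σ × ℕ) => ((β e.1.1, e.1.2), (β e.2.1, e.2.2))) h4.symm

/-- A graph without inner vertices and phases is in GS-LC form. -/
theorem isGSLC_graph (hE : ∀ e ∈ E, e.1.1 ∈ vs ∧ e.2.1 ∈ vs) (hKv : ∀ κ ∈ K, κ.vertex ∈ vs)
    (hc : ∀ κ ∈ K, LocalClifford κ.wire (boundary κ.bdry) κ.chain)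
    (hb : K.map Leg.bdry = Finset.univ.val) (hr : IsReduced vs E K) (hφ : ∀ v ∈ vs, φ v = 0) :
    IsGSLC (graph vs φ E K) := by
  obtain ⟨hE', hKn, hvs⟩ := hr
  have hbn : (K.map Leg.bdry).Nodup := hb ▸ Finset.univ.nodup
  have hsec : ∀ b, ∃ κ ∈ K, κ.bdry = b := fun b =>
    Multiset.mem_map.mp (hb ▸ Finset.mem_univ b)
  choose g hgK hgb using hsec
  have hK : K = Finset.univ.val.map g := by
    rw [← hb, Multiset.map_map]
    conv_lhs => rw [← Multiset.map_id K]
    exact Multiset.map_congr rfl fun κ hκ =>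
      (Multiset.inj_on_of_nodup_map hbn _ (hgK _) κ hκ (hgb _)).symm
  have hinj : Function.Injective fun b => (g b).vertex := by
    intro a b hab
    have := Multiset.inj_on_of_nodup_map hKn _ (hgK a) _ (hgK b) hab
    rw [← hgb a, ← hgb b, this]
  -- Each vertex carries exactly one leg, so the inputs and outputs enumerate the vertices without
  -- repetition.
  have hval : vs.val = Finset.univ.val.map fun b => (g b).vertex := by
    have : vs = Finset.univ.map ⟨_, hinj⟩ := by
      ext v
      simp only [Finset.mem_map, Finset.mem_univ, true_and, Function.Embedding.coeFn_mk]
      constructor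
      · intro hv
        obtain ⟨κ, hκ, rfl⟩ := hvs v hv
        exact ⟨κ.bdry, congrArg _
          (Multiset.inj_on_of_nodup_map hbn _ (hgK _) κ hκ (hgb _))⟩
      · rintro ⟨b, rfl⟩
        exact hKv _ (hgK b)
    rw [this]; rfl
  have hlift : ∀ v ∈ vs, ∃ b, (g b).vertex = v := by
    intro v hv
    obtain ⟨κ, hκ, rfl⟩ := hvs v hv
    exact ⟨κ.bdry, congrArg _ (Multiset.inj_on_of_nodup_map hbn _ (hgK _) κ hκ (hgb _))⟩
  obtain ⟨edges, l, r, hedges, rfl⟩ := exists_lift_edges (fun b => (g b).vertex)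
    (fun e he => ⟨hlift _ (hE e he).1, hlift _ (hE e he).2⟩) hE'
  refine ⟨edges, fun b => (g b).wire, l, r, fun b => (g b).chain, hedges, fun v => ?_, ?_⟩
  · have := hc _ (hgK v)
    rwa [hgb] at this
  · have e1 : chains K = ∑ v, (g v).chain := by
      rw [chains, hK, Multiset.map_map]; rfl
    rw [graph, GraphState, e1, vertices, hval, Multiset.map_map, hads, Multiset.map_map,
      ← add_assoc]
    congr 2
    refine Multiset.map_congr rfl fun v _ => ?_
    simp only [Function.comp_apply]
    rw [hφ _ (hKv _ (hgK v))]
    congr 1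
    rw [legsAt_add, add_comm, hK, ← Multiset.singleton_add, add_assoc]
    congr 1
    · rw [outs, Multiset.map_map, legsAt, Multiset.filter_map, Multiset.map_map]
      have : (Finset.univ.val.filter fun b => (g b).vertex = (g v).vertex) = {v} := by
        have h2 : (Finset.univ.filter fun b => (g b).vertex = (g v).vertex) = {v} := by
          ext b; simp only [Finset.mem_filter, Finset.mem_univ, true_and, Finset.mem_singleton]
          exact ⟨fun h => hinj h, fun h => by rw [h]⟩
        exact congrArg Finset.val h2
      simp only [Function.comp_def]
      rw [this]; rfl
    · simp only [ends, incid, Multiset.map_map, legsAt, Multiset.map_add, Multiset.filter_add,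
        Multiset.filter_map, Function.comp_def, Finset.filter_val]
      congr 2 <;> exact Multiset.filter_congr fun p _ => hinj.eq_iff

/-- Every diagram can be rewritten into normal form with decomposed scalars. -/
theorem Diagram.exists_normalForm (D : Diagram n m) :
    ∃ D' : Diagram n m, D.Rewrites D' ∧ D'.IsNormalForm := by
  obtain ⟨vs, φ, E, K, h1, hK⟩ := D.valid.graphLike
  obtain ⟨vs, φ, E, K, h2, hr⟩ := h1.reduce hK
  obtain ⟨φ', K', h3, hv, hφ⟩ := GraphLike.push_phases (K₁ := 0) (K₂ := K)
    (by rwa [zero_add]) (by rw [zero_add]; exact hr.2.1) (by simp)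
  rw [zero_add] at hv
  have hr' : IsReduced vs E K' := by
    refine ⟨hr.1, hv ▸ hr.2.1, fun v hv' => ?_⟩
    obtain ⟨κ, hκ, rfl⟩ := hr.2.2 v hv'
    exact Multiset.mem_map.mp (hv ▸ Multiset.mem_map_of_mem _ hκ)
  obtain ⟨hE, hKv, hc, hb, Sc, ⟨S, hS, rfl⟩, hP, hQ, hrel⟩ := h3
  refine ⟨hQ.toDiagram, hrel, S, graph vs φ' E K', hS,
    isGSLC_graph hE hKv hc hb hr' fun v hv => ?_, add_comm _ _⟩
  obtain ⟨κ, hκ, rfl⟩ := hr'.2.2 v hv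
  exact hφ κ hκ

end Final

/-! ### Contraction of tensor networks along sets of wires -/

section Contraction

variable {n m : ℕ} {T U : Finset ℕ} {F G : (Wire n m → Fin 2) → ℂ}

/-- The labelling that agrees with `f`, except that the inner wires in `T` carry the label `1` if
they belong to `s` and `0` otherwise. -/
def relabel (T s : Finset ℕ) (f : Wire n m → Fin 2) : Wire n m → Fin 2
  | .input i => f (.input i)
  | .output j => f (.output j)
  | .inner k => if k ∈ T then if k ∈ s then 1 else 0 else f (.inner k)

/-- Contraction along the inner wires in `T`. -/
def contract (T : Finset ℕ) (F : (Wire n m → Fin 2) → ℂ) (f : Wire n m → Fin 2) : ℂ :=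
  ∑ s ∈ T.powerset, F (relabel T s f)

theorem contract_empty : contract ∅ F = F := by
  funext f
  have : relabel ∅ ∅ f = f := by
    funext w; cases w <;> simp [relabel]
  simp [contract, this]

/-- The subsets are split according to whether they contain `k`. This is the induction step for
`contract_union` and `contract_mul`. -/
theorem contract_insert {k : ℕ} (hk : k ∉ T) (f : Wire n m → Fin 2) :
    contract (insert k T) F f =
      contract T F (Function.update f (inner k) 0) +
        contract T F (Function.update f (inner k) 1) := by
  rw [contract, Finset.sum_powerset_insert hk, contract, contract]
  congr 1 <;> refine Finset.sum_congr rfl fun s hs => congrArg F (funext fun w => ?_)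
  all_goals
    have hks : k ∉ s := fun h => hk (Finset.mem_powerset.mp hs h)
    cases w with
    | input i => simp [relabel]
    | output j => simp [relabel]
    | inner l =>
      rcases eq_or_ne l k with rfl | hl
      · simp [relabel, hk, hks]
      · simp [relabel, hl]

theorem contract_singleton (k : ℕ) (f : Wire n m → Fin 2) :
    contract {k} F f =
      F (Function.update f (inner k) 0) + F (Function.update f (inner k) 1) := by
  rw [← insert_empty_eq, contract_insert (Finset.notMem_empty k), contract_empty]

theorem contract_union (h : Disjoint T U) : contract (T ∪ U) F = contract T (contract U F) := by
  induction T using Finset.induction with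
  | empty => rw [Finset.empty_union, contract_empty]
  | insert k T hk ih =>
    rw [Finset.disjoint_insert_left] at h
    funext f
    rw [Finset.insert_union, contract_insert (by simp [hk, h.1]), contract_insert hk, ih h.2]

theorem contract_congr (h : ∀ f, F f = G f) : contract T F = contract T G :=
  congrArg _ (funext h)

theorem contract_add (f : Wire n m → Fin 2) :
    contract T (fun f => F f + G f) f = contract T F f + contract T G f :=
  Finset.sum_add_distrib

theorem contract_mul_left (c : ℂ) (f : Wire n m → Fin 2) :
    contract T (fun f => c * F f) f = c * contract T F f :=
  (Finset.mul_sum ..).symm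

/-- The function `F` of the labels does not depend on the labels of the wires in `T`. -/
def IndepOf (T : Finset ℕ) (F : (Wire n m → Fin 2) → ℂ) : Prop :=
  ∀ k ∈ T, ∀ f x, F (Function.update f (inner k) x) = F f

theorem contract_mul (h : IndepOf T F) (f : Wire n m → Fin 2) :
    contract T (fun f => F f * G f) f = F f * contract T G f := by
  induction T using Finset.induction generalizing f with
  | empty => rw [contract_empty, contract_empty]
  | insert k T hk ih =>
    have ih := ih fun l hl => h l (Finset.mem_insert_of_mem hl)
    rw [contract_insert hk, contract_insert hk, ih, ih, h k (Finset.mem_insert_self ..),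
      h k (Finset.mem_insert_self ..), mul_add]

/-- A wire of `U` that also lies in `T` does no harm, since its label is overwritten by the
summation. -/
theorem contract_indepOf (h : IndepOf U F) : IndepOf U (contract T F) := by
  intro k hk f x
  refine Finset.sum_congr rfl fun s _ => ?_
  by_cases hkT : k ∈ T
  · congr 1
    funext w
    cases w with
    | input i => simp [relabel]
    | output j => simp [relabel]
    | inner l =>
      rcases eq_or_ne l k with rfl | hl
      · simp [relabel, hkT]
      · simp [relabel, hl]
  · rw [← h k hk (relabel T s f) x]
    congr 1
    funext w
    cases w with
    | input i => simp [relabel]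
    | output j => simp [relabel]
    | inner l =>
      rcases eq_or_ne l k with rfl | hl
      · simp [relabel, hkT]
      · simp [relabel, hl]

/-- The matrix entry of a collection of pieces. -/
noncomputable def entries (P : Multiset (Piece n m)) (f : Wire n m → Fin 2) : ℂ :=
  (P.map fun e => e.entry f).prod

theorem entry_congr {f g : Wire n m → Fin 2} {e : Piece n m} (h : ∀ w ∈ e.legs, f w = g w) :
    e.entry f = e.entry g := by
  rcases e with ⟨c, α, l⟩ | ⟨a, b⟩ | ⟨a, b⟩
  · have : ∀ F : Fin 2 → ℂ, (l.map fun w => F (f w)) = l.map fun w => F (g w) := fun F =>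
      Multiset.map_congr rfl fun w hw => by rw [h w hw]
    cases c <;> simp only [entry, this]
  all_goals
    simp only [Piece.legs, Multiset.insert_eq_cons, Multiset.mem_cons, Multiset.mem_singleton,
      forall_eq_or_imp, forall_eq] at h
    simp only [entry, h]

theorem entry_map (g : Wire n m → Wire n m) (f : Wire n m → Fin 2) (e : Piece n m) :
    (e.map g).entry f = e.entry (f ∘ g) := by
  rcases e with ⟨_ | _, α, l⟩ | ⟨a, b⟩ | ⟨a, b⟩ <;>
    simp [Piece.map, entry, Multiset.map_map]

theorem entries_add (P Q : Multiset (Piece n m)) (f : Wire n m → Fin 2) :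
    entries (P + Q) f = entries P f * entries Q f := by
  rw [entries, Multiset.map_add, Multiset.prod_add]; rfl

theorem entries_cons (e : Piece n m) (Q : Multiset (Piece n m)) (f : Wire n m → Fin 2) :
    entries (e ::ₘ Q) f = e.entry f * entries Q f := by
  rw [entries, Multiset.map_cons, Multiset.prod_cons]; rfl

theorem entries_congr {f g : Wire n m → Fin 2} {P : Multiset (Piece n m)}
    (h : ∀ w ∈ legs P, f w = g w) : entries P f = entries P g :=
  congrArg Multiset.prod (Multiset.map_congr rfl fun _ he =>
    entry_congr fun w hw => h w (Multiset.mem_bind.mpr ⟨_, he, hw⟩))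

theorem entries_indepOf {P : Multiset (Piece n m)} (h : ∀ k ∈ T, inner k ∉ legs P) :
    IndepOf T (entries P) := by
  intro k hk f x
  refine entries_congr fun w hw => Function.update_of_ne ?_ ..
  rintro rfl
  exact h k hk hw

/-- The inner wires among `A`. -/
def inners (A : Multiset (Wire n m)) : Finset ℕ := (A.filterMap Wire.innerName).toFinset

@[simp]
theorem mem_inners {A : Multiset (Wire n m)} {k : ℕ} : k ∈ inners A ↔ inner k ∈ A := by
  rw [inners, Multiset.mem_toFinset, Multiset.mem_filterMap]
  constructor
  · rintro ⟨w, hw, h⟩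
    cases w <;> simp [innerName] at h
    rwa [h] at hw
  · exact fun h => ⟨_, h, rfl⟩

/-- A single labelling of all wires replaces the row and column indices. Its values on the inner
wires of the diagram are overwritten, so letting `f` vary freely is the same as varying the boundary
labels. -/
theorem Diagram.interp_eq_zero {D : Diagram n m} :
    D.interp = 0 ↔ ∀ f, contract (inners (legs D.pieces)) (entries D.pieces) f = 0 := by
  have key : ∀ f, D.interp (fun j => f (output j)) (fun i => f (input i)) =
      contract (inners (legs D.pieces)) (entries D.pieces) f := by
    intro f
    refine Finset.sum_congr rfl fun s _ => entries_congr fun w hw => ?_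
    cases w with
    | input i => rfl
    | output j => rfl
    | inner k =>
      have : k ∈ inners (legs D.pieces) := mem_inners.mpr hw
      simp [relabel, labelling, this]
  constructor
  · intro h f
    rw [← key, h]; rfl
  · intro h
    ext y x
    have := key (labelling x y ∅)
    rw [h] at this
    exact this

end Contraction

/-! ### Phases and basis vectors in coordinates -/

section Phase

theorem phase_eq (a : ZMod 4) : phase a = Complex.I ^ a.val := by
  conv_rhs => rw [← Complex.exp_pi_div_two_mul_I, ← Complex.exp_nat_mul]
  rw [phase]
  push_cast
  ring_nf

@[simp] theorem phase_zero : phase 0 = 1 := by simp [phase_eq]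

@[simp] theorem phase_one : phase 1 = Complex.I := by
  rw [phase_eq, show (1 : ZMod 4).val = 1 from rfl, pow_one]

@[simp] theorem phase_two : phase 2 = -1 := by
  rw [phase_eq, show (2 : ZMod 4).val = 2 from rfl, Complex.I_sq]

theorem phase_neg_one : phase (-1) = -Complex.I := by
  rw [phase_eq, show (-1 : ZMod 4).val = 3 from rfl, Complex.I_pow_three]

theorem phase_add (a b : ZMod 4) : phase (a + b) = phase a * phase b := by
  rw [phase_eq, phase_eq, phase_eq, ZMod.val_add, ← pow_add]
  conv_rhs => rw [← Nat.div_add_mod (a.val + b.val) 4, pow_add, pow_mul, Complex.I_pow_four,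
    one_pow, one_mul]

theorem phase_ne_zero (a : ZMod 4) : phase a ≠ 0 := by
  rw [phase_eq]; exact pow_ne_zero _ Complex.I_ne_zero

theorem phase_mul_neg (a : ZMod 4) : phase a * phase (-a) = 1 := by
  rw [← phase_add, add_neg_cancel, phase_zero]

/-- The square root of one half. -/
noncomputable def sqrtHalf : ℂ := 1 / (Real.sqrt 2 : ℂ)

/-- Together with `sqrtHalf_ne_zero`, this is all that the matrix computations below use about √½.
-/
theorem sqrtHalf_sq : sqrtHalf ^ 2 = 1 / 2 := by
  rw [sqrtHalf, div_pow, one_pow, ← Complex.ofReal_pow, Real.sq_sqrt (by norm_num)]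
  norm_num

theorem sqrtHalf_ne_zero : sqrtHalf ≠ 0 := by
  intro h
  have := sqrtHalf_sq
  rw [h] at this
  norm_num at this

@[simp] theorem ket0_zero : ket0 0 = 1 := rfl
@[simp] theorem ket0_one : ket0 1 = 0 := rfl
@[simp] theorem ket1_zero : ket1 0 = 0 := rfl
@[simp] theorem ket1_one : ket1 1 = 1 := rfl
@[simp] theorem ketPlus_zero : ketPlus 0 = sqrtHalf := by simp [ketPlus, sqrtHalf]
@[simp] theorem ketPlus_one : ketPlus 1 = sqrtHalf := by simp [ketPlus, sqrtHalf]
@[simp] theorem ketMinus_zero : ketMinus 0 = sqrtHalf := by simp [ketMinus, sqrtHalf]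
@[simp] theorem ketMinus_one : ketMinus 1 = -sqrtHalf := by simp [ketMinus, sqrtHalf]

end Phase

/-! ### Every rule preserves the matrix up to a non-zero factor -/

section Soundness

variable {n m : ℕ}

/-- `L` and `R` have the same free wire ends and, contracted along their private wires, represent
proportional matrices. -/
def Proportional (L R : Multiset (Piece n m)) : Prop :=
  ∃ (KL KR : Multiset ℕ) (A : Multiset (Wire n m)) (c : ℂ), c ≠ 0 ∧
    legs L = A + 2 • KL.map inner ∧ legs R = A + 2 • KR.map inner ∧
    (KL.Nodup → KR.Nodup → (∀ k ∈ KL, inner k ∉ A) → (∀ k ∈ KR, inner k ∉ A) →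
      ∀ f, contract KL.toFinset (entries L) f = c * contract KR.toFinset (entries R) f)

/-- In a valid diagram the private wires have both ends in `L`, so they are distinct and occur
neither in `A` nor in `C`. The sum over them can therefore be carried out first, with `entries C` as
a constant. The rules themselves do not require such distinctness; it comes from the surroundings.
-/
theorem contract_split {L C : Multiset (Piece n m)} {K : Multiset ℕ} {A : Multiset (Wire n m)}
    (hv : Valid (L + C)) (hL : legs L = A + 2 • K.map inner) :
    K.Nodup ∧ (∀ k ∈ K, inner k ∉ A) ∧
      ∀ f, contract (inners (legs (L + C))) (entries (L + C)) f =
        contract (inners (A + legs C))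
          (fun f => entries C f * contract K.toFinset (entries L) f) f := by
  have hc : ∀ k ∈ K, K.count k = 1 ∧ inner k ∉ A ∧ inner k ∉ legs C := by
    intro k hk
    have h1 := hv.count_inner k
    have h2 := Multiset.one_le_count_iff_mem.mpr hk
    rw [legs_add, hL, Multiset.count_add, Multiset.count_add, Multiset.count_nsmul,
      Multiset.count_map_eq_count' _ _ (fun a b h => Wire.inner.inj h)] at h1
    rw [← Multiset.count_eq_zero, ← Multiset.count_eq_zero]
    omega
  have hd : Disjoint (inners (A + legs C)) K.toFinset := by
    rw [Finset.disjoint_right]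
    intro k hk h
    have := hc k (Multiset.mem_toFinset.mp hk)
    rw [mem_inners, Multiset.mem_add] at h
    tauto
  refine ⟨Multiset.nodup_iff_count_le_one.mpr fun k => ?_, fun k hk => (hc k hk).2.1, fun f => ?_⟩
  · by_cases hk : k ∈ K
    · exact (hc k hk).1.le
    · rw [Multiset.count_eq_zero.mpr hk]; exact Nat.zero_le _
  have hu : inners (legs (L + C)) = inners (A + legs C) ∪ K.toFinset := by
    ext k
    rw [Finset.mem_union, mem_inners, mem_inners, legs_add, hL, Multiset.mem_toFinset]
    simp only [Multiset.mem_add, Multiset.mem_nsmul, Multiset.mem_map, inner.injEq]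
    simp only [exists_eq_right, ne_eq, OfNat.ofNat_ne_zero, not_false_eq_true, true_and]
    tauto
  rw [hu, contract_union hd]
  congr 1
  funext g
  have hi : IndepOf K.toFinset (entries C) :=
    entries_indepOf fun k hk => (hc k (Multiset.mem_toFinset.mp hk)).2.2
  rw [← contract_mul hi]
  exact congrFun (contract_congr fun f => by rw [entries_add, mul_comm]) g

theorem Proportional.interp_eq_zero {L R C : Multiset (Piece n m)} (h : Proportional L R)
    {D D' : Diagram n m} (hD : D.pieces = L + C) (hD' : D'.pieces = R + C) :
    D.interp = 0 ↔ D'.interp = 0 := by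
  obtain ⟨KL, KR, A, c, hc, hL, hR, h⟩ := h
  obtain ⟨n1, a1, e1⟩ := contract_split (hD ▸ D.valid) hL
  obtain ⟨n2, a2, e2⟩ := contract_split (hD' ▸ D'.valid) hR
  rw [Diagram.interp_eq_zero, Diagram.interp_eq_zero, hD, hD']
  refine forall_congr' fun f => ?_
  rw [e1, e2]
  have : ∀ f, entries C f * contract KL.toFinset (entries L) f =
      c * (entries C f * contract KR.toFinset (entries R) f) := fun f => by
    rw [h n1 n2 a1 a2]; ring
  rw [contract_congr this, contract_mul_left, mul_eq_zero, or_iff_right hc]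

theorem map_update_of_notMem {σ : Type*} {A : Multiset (Wire n m)} {w : Wire n m} (h : w ∉ A)
    (F : Fin 2 → σ) (f : Wire n m → Fin 2) (x : Fin 2) :
    (A.map fun v => F (Function.update f w x v)) = A.map fun v => F (f v) :=
  Multiset.map_congr rfl fun v hv => by
    rw [Function.update_of_ne]; rintro rfl; exact h hv

/-- Each summed label occurs in one factor only, so the sum of products is a product of sums. Colour
change and π-copy rest on this, as they have arbitrarily many private wires. -/
theorem contract_pairs {P : Multiset (ℕ × Wire n m)} (hP : (P.map Prod.fst).Nodup)
    (hd : ∀ k ∈ P.map Prod.fst, inner k ∉ P.map Prod.snd) (g : Fin 2 → Fin 2 → ℂ)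
    (f : Wire n m → Fin 2) :
    contract (P.map Prod.fst).toFinset
        (fun f => (P.map fun p => g (f (inner p.1)) (f p.2)).prod) f =
      (P.map fun p => g 0 (f p.2) + g 1 (f p.2)).prod := by
  induction P using Multiset.induction generalizing f with
  | empty => simp [contract_empty]
  | cons p P ih =>
    simp only [Multiset.map_cons, Multiset.nodup_cons, Multiset.mem_cons, forall_eq_or_imp,
      not_or] at hP hd
    have ih := ih hP.2 fun k hk => (hd.2 k hk).2
    have hi : IndepOf (P.map Prod.fst).toFinset
        fun f : Wire n m → Fin 2 => g (f (inner p.1)) (f p.2) := by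
      intro k hk f y
      rw [Multiset.mem_toFinset] at hk
      have h1 : (inner p.1 : Wire n m) ≠ inner k := fun h => hP.1 (by rwa [inner.inj h])
      have h2 : p.2 ≠ inner k := fun h => (hd.2 k hk).1 h.symm
      simp only [Function.update_of_ne h1, Function.update_of_ne h2]
    have h3 : p.2 ≠ inner p.1 := fun h => hd.1.1 h.symm
    simp only [Multiset.map_cons, Multiset.prod_cons, Multiset.toFinset_cons]
    rw [contract_insert (by rw [Multiset.mem_toFinset]; exact hP.1), contract_mul hi,
      contract_mul hi, ih, ih]
    have h4 : ∀ x, (P.map fun q => g 0 (Function.update f (inner p.1) x q.2) +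
        g 1 (Function.update f (inner p.1) x q.2)) = P.map fun q => g 0 (f q.2) + g 1 (f q.2) := by
      intro x
      refine Multiset.map_congr rfl fun q hq => ?_
      rw [Function.update_of_ne]
      rintro h
      exact hd.1.2 (h ▸ Multiset.mem_map_of_mem _ hq)
    simp only [h4, Function.update_self, Function.update_of_ne h3]
    ring

/-- The single-leg factor of a node, for the two terms of the node. -/
noncomputable def Colour.ket : Colour → Fin 2 → Fin 2 → ℂ
  | .green, j => if j = 0 then ket0 else ket1
  | .red, j => if j = 0 then ketPlus else ketMinus

/-- A form common to both colours: rules that concern one colour only follow from orthonormality of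
its basis. -/
theorem entry_node (c : Colour) (α : ZMod 4) (A : Multiset (Wire n m)) (f : Wire n m → Fin 2) :
    (node c α A).entry f = (A.map fun w => c.ket 0 (f w)).prod +
      phase α * (A.map fun w => c.ket 1 (f w)).prod := by
  cases c <;> simp [entry, Colour.ket]

theorem entry_had (a b : Wire n m) (f : Wire n m → Fin 2) :
    (had a b).entry f = ketPlus (f b) * ket0 (f a) + ketMinus (f b) * ket1 (f a) := rfl

theorem entry_cord (a b : Wire n m) (f : Wire n m → Fin 2) :
    (cord a b).entry f = if f a = f b then 1 else 0 := rfl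

/-- The source of the spider and loop rules. -/
theorem Colour.ket_orthonormal (c : Colour) (i j : Fin 2) :
    c.ket i 0 * c.ket j 0 + c.ket i 1 * c.ket j 1 = if i = j then 1 else 0 := by
  have := sqrtHalf_sq
  cases c <;> fin_cases i <;> fin_cases j <;> simp [Colour.ket] <;> linear_combination 2 * this

/-- The resolution of the identity, and the source of the cup rule. -/
theorem Colour.ket_complete (c : Colour) (x y : Fin 2) :
    c.ket 0 x * c.ket 0 y + c.ket 1 x * c.ket 1 y = if x = y then 1 else 0 := by
  have := sqrtHalf_sq
  cases c <;> fin_cases x <;> fin_cases y <;> simp [Colour.ket] <;> linear_combination 2 * this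

/-- The Hadamard matrix exchanges the two bases, whence the colour change rule. -/
theorem Colour.ket_had (c : Colour) (j y : Fin 2) :
    c.ket j 0 * (ketPlus y * ket0 0 + ketMinus y * ket1 0) +
      c.ket j 1 * (ketPlus y * ket0 1 + ketMinus y * ket1 1) = c.swap.ket j y := by
  have := sqrtHalf_sq
  cases c <;> fin_cases j <;> fin_cases y <;> simp [Colour.ket, Colour.swap] <;>
    linear_combination 2 * this

/-- A phase π of one colour exchanges the two basis vectors of the other colour, whence the π-copy
rule. -/
theorem Colour.ket_flip (c : Colour) (j y : Fin 2) :
    c.ket j 0 * (c.swap.ket 0 0 * c.swap.ket 0 y - c.swap.ket 1 0 * c.swap.ket 1 y) +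
      c.ket j 1 * (c.swap.ket 0 1 * c.swap.ket 0 y - c.swap.ket 1 1 * c.swap.ket 1 y) =
      c.ket (1 - j) y := by
  have := sqrtHalf_sq
  cases c <;> fin_cases j <;> fin_cases y <;> simp [Colour.ket, Colour.swap] <;>
    linear_combination 2 * this

theorem proportional_spider (c : Colour) (α β : ZMod 4) (k : ℕ) (A B : Multiset (Wire n m)) :
    Proportional {node c α (inner k ::ₘ A), node c β (inner k ::ₘ B)}
      {node c (α + β) (A + B)} := by
  refine ⟨{k}, 0, A + B, 1, one_ne_zero, ?_, ?_, fun _ _ h _ f => ?_⟩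
  · simp [legs, Piece.legs, two_nsmul]; simp only [← Multiset.singleton_add]; abel
  · simp [legs, Piece.legs]
  · have h := h k (by simp)
    rw [Multiset.mem_add, not_or] at h
    simp only [Multiset.toFinset_singleton, contract_singleton, Multiset.toFinset_zero,
      contract_empty, entries, Multiset.insert_eq_cons, Multiset.map_cons, Multiset.map_singleton,
      Multiset.prod_cons, Multiset.prod_singleton, entry_node, Function.update_self,
      map_update_of_notMem h.1, map_update_of_notMem h.2, Multiset.map_add, Multiset.prod_add,
      phase_add]
    have h00 := c.ket_orthonormal 0 0
    have h01 := c.ket_orthonormal 0 1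
    have h11 := c.ket_orthonormal 1 1
    simp only [if_true, zero_ne_one, if_false] at h00 h01 h11
    generalize (A.map fun w => c.ket 0 (f w)).prod = a0
    generalize (A.map fun w => c.ket 1 (f w)).prod = a1
    generalize (B.map fun w => c.ket 0 (f w)).prod = b0
    generalize (B.map fun w => c.ket 1 (f w)).prod = b1
    -- The product of the two nodes has four terms. The mixed ones contain the inner product of
    -- different basis vectors and vanish.
    linear_combination a0 * b0 * h00 + (phase β * a0 * b1 + phase α * a1 * b0) * h01 +
      phase α * phase β * a1 * b1 * h11

theorem proportional_loop (c : Colour) (α : ZMod 4) (k : ℕ) (A : Multiset (Wire n m)) :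
    Proportional {node c α (inner k ::ₘ inner k ::ₘ A)} {node c α A} := by
  refine ⟨{k}, 0, A, 1, one_ne_zero, ?_, ?_, fun _ _ h _ f => ?_⟩
  · simp [legs, Piece.legs, two_nsmul]; simp only [← Multiset.singleton_add]; abel
  · simp [legs, Piece.legs]
  · have h := h k (by simp)
    simp only [Multiset.toFinset_singleton, contract_singleton, Multiset.toFinset_zero,
      contract_empty, entries, Multiset.map_cons, Multiset.map_singleton,
      Multiset.prod_cons, Multiset.prod_singleton, entry_node, Function.update_self,
      map_update_of_notMem h]
    have h00 := c.ket_orthonormal 0 0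
    have h11 := c.ket_orthonormal 1 1
    simp only [if_true] at h00 h11
    linear_combination (A.map fun w => c.ket 0 (f w)).prod * h00 +
      phase α * (A.map fun w => c.ket 1 (f w)).prod * h11

theorem proportional_cup (c : Colour) (a b : Wire n m) :
    Proportional {node c 0 {a, b}} {cord a b} := by
  refine ⟨0, 0, {a, b}, 1, one_ne_zero, by simp [legs, Piece.legs], by simp [legs, Piece.legs],
    fun _ _ _ _ f => ?_⟩
  have := c.ket_complete (f a) (f b)
  simpa [contract_empty, entries, entry_node, entry_cord] using this

/-- The bare wire forces `k` to carry the label of `a`, so a single term of the sum survives. -/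
theorem proportional_join (a : Wire n m) (k : ℕ) (e : Piece n m)
    (h : e.legs.count (inner k) = 1) :
    Proportional {cord a (inner k), e} {e.map fun w => if w = inner k then a else w} := by
  obtain ⟨A, hA⟩ := Multiset.exists_cons_of_mem
    (Multiset.one_le_count_iff_mem.mp h.ge)
  have hkA : inner k ∉ A := by
    rw [hA, Multiset.count_cons_self] at h
    rw [← Multiset.count_eq_zero]; omega
  have hm : (e.map fun w => if w = inner k then a else w).legs = a ::ₘ A := by
    have : ∀ g : Wire n m → Wire n m, (e.map g).legs = e.legs.map g := by
      intro g; rcases e with _ | _ | _ <;> simp [Piece.map, Piece.legs]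
    rw [this, hA, Multiset.map_cons, if_pos rfl, map_replace_of_not_mem hkA]
  refine ⟨{k}, 0, a ::ₘ A, 1, one_ne_zero, ?_, ?_, fun _ _ h _ f => ?_⟩
  · simp [legs, hA, two_nsmul]; simp [Piece.legs]; simp only [← Multiset.singleton_add]; abel
  · simp [legs, hm]
  · have hak : a ≠ inner k := by
      rintro rfl
      exact h k (by simp) (by simp)
    have he : f ∘ (fun w => if w = inner k then a else w) =
        Function.update f (inner k) (f a) := by
      funext w
      by_cases hw : w = inner k
      · subst hw; simp
      · simp [hw]
    simp only [Multiset.toFinset_singleton, contract_singleton, Multiset.toFinset_zero,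
      contract_empty, entries, Multiset.insert_eq_cons, Multiset.map_cons, Multiset.map_singleton,
      Multiset.prod_cons, Multiset.prod_singleton, entry_map, he]
    simp only [entry_cord, Function.update_self, Function.update_of_ne hak]
    generalize f a = x
    fin_cases x <;> simp

theorem proportional_copy (c : Colour) (k : ℕ) (a b : Wire n m) :
    Proportional {node c.swap 0 {inner k}, node c 0 {inner k, a, b}}
      {node c.swap 0 {a}, node c.swap 0 {b}} := by
  refine ⟨{k}, 0, {a, b}, sqrtHalf, sqrtHalf_ne_zero, ?_, ?_, fun _ _ h _ f => ?_⟩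
  · simp [legs, Piece.legs, two_nsmul]; simp only [← Multiset.singleton_add]; abel
  · simp [legs, Piece.legs]
  · have h := h k (by simp)
    simp only [Multiset.insert_eq_cons, Multiset.mem_cons, Multiset.mem_singleton, not_or] at h
    have ha : a ≠ inner k := fun e => h.1 e.symm
    have hb : b ≠ inner k := fun e => h.2 e.symm
    simp only [Multiset.toFinset_singleton, contract_singleton, Multiset.toFinset_zero,
      contract_empty, entries, Multiset.insert_eq_cons, Multiset.map_cons, Multiset.map_singleton,
      Multiset.prod_cons, Multiset.prod_singleton, entry_node, Function.update_self,
      Function.update_of_ne ha, Function.update_of_ne hb, phase_zero]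
    have := sqrtHalf_sq
    generalize f a = x
    generalize f b = y
    cases c <;> fin_cases x <;> fin_cases y <;> simp [Colour.ket, Colour.swap] <;> grind

theorem proportional_bialgebra (c : Colour) (a₁ a₂ b₁ b₂ : Wire n m) (k₁₁ k₁₂ k₂₁ k₂₂ k : ℕ) :
    Proportional
      {node c 0 {a₁, inner k₁₁, inner k₁₂}, node c 0 {a₂, inner k₂₁, inner k₂₂},
        node c.swap 0 {inner k₁₁, inner k₂₁, b₁}, node c.swap 0 {inner k₁₂, inner k₂₂, b₂}}
      {node c.swap 0 {a₁, a₂, inner k}, node c 0 {inner k, b₁, b₂}} := by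
  refine ⟨{k₁₁, k₁₂, k₂₁, k₂₂}, {k}, {a₁, a₂, b₁, b₂}, sqrtHalf, sqrtHalf_ne_zero, ?_, ?_,
    fun hn _ h h' f => ?_⟩
  · simp [legs, Piece.legs, two_nsmul]; simp only [← Multiset.singleton_add]; abel
  · simp [legs, Piece.legs, two_nsmul]; simp only [← Multiset.singleton_add]; abel
  · replace h := fun k hk w (hw : w ∈ _) => show w ≠ inner k from fun e => h k hk (e ▸ hw)
    replace h' := fun k hk w (hw : w ∈ _) => show w ≠ inner k from fun e => h' k hk (e ▸ hw)
    simp only [Multiset.insert_eq_cons, Multiset.mem_cons, Multiset.mem_singleton, not_or,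
      Multiset.nodup_cons, Multiset.nodup_singleton, forall_eq_or_imp, forall_eq] at h h' hn
    obtain ⟨⟨n1, n2, n3⟩, ⟨n4, n5⟩, n6, -⟩ := hn
    simp only [Multiset.toFinset_cons, Multiset.toFinset_singleton, Multiset.insert_eq_cons]
    simp only [contract_insert, contract_singleton, Finset.mem_insert, Finset.mem_singleton,
      n1, n2, n3, n4, n5, n6, or_self, not_false_eq_true, entries, Multiset.map_cons,
      Multiset.map_singleton, Multiset.prod_cons, Multiset.prod_singleton, entry_node,
      Function.update_apply, inner.injEq, h, h', Ne.symm n1, Ne.symm n2, Ne.symm n3, Ne.symm n4,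
      Ne.symm n5, Ne.symm n6, if_true, if_false, phase_zero]
    have := sqrtHalf_sq
    generalize f a₁ = x
    generalize f a₂ = y
    generalize f b₁ = z
    generalize f b₂ = w
    -- A finite check: two colours and sixteen labellings of the free ends.
    cases c <;> fin_cases x <;> fin_cases y <;> fin_cases z <;> fin_cases w <;>
      simp [Colour.ket, Colour.swap] <;> grind

theorem proportional_colour (c : Colour) (α : ZMod 4) (P : Multiset (ℕ × Wire n m)) :
    Proportional (node c α (P.map fun p => inner p.1) ::ₘ P.map fun p => had (inner p.1) p.2)
      {node c.swap α (P.map fun p => p.2)} := by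
  refine ⟨P.map Prod.fst, 0, P.map Prod.snd, 1, one_ne_zero, ?_, ?_, fun hn _ h _ f => ?_⟩
  · rw [legs_cons, legs_map_had, Piece.legs, two_nsmul, Multiset.map_map, Function.comp_def]
    abel
  · simp [legs, Piece.legs]
  · have e1 : ∀ f : Wire n m → Fin 2,
        entries (node c α (P.map fun p => inner p.1) ::ₘ P.map fun p => had (inner p.1) p.2) f =
        (P.map fun p => (fun x y => c.ket 0 x * (ketPlus y * ket0 x + ketMinus y * ket1 x))
          (f (inner p.1)) (f p.2)).prod + phase α *
        (P.map fun p => (fun x y => c.ket 1 x * (ketPlus y * ket0 x + ketMinus y * ket1 x))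
          (f (inner p.1)) (f p.2)).prod := by
      intro f
      rw [entries_cons, entry_node, entries]
      simp only [Multiset.map_map, Function.comp_def, Multiset.prod_map_mul, entry_had]
      ring
    rw [contract_congr e1, contract_add, contract_mul_left,
      contract_pairs hn h fun x y => c.ket 0 x * (ketPlus y * ket0 x + ketMinus y * ket1 x),
      contract_pairs hn h fun x y => c.ket 1 x * (ketPlus y * ket0 x + ketMinus y * ket1 x)]
    simp only [Multiset.toFinset_zero, contract_empty, entries, Multiset.map_singleton,
      Multiset.prod_singleton, entry_node, Multiset.map_map, Function.comp_def, Colour.ket_had,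
      one_mul]

theorem proportional_pi_copy (c : Colour) (a : Wire n m) (k : ℕ) (P : Multiset (ℕ × Wire n m)) :
    Proportional {node c.swap 2 {a, inner k}, node c 0 (inner k ::ₘ P.map fun p => p.2)}
      (node c 0 (a ::ₘ P.map fun p => inner p.1) ::ₘ
        P.map fun p : ℕ × Wire n m => node c.swap 2 {inner p.1, p.2}) := by
  refine ⟨{k}, P.map Prod.fst, a ::ₘ P.map Prod.snd, 1, one_ne_zero, ?_, ?_,
    fun _ hn h h' f => ?_⟩
  · simp [legs, Piece.legs, two_nsmul]; simp only [← Multiset.singleton_add]; abel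
  · have e : legs (P.map fun p : ℕ × Wire n m => node c.swap 2 {inner p.1, p.2}) =
        (P.map fun p => inner p.1) + P.map Prod.snd := by
      have := legs_map_had P (fun p => inner p.1) Prod.snd
      rw [← this, legs, legs, Multiset.bind_map, Multiset.bind_map]; rfl
    rw [legs_cons, e, Piece.legs, two_nsmul, Multiset.map_map, Function.comp_def]
    simp only [← Multiset.singleton_add]; abel
  · have h := h k (by simp)
    rw [Multiset.mem_cons, not_or] at h
    have ha : a ≠ inner k := fun e => h.1 e.symm
    have h2 : inner k ∉ P.map fun p => p.2 := h.2
    have e1 : ∀ f : Wire n m → Fin 2,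
        entries (node c 0 (a ::ₘ P.map fun p => inner p.1) ::ₘ
          P.map fun p : ℕ × Wire n m => node c.swap 2 {inner p.1, p.2}) f =
        c.ket 0 (f a) * (P.map fun p => (fun x y => c.ket 0 x *
          (c.swap.ket 0 x * c.swap.ket 0 y - c.swap.ket 1 x * c.swap.ket 1 y))
          (f (inner p.1)) (f p.2)).prod +
        c.ket 1 (f a) * (P.map fun p => (fun x y => c.ket 1 x *
          (c.swap.ket 0 x * c.swap.ket 0 y - c.swap.ket 1 x * c.swap.ket 1 y))
          (f (inner p.1)) (f p.2)).prod := by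
      intro f
      rw [entries_cons, entry_node, entries]
      simp only [Multiset.map_map, Function.comp_def, Multiset.prod_map_mul, entry_node,
        Multiset.map_cons, Multiset.prod_cons, Multiset.insert_eq_cons, Multiset.map_singleton,
        Multiset.prod_singleton, phase_zero, phase_two, neg_one_mul, ← sub_eq_add_neg]
      ring
    have hi : ∀ j, IndepOf (P.map Prod.fst).toFinset
        fun f : Wire n m → Fin 2 => c.ket j (f a) := by
      intro j l hl f x
      rw [Multiset.mem_toFinset] at hl
      have := h' l hl
      rw [Multiset.mem_cons, not_or] at this
      simp only [Function.update_of_ne (fun e => this.1 e.symm : a ≠ inner l)]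
    have h'' : ∀ l ∈ P.map Prod.fst, inner l ∉ P.map Prod.snd := fun l hl hm =>
      h' l hl (Multiset.mem_cons_of_mem hm)
    rw [contract_congr e1, contract_add, contract_mul (hi 0), contract_mul (hi 1),
      contract_pairs hn h'' fun x y => c.ket 0 x *
        (c.swap.ket 0 x * c.swap.ket 0 y - c.swap.ket 1 x * c.swap.ket 1 y),
      contract_pairs hn h'' fun x y => c.ket 1 x *
        (c.swap.ket 0 x * c.swap.ket 0 y - c.swap.ket 1 x * c.swap.ket 1 y)]
    simp only [Multiset.toFinset_singleton, contract_singleton, entries, Multiset.insert_eq_cons,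
      Multiset.map_cons, Multiset.map_singleton,
      Multiset.prod_cons, Multiset.prod_singleton, entry_node, Function.update_self,
      Function.update_of_ne ha, phase_zero, phase_two, map_update_of_notMem h2, Colour.ket_flip,
      Multiset.map_map, Function.comp_def, sub_zero, sub_self]
    have e0 := c.ket_flip 0 (f a)
    have e1 := c.ket_flip 1 (f a)
    rw [sub_zero] at e0
    rw [sub_self] at e1
    linear_combination (P.map fun p => c.ket 0 (f p.2)).prod * e0 +
      (P.map fun p => c.ket 1 (f p.2)).prod * e1

theorem proportional_pi_comm (c : Colour) (α : ZMod 4) (a b : Wire n m) (k k' : ℕ) :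
    Proportional {node c.swap 2 {a, inner k}, node c α {inner k, b}}
      {node c (-α) {a, inner k'}, node c.swap 2 {inner k', b}} := by
  -- Moving the π phase past the phase `α` costs the factor e^{iα}.
  refine ⟨{k}, {k'}, {a, b}, phase α, phase_ne_zero α, ?_, ?_, fun _ _ h h' f => ?_⟩
  · simp [legs, Piece.legs, two_nsmul]; simp only [← Multiset.singleton_add]; abel
  · simp [legs, Piece.legs, two_nsmul]; simp only [← Multiset.singleton_add]; abel
  · have h := h k (by simp)
    have h' := h' k' (by simp)
    simp only [Multiset.insert_eq_cons, Multiset.mem_cons, Multiset.mem_singleton, not_or,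
      ← ne_eq] at h h'
    simp only [Multiset.toFinset_singleton, contract_singleton, entries, Multiset.insert_eq_cons,
      Multiset.map_cons, Multiset.map_singleton,
      Multiset.prod_cons, Multiset.prod_singleton, entry_node, Function.update_self,
      Function.update_of_ne h.1.symm, Function.update_of_ne h.2.symm,
      Function.update_of_ne h'.1.symm, Function.update_of_ne h'.2.symm, phase_two]
    have := sqrtHalf_sq
    have hp := phase_mul_neg α
    generalize phase (-α) = q at hp ⊢
    generalize phase α = p at hp ⊢
    generalize f a = x
    generalize f b = y
    cases c <;> fin_cases x <;> fin_cases y <;> simp [Colour.ket, Colour.swap] <;> grind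

theorem proportional_euler (c : Colour) (a b : Wire n m) (k k' : ℕ) :
    Proportional {had a b}
      {node c 1 {a, inner k}, node c.swap 1 {inner k, inner k'}, node c 1 {inner k', b}} := by
  -- The factor is e^{-iπ/4}, the global phase of the Euler decomposition.
  refine ⟨0, {k, k'}, {a, b}, sqrtHalf * (1 - Complex.I), ?_, ?_, ?_, fun _ hn _ h f => ?_⟩
  · refine mul_ne_zero sqrtHalf_ne_zero fun h => ?_
    have := congrArg Complex.re h
    simp at this
  · simp [legs, Piece.legs]
  · simp [legs, Piece.legs, two_nsmul]; simp only [← Multiset.singleton_add]; abel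
  · replace h := fun k hk w (hw : w ∈ _) => show w ≠ inner k from fun e => h k hk (e ▸ hw)
    simp only [Multiset.insert_eq_cons, Multiset.mem_cons, Multiset.mem_singleton,
      Multiset.nodup_cons, Multiset.nodup_singleton, forall_eq_or_imp, forall_eq] at h hn
    simp only [Multiset.toFinset_cons, Multiset.toFinset_singleton, Multiset.insert_eq_cons,
      Multiset.toFinset_zero, contract_empty]
    simp only [contract_insert, contract_singleton, Finset.mem_singleton,
      hn.1, not_false_eq_true, entries, Multiset.map_cons, entry_had,
      Multiset.map_singleton, Multiset.prod_cons, Multiset.prod_singleton, entry_node,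
      Function.update_apply, inner.injEq, h, Ne.symm hn.1, if_true, if_false, phase_one]
    have := sqrtHalf_sq
    have := Complex.I_sq
    generalize Complex.I = i at *
    generalize f a = x
    generalize f b = y
    cases c <;> fin_cases x <;> fin_cases y <;> simp [Colour.ket, Colour.swap] <;> grind

theorem Rule.proportional {L R : Multiset (Piece n m)} (h : Rule L R) : Proportional L R := by
  cases h with
  | cord_symm a b =>
    exact ⟨0, 0, {a, b}, 1, one_ne_zero, by simp [legs, Piece.legs],
      by simpa [legs, Piece.legs] using Multiset.pair_comm b a, fun _ _ _ _ f => by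
        simp [contract_empty, entries, entry_cord, eq_comm]⟩
  | had_symm a b =>
    refine ⟨0, 0, {a, b}, 1, one_ne_zero, by simp [legs, Piece.legs],
      by simpa [legs, Piece.legs] using Multiset.pair_comm b a, fun _ _ _ _ f => ?_⟩
    simp only [Multiset.toFinset_zero, contract_empty, entries, Multiset.map_singleton,
      Multiset.prod_singleton, entry_had]
    generalize f a = x
    generalize f b = y
    fin_cases x <;> fin_cases y <;> simp
  | cord_join a k e h => exact proportional_join a k e h
  | spider c α β k A B => exact proportional_spider c α β k A B
  | loop c α k A => exact proportional_loop c α k A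
  | cup c a b => exact proportional_cup c a b
  | bialgebra c a₁ a₂ b₁ b₂ k₁₁ k₁₂ k₂₁ k₂₂ k =>
    exact proportional_bialgebra c a₁ a₂ b₁ b₂ k₁₁ k₁₂ k₂₁ k₂₂ k
  | copy c k a b => exact proportional_copy c k a b
  | colour c α P => exact proportional_colour c α P
  | pi_copy c a k P => exact proportional_pi_copy c a k P
  | pi_comm c α a b k k' => exact proportional_pi_comm c α a b k k'
  | euler c a b k k' => exact proportional_euler c a b k k'

theorem contract_rename (σ : Equiv.Perm ℕ) (T : Finset ℕ) (F : (Wire n m → Fin 2) → ℂ)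
    (f : Wire n m → Fin 2) :
    contract (T.map σ.toEmbedding) (fun f => F (f ∘ Wire.rename σ)) f =
      contract T F (f ∘ Wire.rename σ) := by
  induction T using Finset.induction generalizing f with
  | empty => simp [contract_empty]
  | insert k T hk ih =>
    have e : ∀ x, Function.update f (inner (σ k)) x ∘ Wire.rename σ =
        Function.update (f ∘ Wire.rename σ) (inner k) x := by
      intro x
      funext w
      cases w <;> simp [Wire.rename, Function.update_apply]
    rw [Finset.map_insert, Equiv.coe_toEmbedding, contract_insert (by simpa using hk),
      contract_insert hk, ih, ih, e, e]

/-- The rewrite rules are sound for the property of being a zero diagram. -/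
theorem Diagram.Rewrites.interp_eq_zero {D D' : Diagram n m} (h : D.Rewrites D') :
    D.interp = 0 ↔ D'.interp = 0 := by
  induction h with
  | rule D D' L R C h hD hD' => exact h.proportional.interp_eq_zero hD hD'
  | rename D D' σ h =>
    have e1 : ∀ f, entries D'.pieces f = entries D.pieces (f ∘ Wire.rename σ) := by
      intro f
      simp only [h, entries, Multiset.map_map, Function.comp_def, entry_map]
    have hl : legs D'.pieces = (legs D.pieces).map (Wire.rename σ) := by
      rw [h, legs, legs, Multiset.bind_map, Multiset.map_bind]
      refine Multiset.bind_congr fun e _ => ?_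
      rcases e with _ | _ | _ <;> simp [Piece.map, Piece.legs]
    have e2 : inners (legs D'.pieces) = (inners (legs D.pieces)).map σ.toEmbedding := by
      ext k
      rw [mem_inners, hl]
      simp only [Multiset.mem_map, Finset.mem_map, mem_inners, Equiv.coe_toEmbedding]
      constructor
      · rintro ⟨w, hw, e⟩
        cases w <;> simp [Wire.rename] at e
        exact ⟨_, hw, e⟩
      · rintro ⟨l, hl, rfl⟩
        exact ⟨_, hl, rfl⟩
    rw [Diagram.interp_eq_zero, Diagram.interp_eq_zero, e2, contract_congr e1]
    simp only [contract_rename]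
    refine ⟨fun h f => h _, fun h f => ?_⟩
    -- Every labelling arises from another one by renaming, namely through the inverse permutation.
    have := h (f ∘ Wire.rename σ.symm)
    rwa [Function.comp_assoc, show Wire.rename (n := n) (m := m) σ.symm ∘ Wire.rename σ = id by
      funext w; cases w <;> simp [Wire.rename], Function.comp_id] at this
  | refl => rfl
  | symm _ _ _ ih => exact ih.symm
  | trans _ _ _ _ _ ih ih' => exact ih.trans ih'

end Soundness

/-! ### When a diagram in normal form vanishes -/

section ZeroTest

variable {n m : ℕ} {P Q E C : Multiset (Piece n m)} {T : Finset ℕ}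

/-- Without a common inner wire either factor is constant for the summation over the wires of the
other, so juxtaposition multiplies values. -/
theorem contract_add_of_disjoint (h : ∀ k, inner k ∈ legs P → inner k ∉ legs Q)
    (f : Wire n m → Fin 2) :
    contract (inners (legs (P + Q))) (entries (P + Q)) f =
      contract (inners (legs P)) (entries P) f * contract (inners (legs Q)) (entries Q) f := by
  have hu : inners (legs (P + Q)) = inners (legs Q) ∪ inners (legs P) := by
    ext k; simp [legs_add, or_comm]
  have hd : Disjoint (inners (legs Q)) (inners (legs P)) := by
    rw [Finset.disjoint_right]
    intro k hk hk'
    rw [mem_inners] at hk hk'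
    exact h k hk hk'
  have h1 : IndepOf (inners (legs P)) (entries Q) := entries_indepOf fun k hk =>
    h k (mem_inners.mp hk)
  have h2 : IndepOf (inners (legs Q)) (contract (inners (legs P)) (entries P)) :=
    contract_indepOf (entries_indepOf fun k hk hk' => h k hk' (mem_inners.mp hk))
  rw [hu, contract_union hd, ← contract_mul h2]
  refine congrFun (contract_congr fun g => ?_) f
  rw [mul_comm, ← contract_mul h1]
  exact congrFun (contract_congr fun g => by rw [entries_add, mul_comm]) g

theorem contract_single (c : Colour) (α : ZMod 4) (f : Wire n m → Fin 2) :
    contract (inners (legs (n := n) (m := m) {node c α 0})) (entries {node c α 0}) f =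
      1 + phase α := by
  simp [Piece.legs, inners, contract_empty, entries, entry_node]

theorem contract_pair (α β : ZMod 4) (k : ℕ) (f : Wire n m → Fin 2) :
    contract (inners (legs (n := n) (m := m) {node .green α {inner k}, node .red β {inner k}}))
        (entries {node .green α {inner k}, node .red β {inner k}}) f =
      sqrtHalf * (1 + phase β + phase α * (1 - phase β)) := by
  have : inners (legs (n := n) (m := m) {node .green α {inner k}, node .red β {inner k}}) =
      {k} := by
    ext l; simp [Piece.legs]
  rw [this, contract_singleton]
  simp [entries, entry_node, Colour.ket]
  ring

theorem ZeroSegment.contract_eq_zero {s : Multiset (Piece n m)} (h : ZeroSegment s)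
    (f : Wire n m → Fin 2) : contract (inners (legs s)) (entries s) f = 0 := by
  cases h with
  | green_pi => rw [contract_single, phase_two]; ring
  | red_pi => rw [contract_single, phase_two]; ring
  | pos_neg k =>
    rw [contract_pair, phase_one, phase_neg_one]
    linear_combination sqrtHalf * Complex.I_sq
  | neg_pos k =>
    rw [contract_pair, phase_one, phase_neg_one]
    linear_combination sqrtHalf * Complex.I_sq

/-- The scalar represented by a segment. -/
theorem ScalarSegment.exists_scalar {s : Multiset (Piece n m)} (h : ScalarSegment s) :
    ∃ z, (∀ f, contract (inners (legs s)) (entries s) f = z) ∧ (z = 0 → ZeroSegment s) := by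
  have hα : ∀ α : ZMod 4, α = 0 ∨ α = 1 ∨ α = 2 ∨ α = -1 := by decide
  cases h with
  | single c α =>
    refine ⟨_, contract_single c α, fun h => ?_⟩
    have h2 : α = 2 := by
      have h1 := congrArg Complex.re h
      rcases hα α with rfl | rfl | rfl | rfl
      · norm_num at h
      · simp at h1
      · rfl
      · simp [phase_neg_one] at h1
    subst h2
    cases c
    exacts [.green_pi, .red_pi]
  | pair α β k =>
    refine ⟨_, contract_pair α β k, fun h => ?_⟩
    have h := (mul_eq_zero.mp h).resolve_left sqrtHalf_ne_zero
    -- The value 1 + e^{iα} + e^{iβ} - e^{i(α+β)} is examined for all sixteen pairs of phases; its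
    -- real or its imaginary part excludes all but two.
    have h2 : α = 1 ∧ β = -1 ∨ α = -1 ∧ β = 1 := by
      have h1 := congrArg Complex.re h
      have h4 := congrArg Complex.im h
      rcases hα α with rfl | rfl | rfl | rfl <;> rcases hα β with rfl | rfl | rfl | rfl <;>
        first
          | decide | (norm_num [phase_neg_one] at h1; done) | norm_num [phase_neg_one] at h4
    rcases h2 with ⟨rfl, rfl⟩ | ⟨rfl, rfl⟩
    exacts [.pos_neg k, .neg_pos k]

theorem ZeroSegment.scalar {s : Multiset (Piece n m)} (h : ZeroSegment s) : ScalarSegment s := by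
  cases h
  exacts [.single .., .single .., .pair .., .pair ..]

/-- A segment contains both ends of its wire, so validity leaves none for the other pieces. -/
theorem ScalarSegment.disjoint {s : Multiset (Piece n m)} (h : ScalarSegment s)
    (hv : Valid (s + Q)) : ∀ k, inner k ∈ legs s → inner k ∉ legs Q := by
  intro k hk hk'
  have h1 := hv.count_inner k
  rw [legs_add, Multiset.count_add] at h1
  have h2 := Multiset.one_le_count_iff_mem.mpr hk'
  cases h with
  | single c α => simp [legs, Piece.legs] at hk
  | pair α β l =>
    simp [legs, Piece.legs] at hk
    subst hk
    rw [show (legs {node .green α {inner k}, node .red β {inner k}} : Multiset (Wire n m)) =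
      {inner k, inner k} by simp [legs, Piece.legs]] at h1
    simp only [Multiset.insert_eq_cons, Multiset.count_cons_self, Multiset.count_singleton_self]
      at h1
    omega

theorem Diagram.ContainsZero.interp_eq_zero {D : Diagram n m} (h : D.ContainsZero) :
    D.interp = 0 := by
  obtain ⟨s, hs, hz⟩ := h
  obtain ⟨C, hC⟩ := Multiset.le_iff_exists_add.mp hs
  rw [Diagram.interp_eq_zero, hC]
  intro f
  rw [contract_add_of_disjoint (hz.scalar.disjoint (hC ▸ D.valid)), hz.contract_eq_zero,
    zero_mul]

/-- The contraction is not identically zero. -/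
def NonZero (T : Finset ℕ) (P : Multiset (Piece n m)) : Prop :=
  ∃ f, contract T (entries P) f ≠ 0

theorem nonZero_segments {S : Multiset (Multiset (Piece n m))} (hS : ∀ s ∈ S, ScalarSegment s)
    (hz : ∀ s ∈ S, ¬ ZeroSegment s) (hv : Valid (S.sum + E))
    (hE : Valid E → NonZero (inners (legs E)) E) :
    NonZero (inners (legs (S.sum + E))) (S.sum + E) := by
  induction S using Multiset.induction with
  | empty => rw [Multiset.sum_zero, zero_add] at hv ⊢; exact hE hv
  | cons s S ih =>
    rw [Multiset.sum_cons, add_assoc] at hv ⊢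
    have hs := hS s (Multiset.mem_cons_self ..)
    have hd := hs.disjoint hv
    obtain ⟨z, hz1, hz2⟩ := hs.exists_scalar
    obtain ⟨f, hf⟩ := ih (fun s hs => hS s (Multiset.mem_cons_of_mem hs))
      (fun s hs => hz s (Multiset.mem_cons_of_mem hs)) (by
        refine ⟨fun i => ?_, fun j => ?_, fun k => ?_⟩
        · have := hv.count_input i
          rwa [legs_add, Multiset.count_add, (Multiset.count_eq_zero (s := legs s)).mpr, zero_add]
            at this
          cases hs <;> simp [legs, Piece.legs]
        · have := hv.count_output j
          rwa [legs_add, Multiset.count_add, (Multiset.count_eq_zero (s := legs s)).mpr, zero_add]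
            at this
          cases hs <;> simp [legs, Piece.legs]
        · have := hv.count_inner k
          rw [legs_add, Multiset.count_add] at this
          by_cases hk : inner k ∈ legs (S.sum + E)
          · rwa [(Multiset.count_eq_zero (s := legs s)).mpr fun h => hd k h hk, zero_add] at this
          · exact .inl (Multiset.count_eq_zero.mpr hk))
    refine ⟨f, ?_⟩
    rw [contract_add_of_disjoint hd, hz1]
    exact mul_ne_zero (mt hz2 (hz s (Multiset.mem_cons_self ..))) hf

/-- All inner wires in `T` have two ends at `P`, the others at most one. -/
structure Closed (T : Finset ℕ) (P : Multiset (Piece n m)) : Prop where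
  mem_iff : ∀ k, k ∈ T ↔ (legs P).count (inner k) = 2
  le_two : ∀ k, (legs P).count (inner k) ≤ 2

/-- A two-legged piece that represents an invertible matrix. -/
def IsInvertible (e : Piece n m) (a b : Wire n m) : Prop :=
  e.legs = {a, b} ∧ ∃ M : Matrix (Fin 2) (Fin 2) ℂ,
    (∀ f, e.entry f = M (f a) (f b)) ∧ ∀ g : Fin 2 → ℂ,
      (∀ y, M 0 y * g 0 + M 1 y * g 1 = 0) → ∀ x, g x = 0

theorem isInvertible_node (c : Colour) (α : ZMod 4) (a b : Wire n m) :
    IsInvertible (node c α {a, b}) a b := by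
  refine ⟨rfl, fun x y => c.ket 0 x * c.ket 0 y + phase α * (c.ket 1 x * c.ket 1 y),
    fun f => by simp [entry_node], fun g h x => ?_⟩
  have h0 := h 0
  have h1 := h 1
  have := sqrtHalf_sq
  have hp := phase_mul_neg α
  generalize phase (-α) = q at hp
  generalize phase α = p at *
  cases c <;> fin_cases x <;> simp [Colour.ket] at h0 h1 ⊢ <;> grind

theorem isInvertible_had (a b : Wire n m) : IsInvertible (had a b) a b := by
  refine ⟨rfl, fun x y => ketPlus y * ket0 x + ketMinus y * ket1 x,
    fun f => entry_had a b f, fun g h x => ?_⟩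
  have h0 := h 0
  have h1 := h 1
  have := sqrtHalf_sq
  fin_cases x <;> simp at h0 h1 ⊢ <;> grind

/-- The contraction of `P`, as a vector in the label of `k`, is acted on by an invertible matrix
whose other index is the label of `b`. If the result vanishes for every label of `b`, so does the
vector. -/
theorem NonZero.cons_invertible {e : Piece n m} {k : ℕ} {b : Wire n m}
    (he : IsInvertible e (inner k) b) (hk : k ∉ T) (hb : b ∉ legs P) (hbT : ∀ l ∈ T, b ≠ inner l)
    (hbk : b ≠ inner k) (h : NonZero T P) : NonZero (insert k T) (e ::ₘ P) := by
  obtain ⟨hl, M, hM, hinj⟩ := he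
  by_contra hz
  rw [NonZero] at hz
  push Not at hz
  obtain ⟨f, hf⟩ := h
  refine hf ?_
  -- The wire `b` does not occur in `P`, so its label can be varied without changing this vector.
  have hi : ∀ f x, contract T (entries P) (Function.update f b x) = contract T (entries P) f := by
    intro f x
    refine Finset.sum_congr rfl fun s _ => entries_congr fun w hw => ?_
    have hwb : w ≠ b := by rintro rfl; exact hb hw
    cases w with
    | input i => simp [relabel, Function.update_of_ne hwb]
    | output i => simp [relabel, Function.update_of_ne hwb]
    | inner l => simp [relabel, Function.update_of_ne hwb]
  have hie : IndepOf T e.entry := by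
    intro l hl' f x
    refine entry_congr fun w hw => Function.update_of_ne ?_ ..
    rw [hl] at hw
    simp only [Multiset.insert_eq_cons, Multiset.mem_cons, Multiset.mem_singleton] at hw
    rcases hw with rfl | rfl
    · rintro h; exact hk (Wire.inner.inj h ▸ hl')
    · exact hbT l hl'
  have key := hinj (fun x => contract T (entries P) (Function.update f (inner k) x)) (fun y => by
    have := hz (Function.update f b y)
    rw [contract_insert hk, contract_congr (entries_cons e P), contract_mul hie, contract_mul hie,
      hM, hM, Function.update_self, Function.update_self, Function.update_of_ne hbk,
      Function.update_of_ne hbk, Function.update_self, Function.update_comm hbk,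
      Function.update_comm hbk, hi, hi] at this
    exact this) (f (inner k))
  rwa [Function.update_eq_self] at key

theorem LocalClifford.mem_legs {a b : Wire n m} (h : LocalClifford a b E) :
    a = b ∨ b ∈ legs E := by
  cases h with
  | nil => exact .inl rfl
  | shift c α _ _ k E h => right; simp [legs, Piece.legs]
  | had _ _ k E h => right; simp [legs, Piece.legs]

/-- The outermost operator of a chain is peeled off. Its boundary wire `b` occurs nowhere else, and
the wire `k` towards the vertex ceases to be contracted and becomes the new free end. -/
theorem LocalClifford.nonZero_step {e : Piece n m} {k : ℕ} {a b : Wire n m}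
    (he : IsInvertible e (inner k) b) (h : LocalClifford a (inner k) E)
    (hT : Closed T (e ::ₘ E + C)) (hb : (legs (e ::ₘ E + C)).count b = 1) (ha : a ∈ legs C)
    (ih : ∀ T' ⊆ T, Closed T' (E + C) → (legs (E + C)).count (inner k) = 1 → NonZero T' (E + C)) :
    NonZero T (e ::ₘ E + C) := by
  have hl : legs (e ::ₘ E + C) = inner k ::ₘ b ::ₘ legs (E + C) := by
    rw [Multiset.cons_add, legs_cons, he.1, Multiset.insert_eq_cons, Multiset.cons_add,
      Multiset.singleton_add]
  obtain ⟨h1, h2⟩ := hT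
  rw [hl] at hb h1 h2
  have hkm : inner k ∈ legs (E + C) := by
    rw [legs_add, Multiset.mem_add]
    rcases h.mem_legs with rfl | h
    exacts [.inr ha, .inl h]
  have hkc := Multiset.one_le_count_iff_mem.mpr hkm
  have hbk : b ≠ inner k := by
    rintro rfl
    rw [Multiset.count_cons_self, Multiset.count_cons_self] at hb
    omega
  rw [Multiset.count_cons_of_ne hbk, Multiset.count_cons_self] at hb
  have hb0 : (legs (E + C)).count b = 0 := by omega
  have hk2 := h2 k
  rw [Multiset.count_cons_self, Multiset.count_cons_of_ne hbk.symm] at hk2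
  have hkT : k ∈ T := by
    rw [h1, Multiset.count_cons_self, Multiset.count_cons_of_ne hbk.symm]
    omega
  rw [← Finset.insert_erase hkT, Multiset.cons_add]
  refine NonZero.cons_invertible he (Finset.notMem_erase k T) (Multiset.count_eq_zero.mp hb0)
    (fun l hl e => ?_) hbk (ih _ (Finset.erase_subset ..) ⟨fun l => ?_, fun l => ?_⟩ (by omega))
  · have := (h1 l).mp (Finset.mem_of_mem_erase hl)
    rw [← e, Multiset.count_cons_of_ne hbk, Multiset.count_cons_self] at this
    omega
  · rw [Finset.mem_erase, h1]
    by_cases hlk : l = k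
    · subst hlk
      simp only [ne_eq, not_true_eq_false, false_and, false_iff]
      omega
    · rw [Multiset.count_cons_of_ne (fun e => hlk (Wire.inner.inj e))]
      by_cases hlb : inner l = b
      · rw [hlb, Multiset.count_cons_self]; omega
      · rw [Multiset.count_cons_of_ne hlb]; tauto
  · have := h2 l
    rw [Multiset.count_cons, Multiset.count_cons] at this
    omega

/-- Chains of invertible pieces can be removed. -/
theorem LocalClifford.nonZero {a b : Wire n m} (h : LocalClifford a b E) :
    ∀ T : Finset ℕ, Closed T (E + C) → (legs (E + C)).count b = 1 → a ∈ legs C →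
      (∀ T' ⊆ T, Closed T' C → (legs C).count a = 1 → NonZero T' C) → NonZero T (E + C) := by
  induction h with
  | nil a =>
    intro T hT hb _ hC
    rw [zero_add] at hT hb ⊢
    exact hC T subset_rfl hT hb
  | shift c α a b k E h ih =>
    intro T hT hb ha hC
    exact h.nonZero_step (isInvertible_node ..) hT hb ha fun T' hT' hc hk =>
      ih T' hc hk ha fun T'' hT'' => hC T'' (hT''.trans hT')
  | had a b k E h ih =>
    intro T hT hb ha hC
    exact h.nonZero_step (isInvertible_had ..) hT hb ha fun T' hT' hc hk =>
      ih T' hc hk ha fun T'' hT'' => hC T'' (hT''.trans hT')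

/-- Graph states are non-zero. -/
theorem nonZero_graphState {edges : Finset ((Fin n ⊕ Fin m) × (Fin n ⊕ Fin m))}
    {out : Fin n ⊕ Fin m → Wire n m} {l r : (Fin n ⊕ Fin m) × (Fin n ⊕ Fin m) → ℕ}
    (hT : Closed T (GraphState edges out l r)) (ho : ∀ v, ∀ k ∈ T, out v ≠ inner k) :
    NonZero T (GraphState edges out l r) := by
  -- The amplitude at all-zero labels is computed. A phaseless green node vanishes unless its legs
  -- agree, and one of them is the free wire with label `0`; hence only the term with no label `1`
  -- survives, and its edges contribute √½ each.
  refine ⟨fun _ => 0, ?_⟩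
  rw [contract, Finset.sum_eq_single ∅]
  · have h0 : relabel T ∅ (fun _ : Wire n m => 0) = fun _ => 0 := by
      funext w; cases w <;> simp [relabel]
    rw [h0, entries, GraphState, Multiset.map_add, Multiset.prod_add]
    refine mul_ne_zero ?_ ?_
    · refine Multiset.prod_ne_zero fun h => ?_
      obtain ⟨v, -, hv⟩ := Multiset.mem_map.mp (Multiset.map_map _ _ _ ▸ h)
      simp [entry] at hv
    · refine Multiset.prod_ne_zero fun h => ?_
      obtain ⟨v, -, hv⟩ := Multiset.mem_map.mp (Multiset.map_map _ _ _ ▸ h)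
      simp [entry, sqrtHalf_ne_zero] at hv
  · intro s hs hne
    obtain ⟨k, hk⟩ := Finset.nonempty_iff_ne_empty.mpr hne
    have hkT := Finset.mem_powerset.mp hs hk
    have hm : inner k ∈ legs (GraphState edges out l r) := by
      rw [← Multiset.count_pos, (hT.mem_iff k).mp hkT]; norm_num
    have hv : ∃ v, inner k ∈ ((edges.filter fun e => e.1 = v).val.map fun e =>
        (inner (l e) : Wire n m)) +
        (edges.filter fun e => e.2 = v).val.map fun e => inner (r e) := by
      have hl : ∀ e ∈ edges, (inner (l e) : Wire n m) ∈ (edges.filter fun e' => e'.1 = e.1).val.map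
          fun e => inner (l e) := fun e he =>
        Multiset.mem_map_of_mem _ (Finset.mem_filter.mpr ⟨he, rfl⟩)
      have hr : ∀ e ∈ edges, (inner (r e) : Wire n m) ∈ (edges.filter fun e' => e'.2 = e.2).val.map
          fun e => inner (r e) := fun e he =>
        Multiset.mem_map_of_mem _ (Finset.mem_filter.mpr ⟨he, rfl⟩)
      rw [GraphState, legs_add, legs_map_had, Multiset.mem_add, Multiset.mem_add] at hm
      rcases hm with hm | hm | hm
      · obtain ⟨e, he, hm⟩ := Multiset.mem_bind.mp hm
        obtain ⟨v, -, rfl⟩ := Multiset.mem_map.mp he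
        rw [Piece.legs, Multiset.cons_add, Multiset.mem_cons] at hm
        exact ⟨v, hm.resolve_left fun e => ho v k hkT e.symm⟩
      · obtain ⟨e, he, hm⟩ := Multiset.mem_map.mp hm
        exact ⟨e.1, Multiset.mem_add.mpr (.inl (hm ▸ hl e he))⟩
      · obtain ⟨e, he, hm⟩ := Multiset.mem_map.mp hm
        exact ⟨e.2, Multiset.mem_add.mpr (.inr (hm ▸ hr e he))⟩
    obtain ⟨v, hv⟩ := hv
    refine Multiset.prod_eq_zero (Multiset.mem_map.mpr ⟨node .green 0 (out v ::ₘ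
      ((edges.filter fun e => e.1 = v).val.map fun e => inner (l e)) +
      (edges.filter fun e => e.2 = v).val.map fun e => inner (r e)), ?_, ?_⟩)
    · exact Multiset.mem_add.mpr (.inl (Multiset.mem_map_of_mem _ (Finset.mem_univ v)))
    · have ho' : relabel T s (fun _ => 0) (out v) = 0 := by
        have := ho v
        rcases hw : out v with i | j | l
        · rfl
        · rfl
        · have : l ∉ T := fun h => this l h hw
          simp [relabel, this]
      obtain ⟨A, hA⟩ := Multiset.exists_cons_of_mem hv
      rw [Multiset.cons_add, hA]
      have hk1 : relabel T s (fun _ => 0) (inner k : Wire n m) = 1 := by simp [relabel, hkT, hk]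
      simp [entry, ho', hk1]
  · simp

theorem IsGSLC.nonZero (h : IsGSLC E) (hv : Valid E) : NonZero (inners (legs E)) E := by
  obtain ⟨edges, out, l, r, cl, -, hcl, rfl⟩ := h
  have hout : ∀ v, out v ∈ legs (GraphState edges out l r) := fun v => by
    rw [GraphState, legs_add, Multiset.mem_add, legs, Multiset.mem_bind]
    exact .inl ⟨_, Multiset.mem_map_of_mem _ (Finset.mem_univ v), by simp [Piece.legs]⟩
  -- The set `s` contains the vertices whose chains are still present. For the others, `out v` is
  -- required to be free. Since such partial collections are no longer diagrams, `Closed` takes the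
  -- place of validity.
  have key : ∀ (s : Finset (Fin n ⊕ Fin m)) (T : Finset ℕ),
      Closed T (∑ v ∈ s, cl v + GraphState edges out l r) →
      (∀ v ∈ s, (legs (∑ v ∈ s, cl v + GraphState edges out l r)).count (boundary v) ≤ 1) →
      (∀ v ∉ s, ∀ k ∈ T, out v ≠ inner k) →
      NonZero T (∑ v ∈ s, cl v + GraphState edges out l r) := by
    intro s
    induction s using Finset.induction with
    | empty =>
      intro T hT _ ho
      rw [Finset.sum_empty, zero_add] at hT ⊢
      exact nonZero_graphState hT fun v => ho v (Finset.notMem_empty v)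
    | insert v s hv ih =>
      intro T hT hb ho
      rw [Finset.sum_insert hv, add_assoc] at hT hb ⊢
      have hout' : out v ∈ legs (∑ v ∈ s, cl v + GraphState edges out l r) := by
        rw [legs_add]; exact Multiset.mem_add.mpr (.inr (hout v))
      have hbv : (legs (cl v + (∑ v ∈ s, cl v + GraphState edges out l r))).count
          (boundary v) = 1 := by
        refine le_antisymm (hb v (Finset.mem_insert_self ..)) ?_
        rw [Multiset.one_le_count_iff_mem, legs_add, Multiset.mem_add]
        rcases (hcl v).mem_legs with h | h
        exacts [.inr (h ▸ hout'), .inl h]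
      refine (hcl v).nonZero T hT hbv hout' fun T' hT' hc ha => ih T' hc (fun w hw => ?_)
        fun w hw k hk => ?_
      · refine le_trans ?_ (hb w (Finset.mem_insert_of_mem hw))
        rw [legs_add (cl v), Multiset.count_add]
        exact Nat.le_add_left ..
      -- Once the chain at `v` is gone, `out v` has a single end and cannot belong to the contracted
      -- wires.
      · by_cases hwv : w = v
        · subst hwv
          intro e
          have := (hc.mem_iff k).mp hk
          rw [← e, ha] at this
          omega
        · exact ho w (by simp [hwv, hw]) k (hT' hk)
  rw [add_comm] at hv ⊢
  refine key Finset.univ _ ⟨fun k => ?_, fun k => ?_⟩ (fun v _ => ?_) (by simp)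
  · have := hv.count_inner k
    rw [mem_inners, ← Multiset.count_pos]
    omega
  · have := hv.count_inner k
    omega
  · cases v with
    | inl i => exact (hv.count_input i).le
    | inr j => exact (hv.count_output j).le

/-- A diagram in normal form is zero if and only if it contains one of the zero scalars. -/
theorem Diagram.IsNormalForm.interp_eq_zero {D : Diagram n m} (h : D.IsNormalForm) :
    D.interp = 0 ↔ D.ContainsZero := by
  refine ⟨fun h0 => ?_, Diagram.ContainsZero.interp_eq_zero⟩
  obtain ⟨S, E, hS, hE, hD⟩ := h
  by_contra hz
  have hz' : ∀ s ∈ S, ¬ ZeroSegment s := by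
    intro s hs hs'
    refine hz ⟨s, ?_, hs'⟩
    obtain ⟨S', rfl⟩ := Multiset.exists_cons_of_mem hs
    rw [hD, Multiset.sum_cons, add_assoc]
    exact Multiset.le_add_right ..
  obtain ⟨f, hf⟩ := nonZero_segments hS hz' (hD ▸ D.valid) hE.nonZero
  rw [Diagram.interp_eq_zero, hD] at h0
  exact hf (h0 f)

end ZeroTest

/-! ### Primitive recursive arithmetic of Gaussian integers -/

section Arithmetic

/-- Codes for Gaussian integers: `(a, b, c, d)` stands for `a + b i - c - d i`. -/
abbrev GaussCode : Type := ℕ × ℕ × ℕ × ℕ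

/-- The Gaussian integer with the given code. -/
noncomputable def GaussCode.value (p : GaussCode) : ℂ :=
  p.1 + p.2.1 * Complex.I - p.2.2.1 - p.2.2.2 * Complex.I

/-- Addition of Gaussian integers. -/
def GaussCode.add (p q : GaussCode) : GaussCode :=
  (p.1 + q.1, p.2.1 + q.2.1, p.2.2.1 + q.2.2.1, p.2.2.2 + q.2.2.2)

/-- Multiplication of Gaussian integers. -/
def GaussCode.mul (p q : GaussCode) : GaussCode :=
  (p.1 * q.1 + p.2.1 * q.2.2.2 + p.2.2.1 * q.2.2.1 + p.2.2.2 * q.2.1,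
    p.1 * q.2.1 + p.2.1 * q.1 + p.2.2.1 * q.2.2.2 + p.2.2.2 * q.2.2.1,
    p.1 * q.2.2.1 + p.2.1 * q.2.1 + p.2.2.1 * q.1 + p.2.2.2 * q.2.2.2,
    p.1 * q.2.2.2 + p.2.1 * q.2.2.1 + p.2.2.1 * q.2.1 + p.2.2.2 * q.1)

/-- Powers of the imaginary unit. -/
def GaussCode.unit (e : ℕ) : GaussCode :=
  if e % 4 = 0 then (1, 0, 0, 0) else if e % 4 = 1 then (0, 1, 0, 0)
    else if e % 4 = 2 then (0, 0, 1, 0) else (0, 0, 0, 1)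

/-- A natural number that vanishes if and only if the Gaussian integer does. -/
def GaussCode.size (p : GaussCode) : ℕ :=
  (p.1 - p.2.2.1) + (p.2.2.1 - p.1) + ((p.2.1 - p.2.2.2) + (p.2.2.2 - p.2.1))

theorem GaussCode.value_zero : GaussCode.value (0, 0, 0, 0) = 0 := by simp [value]

theorem GaussCode.value_add (p q : GaussCode) : (p.add q).value = p.value + q.value := by
  simp only [value, add]; push_cast; ring

theorem GaussCode.value_mul (p q : GaussCode) : (p.mul q).value = p.value * q.value := by
  simp only [value, mul]; push_cast; linear_combination
    ((p.2.1 : ℂ) * q.2.2.2 + p.2.2.2 * q.2.1 - p.2.1 * q.2.1 - p.2.2.2 * q.2.2.2) * Complex.I_sq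

theorem GaussCode.value_unit (e : ℕ) : (GaussCode.unit e).value = Complex.I ^ e := by
  have h : Complex.I ^ e = Complex.I ^ (e % 4) := by
    conv_lhs => rw [← Nat.div_add_mod e 4, pow_add, pow_mul, Complex.I_pow_four, one_pow, one_mul]
  have h4 : e % 4 < 4 := Nat.mod_lt _ (by norm_num)
  rw [h, unit]
  generalize e % 4 = r at *
  interval_cases r <;> simp [value]

/-- Truncated subtraction in both directions gives the absolute values of the real and imaginary
parts, so natural numbers suffice throughout. -/
theorem GaussCode.size_eq_zero (p : GaussCode) : p.size = 0 ↔ p.value = 0 := by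
  obtain ⟨a, b, c, d⟩ := p
  rw [Complex.ext_iff]
  simp only [value, Complex.sub_re, Complex.add_re, Complex.mul_re, Complex.natCast_re,
    Complex.natCast_im, Complex.I_re, Complex.I_im, Complex.sub_im, Complex.add_im,
    Complex.mul_im, Complex.zero_re, Complex.zero_im]
  have h1 : (a : ℝ) + (b * 0 - 0 * 1) - c - (d * 0 - 0 * 1) = 0 ↔ a = c := by
    constructor
    · intro h
      have : (a : ℝ) = c := by linarith
      exact_mod_cast this
    · rintro rfl; ring
  have h2 : (0 : ℝ) + (b * 1 + 0 * 0) - 0 - (d * 1 + 0 * 0) = 0 ↔ b = d := by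
    constructor
    · intro h
      have : (b : ℝ) = d := by linarith
      exact_mod_cast this
    · rintro rfl; ring
  rw [h1, h2, size]
  simp only
  omega

theorem primrec_coords : Primrec (fun p : GaussCode => p.1) ∧ Primrec (fun p : GaussCode => p.2.1) ∧
    Primrec (fun p : GaussCode => p.2.2.1) ∧ Primrec (fun p : GaussCode => p.2.2.2) :=
  ⟨Primrec.fst, Primrec.fst.comp Primrec.snd, Primrec.fst.comp (Primrec.snd.comp Primrec.snd),
    Primrec.snd.comp (Primrec.snd.comp Primrec.snd)⟩

theorem primrec_add : Primrec₂ GaussCode.add := by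
  have h (g : GaussCode → ℕ) (hg : Primrec g) : Primrec fun x : GaussCode × GaussCode =>
      g x.1 + g x.2 :=
    Primrec.nat_add.comp (hg.comp Primrec.fst) (hg.comp Primrec.snd)
  obtain ⟨p0, p1, p2, p3⟩ := primrec_coords
  exact (Primrec.pair (h _ p0) (Primrec.pair (h _ p1) (Primrec.pair (h _ p2) (h _ p3)))).of_eq
    fun _ => rfl

theorem primrec_mul : Primrec₂ GaussCode.mul := by
  have h (g₁ h₁ g₂ h₂ g₃ h₃ g₄ h₄ : GaussCode → ℕ) (a₁ : Primrec g₁) (b₁ : Primrec h₁)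
      (a₂ : Primrec g₂) (b₂ : Primrec h₂) (a₃ : Primrec g₃) (b₃ : Primrec h₃) (a₄ : Primrec g₄)
      (b₄ : Primrec h₄) : Primrec fun x : GaussCode × GaussCode =>
      g₁ x.1 * h₁ x.2 + g₂ x.1 * h₂ x.2 + g₃ x.1 * h₃ x.2 + g₄ x.1 * h₄ x.2 := by
    have m (g h : GaussCode → ℕ) (hg : Primrec g) (hh : Primrec h) :
        Primrec fun x : GaussCode × GaussCode => g x.1 * h x.2 :=
      Primrec.nat_mul.comp (hg.comp Primrec.fst) (hh.comp Primrec.snd)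
    exact Primrec.nat_add.comp (Primrec.nat_add.comp (Primrec.nat_add.comp (m _ _ a₁ b₁)
      (m _ _ a₂ b₂)) (m _ _ a₃ b₃)) (m _ _ a₄ b₄)
  obtain ⟨p0, p1, p2, p3⟩ := primrec_coords
  exact (Primrec.pair (h _ _ _ _ _ _ _ _ p0 p0 p1 p3 p2 p2 p3 p1) (Primrec.pair
    (h _ _ _ _ _ _ _ _ p0 p1 p1 p0 p2 p3 p3 p2) (Primrec.pair
    (h _ _ _ _ _ _ _ _ p0 p2 p1 p1 p2 p0 p3 p3)
    (h _ _ _ _ _ _ _ _ p0 p3 p1 p2 p2 p1 p3 p0)))).of_eq fun _ => rfl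

theorem primrec_unit : Primrec GaussCode.unit := by
  have h : Primrec fun e : ℕ => e % 4 := Primrec.nat_mod.comp .id (.const 4)
  exact Primrec.ite (Primrec.eq.comp h (.const 0)) (.const _) <|
    Primrec.ite (Primrec.eq.comp h (.const 1)) (.const _) <|
    Primrec.ite (Primrec.eq.comp h (.const 2)) (.const _) (.const _)

theorem primrec_size : Primrec GaussCode.size := by
  obtain ⟨p0, p1, p2, p3⟩ := primrec_coords
  exact (Primrec.nat_add.comp
    (Primrec.nat_add.comp (Primrec.nat_sub.comp p0 p2) (Primrec.nat_sub.comp p2 p0))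
    (Primrec.nat_add.comp (Primrec.nat_sub.comp p1 p3) (Primrec.nat_sub.comp p3 p1))).of_eq
    fun _ => rfl

end Arithmetic

/-! ### Primitive recursive evaluation of a diagram by brute force -/

section Evaluation

/-- The label of the wire with code `c`, when the bits of `s` and `w` are the labels of the inner
wires and of the inputs and outputs. -/
def codeLabel (s w c : ℕ) : ℕ := if c % 3 = 2 then s / 2 ^ (c / 3) % 2 else w / 2 ^ c % 2

/-- The number of legs with label `1`. -/
def codeWeight (s w : ℕ) (l : List ℕ) : ℕ := l.foldr (fun c r => codeLabel s w c + r) 0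

/-- A multiple of the matrix entry of the piece with code `e`. -/
def codeEntry (s w : ℕ) (e : ℕ × ℕ × List ℕ) : GaussCode :=
  if e.1 = 1 then (GaussCode.unit 0).add (GaussCode.unit (e.2.1 + 2 * codeWeight s w e.2.2))
  else if e.1 = 2 then GaussCode.unit (2 * (codeWeight s w e.2.2 / 2))
  else (if codeWeight s w e.2.2 = 0 then GaussCode.unit 0 else (0, 0, 0, 0)).add
    (if codeWeight s w e.2.2 = e.2.2.length then GaussCode.unit e.2.1 else (0, 0, 0, 0))

/-- A multiple of the matrix entry of a collection of pieces. -/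
def codeEntries (s w : ℕ) (t : List (ℕ × ℕ × List ℕ)) : GaussCode :=
  t.foldr (fun e r => (codeEntry s w e).mul r) (GaussCode.unit 0)

/-- The sum of `codeEntries s w t` over all `s < N`. -/
def codeSum (w N : ℕ) (t : List (ℕ × ℕ × List ℕ)) : GaussCode :=
  (List.range N).foldr (fun s r => (codeEntries s w t).add r) (0, 0, 0, 0)

/-- An upper bound for the wire codes in a description. -/
def codeBound (t : List (ℕ × ℕ × List ℕ)) : ℕ :=
  t.foldr (fun e r => e.2.2.foldr (fun c r => c + 1 + r) r) 0

/-- The total size of the matrix entries. -/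
def codeSize (t : List (ℕ × ℕ × List ℕ)) : ℕ :=
  (List.range (2 ^ codeBound t)).foldr
    (fun w r => (codeSum w (2 ^ codeBound t) t).size + r) 0

theorem primrec_pow : Primrec₂ ((· ^ ·) : ℕ → ℕ → ℕ) := Primrec₂.unpaired'.1 Nat.Primrec.pow

theorem primrec_codeLabel : Primrec fun x : (ℕ × ℕ) × ℕ => codeLabel x.1.1 x.1.2 x.2 := by
  have s : Primrec fun x : (ℕ × ℕ) × ℕ => x.1.1 := Primrec.fst.comp Primrec.fst
  have w : Primrec fun x : (ℕ × ℕ) × ℕ => x.1.2 := Primrec.snd.comp Primrec.fst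
  have c : Primrec fun x : (ℕ × ℕ) × ℕ => x.2 := Primrec.snd
  have bit : ∀ {f g : (ℕ × ℕ) × ℕ → ℕ}, Primrec f → Primrec g →
      Primrec fun x => f x / 2 ^ g x % 2 := fun hf hg =>
    Primrec.nat_mod.comp (Primrec.nat_div.comp hf (primrec_pow.comp (.const 2) hg)) (.const 2)
  exact Primrec.ite (Primrec.eq.comp (Primrec.nat_mod.comp c (.const 3)) (.const 2))
    (bit s (Primrec.nat_div.comp c (.const 3))) (bit w c)

/-- The evaluation is written with folds whose step functions depend on parameters; this is the
closure property that they all need. -/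
theorem primrec_foldr {α β σ : Type*} [Primcodable α] [Primcodable β] [Primcodable σ]
    {f : α → List β} {g : α → σ} {h : α → β → σ → σ} (hf : Primrec f) (hg : Primrec g)
    (hh : Primrec fun x : α × β × σ => h x.1 x.2.1 x.2.2) :
    Primrec fun a => (f a).foldr (h a) (g a) :=
  (Primrec.list_foldr (h := fun a p => h a p.1 p.2) hf hg hh).of_eq fun _ => rfl

theorem primrec_codeWeight :
    Primrec fun x : (ℕ × ℕ) × List ℕ => codeWeight x.1.1 x.1.2 x.2 := by
  have h : Primrec fun y : ((ℕ × ℕ) × List ℕ) × ℕ × ℕ =>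
      codeLabel y.1.1.1 y.1.1.2 y.2.1 + y.2.2 :=
    Primrec.nat_add.comp
      (primrec_codeLabel.comp
        (Primrec.pair (Primrec.fst.comp Primrec.fst) (Primrec.fst.comp Primrec.snd)))
      (Primrec.snd.comp Primrec.snd)
  exact (primrec_foldr (h := fun x c r => codeLabel x.1.1 x.1.2 c + r) Primrec.snd (.const 0)
    h).of_eq fun _ => rfl

theorem primrec_codeEntry :
    Primrec fun x : (ℕ × ℕ) × (ℕ × ℕ × List ℕ) => codeEntry x.1.1 x.1.2 x.2 := by
  have ty : Primrec fun x : (ℕ × ℕ) × (ℕ × ℕ × List ℕ) => x.2.1 := Primrec.fst.comp Primrec.snd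
  have α : Primrec fun x : (ℕ × ℕ) × (ℕ × ℕ × List ℕ) => x.2.2.1 :=
    Primrec.fst.comp (Primrec.snd.comp Primrec.snd)
  have l : Primrec fun x : (ℕ × ℕ) × (ℕ × ℕ × List ℕ) => x.2.2.2 :=
    Primrec.snd.comp (Primrec.snd.comp Primrec.snd)
  have N : Primrec fun x : (ℕ × ℕ) × (ℕ × ℕ × List ℕ) => codeWeight x.1.1 x.1.2 x.2.2.2 :=
    primrec_codeWeight.comp (Primrec.pair Primrec.fst l)
  have two (f : (ℕ × ℕ) × (ℕ × ℕ × List ℕ) → ℕ) (hf : Primrec f) : Primrec fun x => 2 * f x :=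
    Primrec.nat_mul.comp (.const 2) hf
  have red := primrec_add.comp (.const (GaussCode.unit 0))
    (primrec_unit.comp (Primrec.nat_add.comp α (two _ N)))
  have had := primrec_unit.comp (two _ (Primrec.nat_div.comp N (.const 2)))
  have green := primrec_add.comp
    (Primrec.ite (Primrec.eq.comp N (.const 0)) (.const (GaussCode.unit 0)) (.const (0, 0, 0, 0)))
    (Primrec.ite (Primrec.eq.comp N (Primrec.list_length.comp l)) (primrec_unit.comp α)
      (.const (0, 0, 0, 0)))
  exact (Primrec.ite (Primrec.eq.comp ty (.const 1)) red
    (Primrec.ite (Primrec.eq.comp ty (.const 2)) had green)).of_eq fun _ => rfl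

theorem primrec_codeEntries :
    Primrec fun x : (ℕ × ℕ) × List (ℕ × ℕ × List ℕ) => codeEntries x.1.1 x.1.2 x.2 := by
  have e : Primrec fun y : ((ℕ × ℕ) × List (ℕ × ℕ × List ℕ)) × (ℕ × ℕ × List ℕ) × GaussCode =>
      codeEntry y.1.1.1 y.1.1.2 y.2.1 :=
    primrec_codeEntry.comp
      (Primrec.pair (Primrec.fst.comp Primrec.fst) (Primrec.fst.comp Primrec.snd))
  have r : Primrec fun y : ((ℕ × ℕ) × List (ℕ × ℕ × List ℕ)) × (ℕ × ℕ × List ℕ) × GaussCode =>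
      y.2.2 := Primrec.snd.comp Primrec.snd
  have h := primrec_foldr (f := fun x : (ℕ × ℕ) × List (ℕ × ℕ × List ℕ) => x.2)
    (g := fun _ => GaussCode.unit 0) (h := fun x e r => (codeEntry x.1.1 x.1.2 e).mul r)
    Primrec.snd (.const _) (primrec_mul.comp e r)
  exact h.of_eq fun x => by rw [codeEntries]

theorem primrec_codeSum :
    Primrec fun x : (ℕ × ℕ) × List (ℕ × ℕ × List ℕ) => codeSum x.1.1 x.1.2 x.2 := by
  have e₀ : Primrec fun y : ((ℕ × ℕ) × List (ℕ × ℕ × List ℕ)) × ℕ × GaussCode =>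
      ((y.2.1, y.1.1.1), y.1.2) :=
    Primrec.pair (Primrec.pair (Primrec.fst.comp Primrec.snd)
      (Primrec.fst.comp (Primrec.fst.comp Primrec.fst))) (Primrec.snd.comp Primrec.fst)
  have e := primrec_codeEntries.comp e₀
  have r : Primrec fun y : ((ℕ × ℕ) × List (ℕ × ℕ × List ℕ)) × ℕ × GaussCode => y.2.2 :=
    Primrec.snd.comp Primrec.snd
  have h := primrec_foldr (f := fun x : (ℕ × ℕ) × List (ℕ × ℕ × List ℕ) => List.range x.1.2)
    (g := fun _ => ((0, 0, 0, 0) : GaussCode))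
    (h := fun x s r => (codeEntries s x.1.1 x.2).add r)
    (Primrec.list_range.comp (Primrec.snd.comp Primrec.fst)) (.const _) (primrec_add.comp e r)
  exact h.of_eq fun x => by rw [codeSum]

theorem primrec_codeBound : Primrec codeBound := by
  have h₁ : Primrec fun y : (List (ℕ × ℕ × List ℕ) × (ℕ × ℕ × List ℕ) × ℕ) × ℕ × ℕ =>
      y.2.1 + 1 + y.2.2 :=
    Primrec.nat_add.comp (Primrec.succ.comp (Primrec.fst.comp Primrec.snd))
      (Primrec.snd.comp Primrec.snd)
  have h₂ : Primrec fun y : List (ℕ × ℕ × List ℕ) × (ℕ × ℕ × List ℕ) × ℕ =>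
      y.2.1.2.2.foldr (fun c r => c + 1 + r) y.2.2 :=
    primrec_foldr (h := fun _ c r => c + 1 + r)
      (Primrec.snd.comp (Primrec.snd.comp (Primrec.fst.comp Primrec.snd)))
      (Primrec.snd.comp Primrec.snd) h₁
  exact (primrec_foldr (h := fun _ e r => e.2.2.foldr (fun c r => c + 1 + r) r) .id (.const 0)
    h₂).of_eq fun _ => rfl

theorem primrec_codeSize : Primrec codeSize := by
  have hB : Primrec fun t : List (ℕ × ℕ × List ℕ) => 2 ^ codeBound t :=
    primrec_pow.comp (.const 2) primrec_codeBound
  have e₀ : Primrec fun y : List (ℕ × ℕ × List ℕ) × ℕ × ℕ =>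
      ((y.2.1, 2 ^ codeBound y.1), y.1) :=
    Primrec.pair (Primrec.pair (Primrec.fst.comp Primrec.snd) (hB.comp Primrec.fst)) Primrec.fst
  have e := primrec_size.comp (primrec_codeSum.comp e₀)
  have r : Primrec fun y : List (ℕ × ℕ × List ℕ) × ℕ × ℕ => y.2.2 := Primrec.snd.comp Primrec.snd
  have h := primrec_foldr (f := fun t : List (ℕ × ℕ × List ℕ) => List.range (2 ^ codeBound t))
    (g := fun _ => 0) (h := fun t w r => (codeSum w (2 ^ codeBound t) t).size + r)
    (Primrec.list_range.comp hB) (.const 0) (Primrec.nat_add.comp e r)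
  exact h.of_eq fun t => by rw [codeSize]

/-- The decision procedure for zero diagrams. -/
def isZeroCode (x : ℕ × ℕ × List (ℕ × ℕ × List ℕ)) : Bool := decide (codeSize x.2.2 = 0)

theorem computable_isZeroCode : Computable isZeroCode := by
  have h : PrimrecPred fun x : ℕ × ℕ × List (ℕ × ℕ × List ℕ) => codeSize x.2.2 = 0 :=
    Primrec.eq.comp (primrec_codeSize.comp (Primrec.snd.comp Primrec.snd)) (.const 0)
  exact (primrecPred_iff_primrec_decide.mp h).to_comp

end Evaluation

/-! ### The evaluation decides whether the matrix vanishes -/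

section Correctness

variable {n m : ℕ}

/-- The labelling of the wires that belongs to `codeLabel`. -/
def bitLabel (s w : ℕ) : Wire n m → Fin 2
  | .input i => Fin.ofNat 2 (w / 2 ^ (3 * (i : ℕ)))
  | .output j => Fin.ofNat 2 (w / 2 ^ (3 * (j : ℕ) + 1))
  | .inner k => Fin.ofNat 2 (s / 2 ^ k)

theorem codeLabel_code (s w : ℕ) (x : Wire n m) : codeLabel s w x.code = bitLabel s w x := by
  cases x with
  | input i => simp [codeLabel, Wire.code, bitLabel]
  | output j => simp [codeLabel, Wire.code, bitLabel]
  | inner k =>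
    have h : (3 * k + 2) % 3 = 2 := by omega
    have h' : (3 * k + 2) / 3 = k := by omega
    simp [codeLabel, Wire.code, bitLabel, h, h']

theorem codeWeight_map_code (s w : ℕ) (l : List (Wire n m)) :
    codeWeight s w (l.map Wire.code) = (l.map fun x => (bitLabel s w x : ℕ)).sum := by
  induction l with
  | nil => rfl
  | cons x l ih =>
    rw [List.map_cons, codeWeight, List.foldr_cons, ← codeWeight, ih, codeLabel_code,
      List.map_cons, List.sum_cons]

theorem sum_bits_le (l : List (Wire n m)) (f : Wire n m → Fin 2) :
    (l.map fun x => (f x : ℕ)).sum ≤ l.length := by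
  induction l with
  | nil => rfl
  | cons x l ih =>
    have := (f x).isLt
    simp only [List.map_cons, List.sum_cons, List.length_cons]
    omega

theorem prod_ket0 (l : List (Wire n m)) (f : Wire n m → Fin 2) :
    (l.map fun x => ket0 (f x)).prod = if (l.map fun x => (f x : ℕ)).sum = 0 then 1 else 0 := by
  induction l with
  | nil => simp
  | cons x l ih =>
    simp only [List.map_cons, List.prod_cons, List.sum_cons, ih]
    generalize f x = y
    fin_cases y <;> simp

theorem prod_ket1 (l : List (Wire n m)) (f : Wire n m → Fin 2) :
    (l.map fun x => ket1 (f x)).prod =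
      if (l.map fun x => (f x : ℕ)).sum = l.length then 1 else 0 := by
  induction l with
  | nil => simp
  | cons x l ih =>
    have h := sum_bits_le l f
    simp only [List.map_cons, List.prod_cons, List.sum_cons, ih, List.length_cons]
    generalize f x = y
    fin_cases y
    · simp; omega
    · simp [add_comm 1]

theorem prod_ketPlus (l : List (Wire n m)) (f : Wire n m → Fin 2) :
    (l.map fun x => ketPlus (f x)).prod = sqrtHalf ^ l.length := by
  induction l with
  | nil => simp
  | cons x l ih =>
    simp only [List.map_cons, List.prod_cons, ih, List.length_cons]
    generalize f x = y
    fin_cases y <;> simp <;> ring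

theorem prod_ketMinus (l : List (Wire n m)) (f : Wire n m → Fin 2) :
    (l.map fun x => ketMinus (f x)).prod =
      sqrtHalf ^ l.length * (-1) ^ (l.map fun x => (f x : ℕ)).sum := by
  induction l with
  | nil => simp
  | cons x l ih =>
    simp only [List.map_cons, List.prod_cons, ih, List.length_cons, List.sum_cons]
    generalize f x = y
    fin_cases y <;> simp <;> ring

theorem value_ite (p : Prop) [Decidable p] (e : ℕ) :
    (if p then GaussCode.unit e else (0, 0, 0, 0)).value =
      if p then Complex.I ^ e else 0 := by
  split_ifs
  exacts [GaussCode.value_unit e, GaussCode.value_zero]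

/-- The factor `c` collects the powers of √½, which do not depend on the labels and so do not affect
vanishing of sums. A Hadamard node has sign `-1` only when both of its legs carry `1`, and a bare
wire is treated as a phaseless green node with two legs. -/
theorem value_codeEntry {e : ℕ × ℕ × List ℕ} {q : Piece n m} (h : Piece.IsCode e q) :
    ∃ c ≠ 0, ∀ s w, q.entry (bitLabel s w) = c * (codeEntry s w e).value := by
  cases h with
  | green α l =>
    refine ⟨1, one_ne_zero, fun s w => ?_⟩
    simp only [codeEntry, codeWeight_map_code, entry, Multiset.map_coe, Multiset.prod_coe,
      prod_ket0, prod_ket1, List.length_map, zero_ne_one, OfNat.zero_ne_ofNat, if_false,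
      GaussCode.value_add, value_ite, phase_eq]
    split_ifs <;> simp
  | red α l =>
    refine ⟨sqrtHalf ^ l.length, pow_ne_zero _ sqrtHalf_ne_zero, fun s w => ?_⟩
    simp only [codeEntry, codeWeight_map_code, entry, Multiset.map_coe, Multiset.prod_coe,
      prod_ketPlus, prod_ketMinus, if_true, GaussCode.value_add, GaussCode.value_unit, phase_eq,
      pow_add, pow_mul, Complex.I_sq]
    ring
  | had a b =>
    refine ⟨sqrtHalf, sqrtHalf_ne_zero, fun s w => ?_⟩
    have := codeWeight_map_code s w [a, b]
    simp only [List.map_cons, List.map_nil] at this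
    simp only [codeEntry, this, entry, OfNat.ofNat_ne_one, if_false, if_true,
      GaussCode.value_unit, List.sum_cons, List.sum_nil]
    generalize bitLabel s w a = x
    generalize bitLabel s w b = y
    fin_cases x <;> fin_cases y <;> simp
  | cord a b =>
    refine ⟨1, one_ne_zero, fun s w => ?_⟩
    have := codeWeight_map_code s w [a, b]
    simp only [List.map_cons, List.map_nil] at this
    simp only [codeEntry, this, entry, OfNat.ofNat_ne_one, if_false, Nat.reduceEqDiff,
      GaussCode.value_add, value_ite, List.sum_cons, List.sum_nil, List.length_cons,
      List.length_nil]
    generalize bitLabel s w a = x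
    generalize bitLabel s w b = y
    fin_cases x <;> fin_cases y <;> simp

theorem value_codeEntries {t : List (ℕ × ℕ × List ℕ)} {es : List (Piece n m)}
    (h : List.Forall₂ Piece.IsCode t es) :
    ∃ c ≠ 0, ∀ s w, entries (es : Multiset (Piece n m)) (bitLabel s w) =
      c * (codeEntries s w t).value := by
  induction h with
  | nil =>
    exact ⟨1, one_ne_zero, fun s w => by simp [entries, codeEntries, GaussCode.value_unit]⟩
  | cons h _ ih =>
    obtain ⟨c, hc, h1⟩ := ih
    obtain ⟨d, hd, h2⟩ := value_codeEntry h
    refine ⟨d * c, mul_ne_zero hd hc, fun s w => ?_⟩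
    rw [← Multiset.cons_coe, entries_cons, h1, h2]
    exact (mul_mul_mul_comm ..).trans (congrArg _ (GaussCode.value_mul ..).symm)

theorem value_codeSum (w N : ℕ) (t : List (ℕ × ℕ × List ℕ)) :
    (codeSum w N t).value = ∑ s ∈ Finset.range N, (codeEntries s w t).value := by
  have h : ∀ l : List ℕ, (l.foldr (fun s r => (codeEntries s w t).add r) (0, 0, 0, 0)).value =
      (l.map fun s => (codeEntries s w t).value).sum := by
    intro l
    induction l with
    | nil => exact GaussCode.value_zero
    | cons s l ih => rw [List.foldr_cons, GaussCode.value_add, ih, List.map_cons, List.sum_cons]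
  rw [codeSum, h, ← List.sum_toFinset _ (List.nodup_range), List.toFinset_range]

theorem codeSize_eq_zero (t : List (ℕ × ℕ × List ℕ)) :
    codeSize t = 0 ↔ ∀ w < 2 ^ codeBound t, (codeSum w (2 ^ codeBound t) t).value = 0 := by
  have h : ∀ l : List ℕ,
      l.foldr (fun w r => (codeSum w (2 ^ codeBound t) t).size + r) 0 = 0 ↔
        ∀ w ∈ l, (codeSum w (2 ^ codeBound t) t).value = 0 := by
    intro l
    induction l with
    | nil => simp
    | cons w l ih =>
      rw [List.foldr_cons, Nat.add_eq_zero_iff, ih, GaussCode.size_eq_zero, List.forall_mem_cons]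
  rw [codeSize, h]
  simp only [List.mem_range]

theorem lt_codeBound {t : List (ℕ × ℕ × List ℕ)} {e : ℕ × ℕ × List ℕ} (he : e ∈ t) {c : ℕ}
    (hc : c ∈ e.2.2) : c < codeBound t := by
  have h1 : ∀ (l : List ℕ) (r : ℕ), r ≤ l.foldr (fun c r => c + 1 + r) r ∧
      ∀ c ∈ l, c < l.foldr (fun c r => c + 1 + r) r := by
    intro l r
    induction l with
    | nil => simp
    | cons d l ih =>
      rw [List.foldr_cons]
      refine ⟨by omega, fun c hc => ?_⟩
      rcases List.mem_cons.mp hc with rfl | hc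
      · omega
      · have := ih.2 c hc; omega
  induction t with
  | nil => simp at he
  | cons d t ih =>
    rw [codeBound, List.foldr_cons, ← codeBound]
    rcases List.mem_cons.mp he with rfl | he
    · exact (h1 ..).2 c hc
    · exact (ih he).trans_le (h1 ..).1

theorem exists_isCode {t : List (ℕ × ℕ × List ℕ)} {es : List (Piece n m)}
    (h : List.Forall₂ Piece.IsCode t es) {q : Piece n m} (hq : q ∈ es) :
    ∃ e ∈ t, Piece.IsCode e q := by
  induction h with
  | nil => simp at hq
  | @cons e q' t es h _ ih =>
    rcases List.mem_cons.mp hq with rfl | hq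
    · exact ⟨e, List.mem_cons_self .., h⟩
    · obtain ⟨e, he, h⟩ := ih hq
      exact ⟨e, List.mem_cons_of_mem _ he, h⟩

theorem code_lt {t : List (ℕ × ℕ × List ℕ)} {es : List (Piece n m)}
    (h : List.Forall₂ Piece.IsCode t es) {x : Wire n m}
    (hx : x ∈ legs (es : Multiset (Piece n m))) : x.code < codeBound t := by
  have : ∃ e ∈ t, x.code ∈ e.2.2 := by
    obtain ⟨q, hq, hx⟩ := Multiset.mem_bind.mp hx
    obtain ⟨e, he, heq⟩ := exists_isCode h (Multiset.mem_coe.mp hq)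
    refine ⟨e, he, ?_⟩
    cases heq with
    | green α l => exact List.mem_map_of_mem (Multiset.mem_coe.mp hx)
    | red α l => exact List.mem_map_of_mem (Multiset.mem_coe.mp hx)
    | had a b =>
      simp only [Piece.legs, Multiset.insert_eq_cons, Multiset.mem_cons, Multiset.mem_singleton]
        at hx
      rcases hx with rfl | rfl <;> simp
    | cord a b =>
      simp only [Piece.legs, Multiset.insert_eq_cons, Multiset.mem_cons, Multiset.mem_singleton]
        at hx
      rcases hx with rfl | rfl <;> simp
  obtain ⟨e, he, hx⟩ := this
  exact lt_codeBound he hx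

/-- Summing over the bits of a number is contracting the corresponding inner wires. -/
theorem sum_bits_eq_contract (B : ℕ) (F : (Wire n m → Fin 2) → ℂ) (f : Wire n m → Fin 2) :
    ∑ s ∈ Finset.range (2 ^ B), F (fun x => match x with
      | .inner k => if k < B then Fin.ofNat 2 (s / 2 ^ k) else f (.inner k)
      | x => f x) = contract (Finset.range B) F f := by
  induction B generalizing f with
  | zero =>
    rw [pow_zero, Finset.range_one, Finset.sum_singleton, Finset.range_zero, contract_empty]
    congr 1
    funext x
    cases x <;> simp
  | succ B ih =>
    -- The numbers below `2 ^ (B + 1)` are split by their top bit, which is the label of the wire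
    -- `B`.
    rw [Finset.range_add_one, contract_insert Finset.notMem_range_self, ← ih, ← ih, pow_succ,
      mul_two, Finset.sum_range_add]
    congr 1 <;> refine Finset.sum_congr rfl fun s hs => congrArg F (funext fun x => ?_)
    all_goals
      have hs := Finset.mem_range.mp hs
      cases x with
      | input i => simp
      | output j => simp
      | inner k =>
        rcases lt_trichotomy k B with hk | rfl | hk
        -- Adding `2 ^ B` leaves the bits below `B` unchanged.
        · have h : (2 ^ B + s) / 2 ^ k % 2 = s / 2 ^ k % 2 := by
            obtain ⟨d, rfl⟩ := Nat.exists_eq_add_of_lt hk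
            rw [show 2 ^ (k + d + 1) = 2 ^ k * (2 * 2 ^ d) by ring,
              Nat.mul_add_div (by positivity)]
            omega
          have h' : k < B + 1 := by omega
          simp [hk, h', Fin.ext_iff, h]
        · simp [Nat.div_eq_of_lt hs, Nat.add_div_left]
        · have h1 : ¬ k < B + 1 := by omega
          have h2 : ¬ k < B := by omega
          simp [h1, h2, hk.ne']

/-- Ensures that a finite range of numbers `w` reaches all labellings of the inputs and outputs. -/
theorem exists_bits (B : ℕ) (g : ℕ → Fin 2) :
    ∃ w < 2 ^ B, ∀ c < B, Fin.ofNat 2 (w / 2 ^ c) = g c := by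
  induction B with
  | zero => exact ⟨0, by simp, by simp⟩
  | succ B ih =>
    obtain ⟨w, hw, h⟩ := ih
    have hg := (g B).isLt
    refine ⟨w + 2 ^ B * (g B : ℕ), ?_, fun c hc => ?_⟩
    · rw [pow_succ]; nlinarith [Nat.one_le_two_pow (n := B)]
    · rcases Nat.lt_succ_iff_lt_or_eq.mp hc with hc | rfl
      · rw [← h c hc]
        obtain ⟨d, rfl⟩ := Nat.exists_eq_add_of_lt hc
        rw [Fin.ext_iff, Fin.val_ofNat, Fin.val_ofNat,
          show 2 ^ (c + d + 1) * (g (c + d + 1) : ℕ) =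
            2 ^ c * (2 * (2 ^ d * (g (c + d + 1) : ℕ))) by ring,
          Nat.add_mul_div_left _ _ (by positivity)]
        omega
      · rw [Fin.ext_iff, Fin.val_ofNat, Nat.add_mul_div_left _ _ (by positivity),
          Nat.div_eq_of_lt hw]
        omega

theorem contract_congr_labels {P : Multiset (Piece n m)} {f g : Wire n m → Fin 2}
    (h : ∀ x ∈ legs P, (∀ k, x ≠ inner k) → f x = g x) :
    contract (inners (legs P)) (entries P) f = contract (inners (legs P)) (entries P) g := by
  refine Finset.sum_congr rfl fun s _ => entries_congr fun x hx => ?_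
  cases x with
  | input i => exact h _ hx (by simp)
  | output j => exact h _ hx (by simp)
  | inner k => simp [relabel, mem_inners.mpr hx]

/-- Every superfluous wire merely doubles the sum. The evaluation can thus run over all inner names
below a crude bound instead of those in use. -/
theorem contract_superset {P : Multiset (Piece n m)} {T : Finset ℕ}
    (h : inners (legs P) ⊆ T) :
    ∃ c ≠ 0, ∀ f, contract T (entries P) f = c * contract (inners (legs P)) (entries P) f := by
  refine ⟨((T \ inners (legs P)).powerset.card : ℂ), ?_, fun f => ?_⟩
  · rw [Finset.card_powerset]
    exact Nat.cast_ne_zero.mpr (pow_ne_zero _ two_ne_zero)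
  · have hi : IndepOf (T \ inners (legs P)) (contract (inners (legs P)) (entries P)) :=
      contract_indepOf (entries_indepOf fun k hk hk' =>
        (Finset.mem_sdiff.mp hk).2 (mem_inners.mpr hk'))
    rw [← Finset.sdiff_union_of_subset h, contract_union Finset.sdiff_disjoint,
      Finset.sdiff_union_of_subset h]
    have := contract_mul (G := fun _ => 1) hi f
    simp only [mul_one] at this
    rw [this, mul_comm]
    congr 1
    rw [contract, Finset.sum_const, nsmul_one]

theorem isZeroCode_iff {D : Diagram n m} {t : List (ℕ × ℕ × List ℕ)} (h : Diagram.IsCode t D) :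
    isZeroCode (n, m, t) = true ↔ D.interp = 0 := by
  classical
  obtain ⟨es, hD, hes⟩ := h
  obtain ⟨c, hc, h1⟩ := value_codeEntries hes
  have hlt : ∀ x ∈ legs D.pieces, x.code < codeBound t := fun x hx => code_lt hes (hD ▸ hx)
  -- The inner wire `k` has code `3 * k + 2`, so a bound for the codes also bounds the names.
  have hsub : inners (legs D.pieces) ⊆ Finset.range (codeBound t) := by
    intro k hk
    have := hlt _ (mem_inners.mp hk)
    rw [Wire.code] at this
    rw [Finset.mem_range]
    omega
  obtain ⟨d, hd, h2⟩ := contract_superset hsub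
  have key : ∀ w, (codeSum w (2 ^ codeBound t) t).value = 0 ↔
      contract (inners (legs D.pieces)) (entries D.pieces) (bitLabel 0 w) = 0 := by
    intro w
    have h3 : contract (Finset.range (codeBound t)) (entries D.pieces) (bitLabel 0 w) =
        c * (codeSum w (2 ^ codeBound t) t).value := by
      rw [← sum_bits_eq_contract, value_codeSum, Finset.mul_sum]
      refine Finset.sum_congr rfl fun s _ => ?_
      rw [← h1, ← hD]
      refine entries_congr fun x hx => ?_
      have hx' := hlt x hx
      cases x with
      | input i => rfl
      | output j => rfl
      | inner k =>
        rw [Wire.code] at hx'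
        have : k < codeBound t := by omega
        simp [this, bitLabel]
    rw [h2] at h3
    constructor
    · intro h
      rw [h, mul_zero] at h3
      exact (mul_eq_zero.mp h3).resolve_left hd
    · intro h
      rw [h, mul_zero] at h3
      exact (mul_eq_zero.mp h3.symm).resolve_left hc
  rw [isZeroCode, decide_eq_true_iff, codeSize_eq_zero, Diagram.interp_eq_zero]
  refine ⟨fun h f => ?_, fun h w _ => (key w).mpr (h _)⟩
  -- The bits of `w` are indexed by wire codes: bit `c` is the label under `f` of the wire with code
  -- `c`, and `0` where there is none. Injectivity of the coding makes the chosen wire the right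
  -- one.
  obtain ⟨w, hw, hwf⟩ := exists_bits (codeBound t) fun c =>
    if hx : ∃ x ∈ legs D.pieces, x.code = c then f hx.choose else 0
  rw [← (key w).mp (h w hw)]
  refine contract_congr_labels fun x hx hxi => ?_
  have hinj : ∀ x y : Wire n m, x.code = y.code → x = y := by
    intro x y hxy
    cases x <;> cases y <;> simp only [Wire.code] at hxy <;>
      first | (exfalso; omega) | (congr 1; omega)
  have hx' : ∃ y ∈ legs D.pieces, y.code = x.code := ⟨x, hx, rfl⟩
  have hw' := hwf x.code (hlt x hx)
  rw [dif_pos hx', hinj _ _ hx'.choose_spec.2] at hw'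
  rw [← hw']
  cases x with
  | input i => rfl
  | output j => rfl
  | inner k => exact absurd rfl (hxi k)

end Correctness

end ZX

theorem corollary2 :
    (∀ (n m : ℕ) (D : ZX.Diagram n m),
      (∃ D' : ZX.Diagram n m, D.Rewrites D' ∧ D'.IsNormalForm) ∧
      ∀ D' : ZX.Diagram n m, D.Rewrites D' → D'.IsNormalForm →
        (D.interp = 0 ↔ D'.ContainsZero)) ∧
    ∃ f : ℕ × ℕ × List (ℕ × ℕ × List ℕ) → Bool, Computable f ∧
      ∀ (n m : ℕ) (D : ZX.Diagram n m) (t : List (ℕ × ℕ × List ℕ)),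
        ZX.Diagram.IsCode t D → (f (n, m, t) = true ↔ D.interp = 0) :=
  ⟨fun _ _ D => ⟨D.exists_normalForm, fun _ h hD' => h.interp_eq_zero.trans hD'.interp_eq_zero⟩,
    ZX.isZeroCode, ZX.computable_isZeroCode, fun _ _ _ _ h => ZX.isZeroCode_iff h⟩
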